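/- **Setting.** Fix $T,L,\rho>0$, $K\in\mathbb N$, a Borel set $\mathcal Z\subseteq\mathbb R$, a finite measure $\varsigma$ on $\mathcal Z$, and a measurable $G:[0,T]\times\{e_1,\dots,e_K\}\times\mathcal Z\to(-1,\infty)$, continuous in time, with $\int_0^T\!\int_{\mathcal Z}G(t,e_i,\zeta)^2\,\varsigma(d\zeta)\,dt<\infty$ for all $i$. Let $(q^{i,j}(h))_{i,j}$, $h\in[-L,L]$, be generator matrices (off-diagonal entries nonnegative and continuous in $h$, row sums zero). Put $\eta(t,e_i,A)=\varsigma\{\zeta\in\mathcal Z: G(t,e_i,\zeta)\in A\setminus\{0\}\}$, and assume that for each $t\in[0,T]$ the measures $\eta(t,e_1,\cdot),\dots,\eta(t,e_K,\cdot)$ are mutually absolutely continuous. Let $u^i(t,\pi,z)=\big(\sum_j\pi^j\frac{d\eta(t,e_j,\cdot)}{d\eta(t,e_i,\cdot)}(z)\big)^{-1}-1$. Let $U:(0,\infty)\to\mathbb R$ be strictly increasing, strictly concave and $C^1$ with $U'(0+)=\infty$, $U'(\infty)=0$. The state space is $\widetilde{\mathcal X}=[0,T]\times(0,\infty)\times\Delta_K$,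 with points $\widetilde x=(t,w,\pi)$, where $\Delta_K$ is the probability simplex in $\mathbb R^K$. A strategy is a sequence $\{h^n\}_{n\ge 0}$ of jointly measurable maps $(\widetilde x,s)\mapsto h^n(\widetilde x)(s)\in[-L,L]$, $s\in[0,T]$. It is admissible if $\eta(t+s,e_i,\{z:1+h^n(\widetilde x)(s)z\le 0\})=0$ for all $n$, $i$, $\widetilde x=(t,w,\pi)\in\widetilde{\mathcal X}$ and $s\in[0,T-t]$. **The PDMP.** Between jumps the state moves along $\frac{d}{ds}\varphi_s=g(\varphi_s,\alpha_s)$, where $$g(\widetilde x,h)=\Big(1,\;w(1-h)\rho,\;\Big(\sum_j\pi^j\big(q^{j,i}(h)-\int\pi^iu^i(t,\pi,z)\,\eta(t,e_j,dz)\big)\Big)_{i}\Big);$$ write $\varphi^\alpha_s(\widetilde x)$ for the flow started in $\widetilde x$ under a measurable control $\alpha$, and $w_s$ for its wealth component. The jump rate is $\lambda(\widetilde x)=\sum_i\pi^i\eta(t,e_i,\mathbb R)$, and, where $\lambda(\widetilde x)>0$, the post-jump law is $$Qf(\widetilde x,h)=\frac1{\lambda(\widetilde x)}\sum_j\pi^j\int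 f\big(t,\,w(1+hz),\,(\pi^i(1+u^i(t,\pi,z)))_i\big)\,\eta(t,e_j,dz).$$ After the $n$-th jump $T_n$ ($T_0$ is the initial time) the control at time $T_n+s$ is $h^n(\widetilde X_{T_n})(s)$. Let $\Lambda^\alpha_s(\widetilde x)=\int_0^s\lambda(\varphi^\alpha_v(\widetilde x))\,dv$. The law $\mathbb P^{\{h^n\}}_{\widetilde x}$ of the PDMP $\widetilde X=(t,W,\pi)$ started in $\widetilde x$ is given as follows: up to the horizon $T$, given the past up to $T_n$, the waiting time for the next jump exceeds $s$ with probability $e^{-\Lambda_s}$; given in addition $T_{n+1}$, the post-jump state has law $Q$ evaluated at the state and control just before the jump. With expectation $\mathbb E^{\{h^n\}}_{\widetilde x}$ under this law put $$J(\widetilde x,\{h^n\})=\mathbb E^{\{h^n\}}_{\widetilde x}[U(W_T)],\qquad V(\widetilde x)=\sup_{\{h^n\}\text{ admissible}}J(\widetilde x,\{h^n\}).$$ **The Markov decision model.** It has state space $\widetilde{\mathcal X}\cup\{\Delta\}$ with $\Delta$ absorbing. The actions are measurable maps $\alpha:[0,T]\to[-L,L]$, the transition kernel at $\widetilde x=(t,w,\pi)$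 is $$Q_Lf(\widetilde x,\alpha)=\int_0^{T-t}\lambda(\varphi^\alpha_v(\widetilde x))\,e^{-\Lambda^\alpha_v(\widetilde x)}\,Qf(\varphi^\alpha_v(\widetilde x),\alpha_v)\,dv+e^{-\Lambda^\alpha_{T-t}(\widetilde x)}f(\Delta),$$ and the one-stage reward is $r(\widetilde x,\alpha)=e^{-\Lambda^\alpha_{T-t}(\widetilde x)}U(w_{T-t})$, $r(\Delta)=0$. Let $(L_n)_{n\ge0}$ be the Markov chain with $L_0=\widetilde x$ and transition kernels $Q_L(\cdot\mid L_n,h^n(L_n))$, and, with expectation under the law of this chain, put $$J_\infty^{\{h^n\}}(\widetilde x)=\mathbb E\Big[\sum_{n=0}^\infty r(L_n,h^n(L_n))\Big],\qquad J_\infty(\widetilde x)=\sup_{\{h^n\}\text{ admissible}}J_\infty^{\{h^n\}}(\widetilde x).$$ **Lemma 4.2.** For every admissible strategy $\{h^n\}$ and every $\widetilde x\in\widetilde{\mathcal X}$, the laws of the PDMP and of the chain $(L_n)$ exist and are unique, almost surely $L_n=\Delta$ for all large $n$, the positive parts of $U(W_T)$ and of $\sum_n r(L_n,h^n(L_n))$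 have finite expectation (so that both expectations are well defined in $[-\infty,\infty)$), and $$J(\widetilde x,\{h^n\})=J_\infty^{\{h^n\}}(\widetilde x).$$ Hence $V(\widetilde x)=J_\infty(\widetilde x)$ for every $\widetilde x\in\widetilde{\mathcal X}$. -/

import Mathlib

open MeasureTheory ProbabilityTheory Set Filter Topology
open scoped ENNReal

/-- Data of the market with `K` hidden states: horizon `T`, bound `L` on the portfolio weight,
risk-free rate `ρ`, controlled generator matrix `q`, mark space `Z ⊆ ℝ` with the finite intensity
measure `ς` of the Poisson random measure, and the return jump `G t i ζ` in state `i`.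
Only the values for `t ∈ [0,T]`, `ζ ∈ Z` and `h ∈ [-L,L]` matter. -/
structure MarketData (K : ℕ) where
  T : ℝ
  L : ℝ
  ρ : ℝ
  q : Fin K → Fin K → ℝ → ℝ
  Z : Set ℝ
  ς : Measure ℝ
  G : ℝ → Fin K → ℝ → ℝ
  measurableSet_Z : MeasurableSet Z
  finite_ς : IsFiniteMeasure ς
  measurable_G : ∀ i, Measurable fun p : ℝ × ℝ => G p.1 i p.2

/-- Points `(t, w, π)`: time, wealth, filter. -/
abbrev State (K : ℕ) : Type := ℝ × ℝ × (Fin K → ℝ)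

/-- States together with the cemetery `Δ = Sum.inr ()`. -/
abbrev ExtState (K : ℕ) : Type := State K ⊕ Unit

/-- Sequences `(L₀, L₁, …)` in the state space with cemetery. -/
abbrev PathSpace (K : ℕ) : Type := ℕ → ExtState K

/-- A sequence of feedback maps: `h n x s` is the portfolio weight used `s` time units after the
`n`-th jump, if the state just after that jump is `x`. -/
abbrev Strategy (K : ℕ) : Type := ℕ → State K → ℝ → ℝ

/-- Utility functions on `(0,∞)`: strictly increasing, strictly concave, continuously
differentiable, with the Inada conditions. -/
structure IsUtility (U : ℝ → ℝ) : Prop where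
  strictMonoOn : StrictMonoOn U (Ioi 0)
  strictConcaveOn : StrictConcaveOn ℝ (Ioi 0) U
  contDiffOn : ContDiffOn ℝ 1 U (Ioi 0)
  inada_zero : Tendsto (deriv U) (𝓝[>] 0) atTop
  inada_top : Tendsto (deriv U) atTop (𝓝 0)

/-- Expectation of a real random variable with values in `[-∞, ∞]`, `E[f⁺] - E[f⁻]`; it is used
where the positive part has finite expectation. -/
noncomputable def extExpectation {Ω : Type*} [MeasurableSpace Ω] (μ : Measure Ω) (f : Ω → ℝ) :
    EReal :=
  ((∫⁻ ω, ENNReal.ofReal (f ω) ∂μ : ℝ≥0∞) : EReal)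
    - ((∫⁻ ω, ENNReal.ofReal (-f ω) ∂μ : ℝ≥0∞) : EReal)

/-- The time `Tₙ` of the `n`-th jump; `⊤` means that there is no `n`-th jump before the horizon. -/
noncomputable def jumpTime {K : ℕ} (ω : PathSpace K) (n : ℕ) : EReal :=
  Sum.elim (fun x : State K => (x.1 : EReal)) (fun _ => ⊤) (ω n)

namespace MarketData

variable {K : ℕ} (M : MarketData K)

/-- The compensator measures `η(t, e_i, dz)` as a finite kernel in `t`: the image of `ς` on `Z`
under `G t i`, without the atom at `0` (see `eta_apply`). -/
noncomputable def eta (i : Fin K) : Kernel ℝ ℝ where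
  toFun t := (M.ς.restrict (M.Z ∩ {ζ | M.G t i ζ ≠ 0})).map (M.G t i)
  measurable' := by
    have := M.finite_ς
    have hm : ∀ t, Measurable (M.G t i) := fun t => (M.measurable_G i).comp measurable_prodMk_left
    refine Measure.measurable_of_measurable_coe _ fun A hA => ?_
    have hS : MeasurableSet ({p : ℝ × ℝ | M.G p.1 i p.2 ∈ A} ∩
        ((Prod.snd ⁻¹' M.Z) ∩ {p : ℝ × ℝ | M.G p.1 i p.2 ≠ 0})) :=
      (M.measurable_G i hA).inter ((measurable_snd M.measurableSet_Z).inter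
        (M.measurable_G i (measurableSet_singleton 0).compl))
    have key : (fun t => ((M.ς.restrict (M.Z ∩ {ζ | M.G t i ζ ≠ 0})).map (M.G t i)) A) =
        fun t => M.ς (Prod.mk t ⁻¹' ({p : ℝ × ℝ | M.G p.1 i p.2 ∈ A} ∩
          ((Prod.snd ⁻¹' M.Z) ∩ {p : ℝ × ℝ | M.G p.1 i p.2 ≠ 0}))) := by
      funext t
      rw [Measure.map_apply (hm t) hA, Measure.restrict_apply (hm t hA)]
      rfl
    rw [key]
    exact measurable_measure_prodMk_left hS

theorem eta_apply (i : Fin K) (t : ℝ) {A : Set ℝ} (hA : MeasurableSet A) :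
    M.eta i t A = M.ς {ζ | ζ ∈ M.Z ∧ M.G t i ζ ∈ A \ {0}} := by
  have hm : Measurable (M.G t i) := (M.measurable_G i).comp measurable_prodMk_left
  change ((M.ς.restrict (M.Z ∩ {ζ | M.G t i ζ ≠ 0})).map (M.G t i)) A = _
  rw [Measure.map_apply hm hA, Measure.restrict_apply (hm hA)]
  congr 1
  ext ζ
  simp only [mem_inter_iff, mem_preimage, mem_ofPred_eq, Set.mem_sdiff, mem_singleton_iff]
  tauto

/-- Standing assumptions on the market. The last field is what the densities
`dη(t,e_j)/dη(t,e_i)` in the filtering equation presuppose. -/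
structure Standing : Prop where
  T_pos : 0 < M.T
  L_pos : 0 < M.L
  ρ_pos : 0 < M.ρ
  q_continuous : ∀ i j, i ≠ j → ContinuousOn (M.q i j) (Icc (-M.L) M.L)
  q_nonneg : ∀ i j, i ≠ j → ∀ h ∈ Icc (-M.L) M.L, 0 ≤ M.q i j h
  q_diag : ∀ i, ∀ h ∈ Icc (-M.L) M.L, M.q i i h = -∑ j ∈ Finset.univ.erase i, M.q i j h
  G_continuous : ∀ i, ∀ ζ ∈ M.Z, ContinuousOn (fun t => M.G t i ζ) (Icc 0 M.T)
  G_gt : ∀ t ∈ Icc 0 M.T, ∀ i, ∀ ζ ∈ M.Z, 0 < 1 + M.G t i ζ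
  G_sq : ∀ i, ∫⁻ t in Icc 0 M.T, ∫⁻ ζ in M.Z, ENNReal.ofReal (M.G t i ζ ^ 2) ∂M.ς < ⊤
  eta_ac : ∀ t ∈ Icc 0 M.T, ∀ i j, M.eta j t ≪ M.eta i t

/-- The augmented state space `[0,T] × (0,∞) × Δ_K`. -/
def stateSpace : Set (State K) :=
  {x | x.1 ∈ Icc 0 M.T ∧ 0 < x.2.1 ∧ x.2.2 ∈ stdSimplex ℝ (Fin K)}

/-- `uⁱ(t, π, z) = 1 / (∑ⱼ πʲ dη(t,e_j)/dη(t,e_i)(z)) - 1`, with the jointly measurable version of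
the Radon-Nikodym derivatives. -/
noncomputable def u (i : Fin K) (t : ℝ) (π : Fin K → ℝ) (z : ℝ) : ℝ :=
  1 / (∑ j, π j * (Kernel.rnDeriv (M.eta j) (M.eta i) t z).toReal) - 1

/-- The vector field `g(x, h)` of the motion between jumps. -/
noncomputable def g (x : State K) (h : ℝ) : State K :=
  (1, x.2.1 * (1 - h) * M.ρ, fun i => ∑ j, x.2.2 j *
    (M.q j i h - ∫ z, x.2.2 i * M.u i x.1 x.2.2 z ∂(M.eta j x.1)))

/-- The jump rate `λ(t, w, π) = ∑ᵢ πⁱ η(t, e_i, ℝ)`. -/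
noncomputable def rate (x : State K) : ℝ :=
  ∑ i, x.2.2 i * (M.eta i x.1).real univ

/-- The state after a jump of the return process of size `z`, with portfolio weight `h`. -/
noncomputable def jumpMap (x : State K) (h z : ℝ) : State K :=
  (x.1, x.2.1 * (1 + h * z), fun i => x.2.2 i * (1 + M.u i x.1 x.2.2 z))

/-- The transition kernel `Q` of the jumps, as an operator on nonnegative functions:
`Q f (x, h) = λ(x)⁻¹ ∑ⱼ πʲ ∫ f(jumpMap x h z) η(t, e_j, dz)`. (It is `0` where `λ(x) = 0`; there
no jump occurs.) -/
noncomputable def jumpOp (f : State K → ℝ≥0∞) (x : State K) (h : ℝ) : ℝ≥0∞ :=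
  (∑ j, ENNReal.ofReal (x.2.2 j) * ∫⁻ z, f (M.jumpMap x h z) ∂(M.eta j x.1))
    / ENNReal.ofReal (M.rate x)

/-- `φ` solves `φ' = g(φ, α)`, `φ(0) = x` on `[0, T - t]`, `x = (t, w, π)`, inside the state space
(in the integrated sense, the control `α` being only measurable). -/
structure IsTrajectory (α : ℝ → ℝ) (x : State K) (φ : ℝ → State K) : Prop where
  mem : ∀ s ∈ Icc 0 (M.T - x.1), φ s ∈ M.stateSpace
  integrable : IntervalIntegrable (fun r => M.g (φ r) (α r)) volume 0 (M.T - x.1)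
  eq : ∀ s ∈ Icc 0 (M.T - x.1), φ s = x + ∫ r in 0..s, M.g (φ r) (α r)

open Classical in
/-- The flow `φ^α_s(x)`: the solution of the initial value problem. -/
noncomputable def flow (α : ℝ → ℝ) (x : State K) (s : ℝ) : State K :=
  if H : ∃ φ, M.IsTrajectory α x φ then H.choose s else x

/-- `Λ^α_s(x) = ∫₀ˢ λ(φ^α_u(x)) du`. -/
noncomputable def cumRate (α : ℝ → ℝ) (x : State K) (s : ℝ) : ℝ :=
  ∫ v in 0..s, M.rate (M.flow α x v)

/-- Admissible strategies: jointly measurable, with values in `[-L, L]`, and such that jumps keep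
the wealth positive: `η(t, e_i, ·)` does not charge `{z | 1 + h_t z ≤ 0}`. -/
structure Admissible (h : Strategy K) : Prop where
  measurable : ∀ n, Measurable (Function.uncurry (h n))
  mem_Icc : ∀ n, ∀ x ∈ M.stateSpace, ∀ s ∈ Icc 0 M.T, h n x s ∈ Icc (-M.L) M.L
  wealth_pos : ∀ n, ∀ x ∈ M.stateSpace, ∀ s ∈ Icc 0 (M.T - x.1), ∀ i,
    M.eta i (x.1 + s) {z | 1 + h n x s * z ≤ 0} = 0

/-! The controlled PDMP -/

/-- `μ` is the law, under the strategy `h` and started in `x`, of the sequence of jump times and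
post-jump states of the PDMP with characteristics `(g, λ, Q)` on the time interval up to `T`.
The entry `ω n` is `(Tₙ, X_{Tₙ})`, and `Δ` if there is no `n`-th jump before `T`; `A` runs through
the events determined by the first `n` jumps.
* `survival`: given the past up to the `n`-th jump, `T_{n+1} - Tₙ > s` has probability
  `exp (-Λ_s)`; nothing jumps after the horizon.
* `location`: given this past and `T_{n+1}`, the state after the jump has the law
  `Q(· | y, a)`, with `y` the state and `a` the control just before the jump. -/
structure IsPDMPLaw (h : Strategy K) (x : State K) (μ : Measure (PathSpace K)) : Prop where
  prob : IsProbabilityMeasure μ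
  initial : ∀ᵐ ω ∂μ, ω 0 = Sum.inl x
  absorbed : ∀ n, ∀ᵐ ω ∂μ, ω n = Sum.inr () → ω (n + 1) = Sum.inr ()
  survival : ∀ n, ∀ A : Set (PathSpace K), MeasurableSet[Filtration.piLE n] A → ∀ s : ℝ, 0 ≤ s →
    μ (A ∩ {ω | ∃ y, ω n = Sum.inl y ∧ ((y.1 + s : ℝ) : EReal) < jumpTime ω (n + 1)}) =
      ∫⁻ ω in A, Sum.elim
        (fun y => ENNReal.ofReal (Real.exp (-M.cumRate (h n y) y (min s (M.T - y.1)))))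
        (fun _ => 0) (ω n) ∂μ
  location : ∀ n, ∀ A : Set (PathSpace K), MeasurableSet[Filtration.piLE n] A →
    ∀ B : Set ℝ, MeasurableSet B → ∀ f : State K → ℝ≥0∞, Measurable f →
    ∫⁻ ω in A, Sum.elim (fun y' => B.indicator 1 y'.1 * f y') (fun _ => 0) (ω (n + 1)) ∂μ =
      ∫⁻ ω in A, Sum.elim
        (fun y => Sum.elim
          (fun y' => B.indicator 1 y'.1 *
            M.jumpOp f (M.flow (h n y) y (y'.1 - y.1)) (h n y (y'.1 - y.1)))
          (fun _ => 0) (ω (n + 1)))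
        (fun _ => 0) (ω n) ∂μ

/-- The law of the PDMP under the strategy `h`, started in `x`. -/
noncomputable def pdmpLaw (h : Strategy K) (x : State K) : Measure (PathSpace K) :=
  Classical.epsilon (M.IsPDMPLaw h x)

open Classical in
/-- The state `X_s = φ_{s - Tₙ}(X_{Tₙ})` for `Tₙ ≤ s < T_{n+1}` (a constant outside the
null event that there is no such `n`). -/
noncomputable def stateAt (h : Strategy K) (ω : PathSpace K) (s : ℝ) : State K :=
  if H : ∃ n, jumpTime ω n ≤ (s : EReal) ∧ (s : EReal) < jumpTime ω (n + 1) then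
    Sum.elim (fun y => M.flow (h (Nat.find H) y) y (s - y.1)) (fun _ => 0) (ω (Nat.find H))
  else 0

/-- The terminal wealth `W_T`. -/
noncomputable def terminalWealth (h : Strategy K) (ω : PathSpace K) : ℝ :=
  (M.stateAt h ω M.T).2.1

/-- The reward function `J(x, h) = E_x^h[U(W_T)]` of the PDMP control problem. -/
noncomputable def pdmpReward (U : ℝ → ℝ) (h : Strategy K) (x : State K) : EReal :=
  extExpectation (M.pdmpLaw h x) fun ω => U (M.terminalWealth h ω)

/-- The value function `V` of the PDMP control problem. -/
noncomputable def pdmpValue (U : ℝ → ℝ) (x : State K) : EReal :=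
  ⨆ (h : Strategy K) (_ : M.Admissible h), M.pdmpReward U h x

/-! The Markov decision model -/

/-- The transition kernel `Q_L` of the Markov decision model in the state `x = (t, w, π)` under the
action `α`, as an operator on nonnegative functions:
`∫₀^{T-t} λ_v e^{-Λ_v} (Q f)(φ_v, α_v) dv + e^{-Λ_{T-t}} f(Δ)`. -/
noncomputable def mdmOp (f : ExtState K → ℝ≥0∞) (x : State K) (α : ℝ → ℝ) : ℝ≥0∞ :=
  (∫⁻ v in Ioc 0 (M.T - x.1),
    ENNReal.ofReal (M.rate (M.flow α x v) * Real.exp (-M.cumRate α x v)) *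
      M.jumpOp (fun y => f (Sum.inl y)) (M.flow α x v) (α v))
  + ENNReal.ofReal (Real.exp (-M.cumRate α x (M.T - x.1))) * f (Sum.inr ())

/-- `ν` is the law of the chain `(Lₙ)` of the Markov decision model with transition kernel `Q_L`
(where `Δ` is absorbing), under the policy `h`, started in `x`. -/
structure IsMDMLaw (h : Strategy K) (x : State K) (ν : Measure (PathSpace K)) : Prop where
  prob : IsProbabilityMeasure ν
  initial : ∀ᵐ ω ∂ν, ω 0 = Sum.inl x
  transition : ∀ n, ∀ A : Set (PathSpace K), MeasurableSet[Filtration.piLE n] A →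
    ∀ f : ExtState K → ℝ≥0∞, Measurable f →
    ∫⁻ ω in A, f (ω (n + 1)) ∂ν =
      ∫⁻ ω in A, Sum.elim (fun y => M.mdmOp f y (h n y)) (fun _ => f (Sum.inr ())) (ω n) ∂ν

/-- The law of the Markov decision model under the policy `h`, started in `x`. -/
noncomputable def mdmLaw (h : Strategy K) (x : State K) : Measure (PathSpace K) :=
  Classical.epsilon (M.IsMDMLaw h x)

/-- The one-stage reward `r(x, α) = e^{-Λ_{T-t}} U(w_{T-t})`. -/
noncomputable def stageReward (U : ℝ → ℝ) (x : State K) (α : ℝ → ℝ) : ℝ :=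
  Real.exp (-M.cumRate α x (M.T - x.1)) * U (M.flow α x (M.T - x.1)).2.1

/-- The total reward `∑ₙ r(Lₙ, hⁿ(Lₙ))` along a path, with `r(Δ) = 0`. -/
noncomputable def totalReward (U : ℝ → ℝ) (h : Strategy K) (ω : PathSpace K) : ℝ :=
  ∑' n, Sum.elim (fun y => M.stageReward U y (h n y)) (fun _ => 0) (ω n)

/-- The expected total reward `J_∞^h(x)` of the Markov decision model. -/
noncomputable def mdmReward (U : ℝ → ℝ) (h : Strategy K) (x : State K) : EReal :=
  extExpectation (M.mdmLaw h x) (M.totalReward U h)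

/-- The value function `J_∞` of the Markov decision model. -/
noncomputable def mdmValue (U : ℝ → ℝ) (x : State K) : EReal :=
  ⨆ (h : Strategy K) (_ : M.Admissible h), M.mdmReward U h x

end MarketData

/-! ### Primitives of integrable functions -/

/-! Between jumps the process follows a deterministic flow, so the sequence of jump times and
post-jump states determines the whole path. Under the PDMP law the waiting time after `Tₙ` has
survival function `exp (-Λ)`. It therefore has the density `λ exp (-Λ)` on the remaining interval,
and the mass `exp (-Λ_{T-t})` is left for "no further jump". Integrating the post-jump law `Q`
against this density gives exactly `Q_L`. Hence the two descriptions characterise the same measure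
on path space (`isPDMPLaw_iff_isMDMLaw`), namely the law of a Markov chain, which exists by the
Ionescu-Tulcea theorem and is unique because the transitions determine all finite-dimensional laws.

For this, `Q_L` must come from genuine kernels, so the flow has to exist and to depend measurably on
the initial state. The integral in the filter drift simplifies by Bayes' formula (`filter_drift`),
and the filter becomes the normalisation of a linear system with nonnegative coefficients, solved by
monotone Picard iteration (`exists_measurable_trajectory`). Uniqueness of trajectories is Grönwall's
inequality. As `flow` is defined by choice, it is replaced by a measurable version `Φ` that agrees
with it on the state space (`IsFlowVersion`).

From every state the probability of absorption in one step is bounded below, so a.s. there is a last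
jump `n`, and `W_T` is the wealth of the flow started in `Lₙ`. Given `Lₙ` this jump is the last one
with probability `exp (-Λ_{T-Tₙ})`. So for `f ≥ 0` the expectation of `f (W_T)` is the expected sum
of the discounted payoffs (`lintegral_terminalWealth`). This is applied to the positive and the
negative part of `U`. The difference makes sense because `U` is at most affine and the expected
terminal wealth is finite: `w` times `growthFactor t` is superharmonic (`wealth_superharmonic`). -/

theorem LipschitzOnWith.comp_absolutelyContinuousOnInterval {φ F : ℝ → ℝ} {C : NNReal} {S : Set ℝ}
    {a b : ℝ} (hφ : LipschitzOnWith C φ S) (hF : AbsolutelyContinuousOnInterval F a b)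
    (hS : ∀ s ∈ uIcc a b, F s ∈ S) :
    AbsolutelyContinuousOnInterval (fun s => φ (F s)) a b := by
  unfold AbsolutelyContinuousOnInterval at *
  have h0 := hF.const_mul (C : ℝ)
  rw [mul_zero] at h0
  refine squeeze_zero' (Eventually.of_forall fun E => Finset.sum_nonneg fun i _ => dist_nonneg) ?_ h0
  rw [eventually_inf_principal]
  refine Eventually.of_forall fun E hE => ?_
  rw [Finset.mul_sum]
  refine Finset.sum_le_sum fun i hi => ?_
  have := hE.1 i hi
  exact hφ.dist_le_mul _ (hS _ this.1) _ (hS _ this.2)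

/-- As `f` is only integrable, its primitive is differentiable only almost everywhere, and absolute
continuity has to replace the chain rule. The primitive is bounded on the interval and `exp` is
Lipschitz below that bound, so the composition is absolutely continuous and is the integral of its
derivative. -/
theorem exp_primitive {f : ℝ → ℝ} {τ : ℝ} (hf : IntervalIntegrable f volume 0 τ)
    {s : ℝ} (hs : s ∈ Icc 0 τ) :
    ∫ r in 0..s, f r * Real.exp (∫ v in 0..r, f v) = Real.exp (∫ v in 0..s, f v) - 1 := by
  have hsub : uIcc 0 s ⊆ uIcc 0 τ := by
    rw [uIcc_of_le hs.1, uIcc_of_le (hs.1.trans hs.2)]; exact Icc_subset_Icc le_rfl hs.2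
  have hfs : IntervalIntegrable f volume 0 s := hf.mono_set hsub
  have hac := hfs.absolutelyContinuousOnInterval_intervalIntegral (c := 0) (by simp)
  obtain ⟨B, hB⟩ := hac.exists_bound
  have hlip : LipschitzOnWith (Real.toNNReal (Real.exp B)) Real.exp (Iic B) := by
    refine (convex_Iic B).lipschitzOnWith_of_nnnorm_hasDerivWithin_le
      (f' := Real.exp) (fun x _ => (Real.hasDerivAt_exp x).hasDerivWithinAt) fun x hx => ?_
    rw [← NNReal.coe_le_coe]
    simp only [coe_nnnorm, Real.norm_eq_abs, abs_of_pos (Real.exp_pos x),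
      Real.coe_toNNReal _ (Real.exp_pos B).le, Real.exp_le_exp]
    exact hx
  have hE := hlip.comp_absolutelyContinuousOnInterval hac
    (fun r hr => (le_abs_self _).trans (hB r hr))
  have h1 := hE.integral_deriv_eq_sub
  simp only [intervalIntegral.integral_same, Real.exp_zero] at h1
  rw [← h1]
  refine intervalIntegral.integral_congr_ae ?_
  filter_upwards [hfs.ae_hasDerivAt_integral] with r hr hr'
  have := (hr (uIoc_subset_uIcc hr') 0 (by simp)).exp
  rw [this.deriv, mul_comm]

/-- Integration by parts for absolutely continuous functions, with initial values `c` and `d`. -/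
theorem mul_primitive {f g : ℝ → ℝ} {τ : ℝ} (hf : IntervalIntegrable f volume 0 τ)
    (hg : IntervalIntegrable g volume 0 τ) (c d : ℝ) {s : ℝ} (hs : s ∈ Icc 0 τ) :
    ∫ r in 0..s, (f r * (d + ∫ v in 0..r, g v) + (c + ∫ v in 0..r, f v) * g r) =
      (c + ∫ v in 0..s, f v) * (d + ∫ v in 0..s, g v) - c * d := by
  have hsub : uIcc 0 s ⊆ uIcc 0 τ := by
    rw [uIcc_of_le hs.1, uIcc_of_le (hs.1.trans hs.2)]; exact Icc_subset_Icc le_rfl hs.2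
  have hfs : IntervalIntegrable f volume 0 s := hf.mono_set hsub
  have hgs : IntervalIntegrable g volume 0 s := hg.mono_set hsub
  have hc : ∀ c : ℝ, AbsolutelyContinuousOnInterval (fun _ : ℝ => c) 0 s := fun c =>
    ((LipschitzWith.const c).lipschitzOnWith (s := uIcc 0 s)).absolutelyContinuousOnInterval
  have hF := (hc c).fun_add (hfs.absolutelyContinuousOnInterval_intervalIntegral (c := 0) (by simp))
  have hG := (hc d).fun_add (hgs.absolutelyContinuousOnInterval_intervalIntegral (c := 0) (by simp))
  have h1 := hF.integral_deriv_mul_eq_sub hG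
  simp only [intervalIntegral.integral_same, add_zero] at h1
  rw [← h1]
  refine intervalIntegral.integral_congr_ae ?_
  filter_upwards [hfs.ae_hasDerivAt_integral, hgs.ae_hasDerivAt_integral] with r hr hr2 hr'
  have e1 := (hr (uIoc_subset_uIcc hr') 0 (by simp)).const_add c
  have e2 := (hr2 (uIoc_subset_uIcc hr') 0 (by simp)).const_add d
  rw [e1.deriv, e2.deriv]

/-- The integral form of Grönwall's inequality with zero initial value. -/
theorem eq_zero_of_le_mul_integral {u : ℝ → ℝ} {C τ : ℝ} 
    (hu : ContinuousOn u (Icc 0 τ)) (h0 : ∀ s ∈ Icc 0 τ, 0 ≤ u s)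
    (hle : ∀ s ∈ Icc 0 τ, u s ≤ C * ∫ r in 0..s, u r) : ∀ s ∈ Icc 0 τ, u s = 0 := by
  intro s hs
  have hτ : 0 ≤ τ := hs.1.trans hs.2
  have hui : IntervalIntegrable u volume 0 τ := by
    apply ContinuousOn.intervalIntegrable; rwa [uIcc_of_le hτ]
  -- The integrating factor `exp (-C s)`: the derivative of `exp (-C s) ∫ u` is `(u - C ∫ u) exp (-C
  -- s) ≤ 0`.
  have hc := fun s hs => mul_primitive (c := 0) (d := 1) (s := s) hui (g := fun r => -C * Real.exp (-C * r))
    (Continuous.intervalIntegrable (by fun_prop) _ _) hs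
  have hexp : ∀ r : ℝ, 1 + ∫ v in 0..r, -C * Real.exp (-C * v) = Real.exp (-C * r) := by
    intro r
    have := intervalIntegral.integral_eq_sub_of_hasDerivAt (a := 0) (b := r)
      (f := fun v => Real.exp (-C * v)) (f' := fun v => -C * Real.exp (-C * v)) (fun x _ => by
        have := ((hasDerivAt_id x).const_mul (-C)).exp
        simpa [mul_comm] using this) (Continuous.intervalIntegrable (by fun_prop) _ _)
    rw [this]; simp
  simp only [hexp, zero_add, zero_mul, sub_zero] at hc
  have hI : ∫ r in 0..s, u r ≤ 0 := by
    have h1 := hc s hs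
    have h2 : ∫ r in 0..s, (u r * Real.exp (-C * r) + (∫ v in 0..r, u v) * (-C * Real.exp (-C * r))) ≤ 0 := by
      rw [intervalIntegral.integral_of_le hs.1]
      refine setIntegral_nonpos measurableSet_Ioc fun r hr => ?_
      have := hle r ⟨hr.1.le, hr.2.trans hs.2⟩
      have h3 := Real.exp_pos (-C * r)
      nlinarith
    rw [h1] at h2
    exact nonpos_of_mul_nonpos_left h2 (Real.exp_pos _)
  have hI' : 0 ≤ ∫ r in 0..s, u r := intervalIntegral.integral_nonneg hs.1 fun r hr =>
    h0 r ⟨hr.1, hr.2.trans hs.2⟩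
  have h3 := hle s hs
  rw [le_antisymm hI hI', mul_zero] at h3
  exact le_antisymm h3 (h0 s hs)

/-- The total mass of the density of the first jump time. -/
theorem lintegral_hazard {a : ℝ → ℝ} {τ : ℝ} (ha : IntervalIntegrable a volume 0 τ)
    (h0 : ∀ r ∈ Icc 0 τ, 0 ≤ a r) {s : ℝ} (hs : s ∈ Icc 0 τ) :
    (∫⁻ v in Ioc s τ, ENNReal.ofReal (a v * Real.exp (-∫ r in 0..v, a r))) +
      ENNReal.ofReal (Real.exp (-∫ r in 0..τ, a r)) =
      ENNReal.ofReal (Real.exp (-∫ r in 0..s, a r)) := by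
  have hτ : 0 ≤ τ := hs.1.trans hs.2
  -- The density is the derivative of `-exp (-∫ a)`, so this is `exp_primitive` for `-a`.
  have e : ∀ s ∈ Icc 0 τ, ∫ r in 0..s, a r * Real.exp (-∫ v in 0..r, a v) =
      1 - Real.exp (-∫ v in 0..s, a v) := by
    intro s hs
    have := exp_primitive ha.neg hs
    simp only [Pi.neg_apply, neg_mul, intervalIntegral.integral_neg] at this
    linarith
  have hint : IntervalIntegrable (fun r => a r * Real.exp (-∫ v in 0..r, a v)) volume 0 τ := by
    refine ha.mul_continuousOn ?_
    have := (ha.absolutelyContinuousOnInterval_intervalIntegral (c := 0) (by simp)).continuousOn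
    exact this.neg.rexp
  have hsub1 : uIcc 0 s ⊆ uIcc 0 τ := by
    rw [uIcc_of_le hs.1, uIcc_of_le hτ]; exact Icc_subset_Icc le_rfl hs.2
  have hsub2 : uIcc s τ ⊆ uIcc 0 τ := by
    rw [uIcc_of_le hs.2, uIcc_of_le hτ]; exact Icc_subset_Icc hs.1 le_rfl
  have hst := hint.mono_set hsub2
  have hsum := intervalIntegral.integral_add_adjacent_intervals (hint.mono_set hsub1) hst
  rw [e s hs, e τ ⟨hτ, le_rfl⟩] at hsum
  rw [← ofReal_integral_eq_lintegral_ofReal, ← intervalIntegral.integral_of_le hs.2,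
    ← ENNReal.ofReal_add]
  · congr 1; linarith
  · refine intervalIntegral.integral_nonneg hs.2 fun r hr => ?_
    exact mul_nonneg (h0 r ⟨hs.1.trans hr.1, hr.2⟩) (Real.exp_pos _).le
  · exact (Real.exp_pos _).le
  · exact (intervalIntegrable_iff_integrableOn_Ioc_of_le hs.2).1 hst
  · refine (ae_restrict_iff' measurableSet_Ioc).2 (Eventually.of_forall fun r hr => ?_)
    exact mul_nonneg (h0 r ⟨hs.1.trans hr.1.le, hr.2⟩) (Real.exp_pos _).le

namespace MarketData

variable {K : ℕ} (M : MarketData K)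

instance isFiniteMeasure_ς : IsFiniteMeasure M.ς := M.finite_ς

/-! ### The compensator kernels and the filter -/

theorem eta_univ_le (i : Fin K) (t : ℝ) : M.eta i t univ ≤ M.ς univ := by
  rw [M.eta_apply i t MeasurableSet.univ]
  exact measure_mono (subset_univ _)

instance isFiniteKernel_eta (i : Fin K) : IsFiniteKernel (M.eta i) :=
  ⟨⟨M.ς univ, measure_lt_top _ _, M.eta_univ_le i⟩⟩

/-- The total intensity of jumps in state `i`. -/
noncomputable def totalRate (i : Fin K) (t : ℝ) : ℝ := (M.eta i t).real univ

theorem measurable_totalRate (i : Fin K) : Measurable (M.totalRate i) :=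
  ((M.eta i).measurable_coe MeasurableSet.univ).ennreal_toReal

theorem totalRate_nonneg (i : Fin K) (t : ℝ) : 0 ≤ M.totalRate i t := measureReal_nonneg

theorem totalRate_le (i : Fin K) (t : ℝ) : M.totalRate i t ≤ M.ς.real univ :=
  ENNReal.toReal_mono (measure_ne_top _ _) (M.eta_univ_le i t)

/-- The density of `η(t, e_j)` with respect to `η(t, e_i)`. -/
noncomputable def dens (j i : Fin K) (t z : ℝ) : ℝ :=
  (Kernel.rnDeriv (M.eta j) (M.eta i) t z).toReal

/-- The density of the filtered intensity with respect to `η(t, e_i)`. -/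
noncomputable def mixDens (i : Fin K) (t : ℝ) (π : Fin K → ℝ) (z : ℝ) : ℝ :=
  ∑ j, π j * M.dens j i t z

theorem dens_nonneg (j i : Fin K) (t z : ℝ) : 0 ≤ M.dens j i t z := ENNReal.toReal_nonneg

theorem one_add_u (i : Fin K) (t : ℝ) (π : Fin K → ℝ) (z : ℝ) :
    1 + M.u i t π z = 1 / M.mixDens i t π z := by
  simp [u, mixDens, dens]

theorem measurable_dens (j i : Fin K) : Measurable fun p : ℝ × ℝ => M.dens j i p.1 p.2 :=
  (Kernel.measurable_rnDeriv (M.eta j) (M.eta i)).ennreal_toReal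

theorem measurable_u (i : Fin K) :
    Measurable fun p : ℝ × (Fin K → ℝ) × ℝ => M.u i p.1 p.2.1 p.2.2 := by
  have h : ∀ j, Measurable fun p : ℝ × (Fin K → ℝ) × ℝ => M.dens j i p.1 p.2.2 := fun j =>
    (M.measurable_dens j i).comp (measurable_fst.prodMk measurable_snd.snd)
  have h2 : Measurable fun p : ℝ × (Fin K → ℝ) × ℝ => M.mixDens i p.1 p.2.1 p.2.2 := by
    refine Finset.measurable_sum _ fun j _ => Measurable.mul ?_ (h j)
    exact (measurable_pi_apply j).comp measurable_snd.fst
  exact (measurable_const.div h2).sub_const 1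

variable {M}

/-- The kernel derivative agrees with the derivative of measures only up to a null set of `η(t,
e_i)`. Mutual absolute continuity carries such null sets to every `η(t, e_k)`, so identities between
densities can be used under all of these measures. -/
theorem Standing.ae_dens_eq (hM : M.Standing) {t : ℝ} (ht : t ∈ Icc 0 M.T) (j i k : Fin K) :
    ∀ᵐ z ∂(M.eta k t), M.dens j i t z = ((M.eta j t).rnDeriv (M.eta i t) z).toReal := by
  refine (hM.eta_ac t ht i k).ae_le ?_
  filter_upwards [Kernel.rnDeriv_eq_rnDeriv_measure (κ := M.eta j) (η := M.eta i) (a := t)] with z hz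
  rw [dens, hz]

theorem Standing.ae_dens_self (hM : M.Standing) {t : ℝ} (ht : t ∈ Icc 0 M.T) (i k : Fin K) :
    ∀ᵐ z ∂(M.eta k t), M.dens i i t z = 1 := by
  refine (hM.eta_ac t ht i k).ae_le ?_
  filter_upwards [Kernel.rnDeriv_self (M.eta i) t] with z hz
  simp [dens, hz]

/-- The density of `η(t, e_j)` is positive almost everywhere under `η(t, e_j)` itself; absolute
continuity then passes this on to `η(t, e_k)`. -/
theorem Standing.ae_dens_pos (hM : M.Standing) {t : ℝ} (ht : t ∈ Icc 0 M.T) (j i k : Fin K) :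
    ∀ᵐ z ∂(M.eta k t), 0 < M.dens j i t z := by
  refine (hM.eta_ac t ht j k).ae_le ?_
  exact Kernel.rnDeriv_toReal_pos (hM.eta_ac t ht i j)

theorem Standing.ae_dens_mul (hM : M.Standing) {t : ℝ} (ht : t ∈ Icc 0 M.T) (j i k l : Fin K) :
    ∀ᵐ z ∂(M.eta l t), M.dens j k t z * M.dens k i t z = M.dens j i t z := by
  filter_upwards [hM.ae_dens_eq ht j k l, hM.ae_dens_eq ht k i l, hM.ae_dens_eq ht j i l,
    (hM.eta_ac t ht i l).ae_le (Measure.rnDeriv_mul_rnDeriv (κ := M.eta i t)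
      (hM.eta_ac t ht k j))] with z h1 h2 h3 h4
  rw [h1, h2, h3, ← h4, Pi.mul_apply, ENNReal.toReal_mul]

theorem Standing.ae_mixDens_pos (hM : M.Standing) {t : ℝ} (ht : t ∈ Icc 0 M.T) {π : Fin K → ℝ}
    (hπ : π ∈ stdSimplex ℝ (Fin K)) (i k : Fin K) :
    ∀ᵐ z ∂(M.eta k t), 0 < M.mixDens i t π z := by
  filter_upwards [ae_all_iff.2 fun j => hM.ae_dens_pos ht j i k] with z hz
  obtain ⟨j, -, hj⟩ : ∃ j ∈ Finset.univ, π j ≠ 0 := by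
    apply Finset.exists_ne_zero_of_sum_ne_zero; rw [hπ.2]; exact one_ne_zero
  refine Finset.sum_pos' (fun j _ => mul_nonneg (hπ.1 j) (hz j).le) ⟨j, Finset.mem_univ _, ?_⟩
  exact mul_pos (lt_of_le_of_ne (hπ.1 j) hj.symm) (hz j)

/-- Bayes' formula. By the chain rule for densities `mixDens i = mixDens k * dens k i`, so the
updated weights are `π i * dens i k / mixDens k`. With the one reference measure `η(t, e_k)` they
visibly sum to one. -/
theorem Standing.ae_filter_mem (hM : M.Standing) {t : ℝ} (ht : t ∈ Icc 0 M.T) {π : Fin K → ℝ}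
    (hπ : π ∈ stdSimplex ℝ (Fin K)) (k : Fin K) :
    ∀ᵐ z ∂(M.eta k t), (fun i => π i * (1 + M.u i t π z)) ∈ stdSimplex ℝ (Fin K) := by
  filter_upwards [ae_all_iff.2 fun i => hM.ae_mixDens_pos ht hπ i k,
    ae_all_iff.2 fun i => hM.ae_dens_pos ht k i k, hM.ae_dens_self ht k k,
    ae_all_iff.2 fun i => hM.ae_dens_mul ht k k i k,
    ae_all_iff.2 fun i => ae_all_iff.2 fun j => hM.ae_dens_mul ht j i k k] with z h1 h2 h3 h4 h5
  refine ⟨fun i => ?_, ?_⟩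
  · change 0 ≤ π i * (1 + M.u i t π z)
    rw [one_add_u]; exact mul_nonneg (hπ.1 i) (one_div_pos.2 (h1 i)).le
  · have key : ∀ i, π i * (1 + M.u i t π z) = π i * M.dens i k t z / M.mixDens k t π z := by
      intro i
      have e : M.mixDens i t π z = M.mixDens k t π z * M.dens k i t z := by
        simp only [mixDens, Finset.sum_mul, mul_assoc, h5]
      have e2 := h4 i
      rw [h3] at e2
      rw [one_add_u, e, mul_one_div, div_eq_div_iff (mul_pos (h1 k) (h2 i)).ne' (h1 k).ne']
      linear_combination (π i * M.mixDens k t π z) * (-e2)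
    simp only [key]
    rw [← Finset.sum_div]
    exact div_self (h1 k).ne'

/-- Averaging `∫ 1 / mixDens i dη(t, e_j)` with the weights `π j` gives the integral of `mixDens i /
mixDens i = 1` under `η(t, e_i)`. The densities disappear, and a quadratic expression in `π` with
the total rates as coefficients remains. -/
theorem Standing.filter_drift (hM : M.Standing) {t : ℝ} (ht : t ∈ Icc 0 M.T) {π : Fin K → ℝ}
    (hπ : π ∈ stdSimplex ℝ (Fin K)) (i : Fin K) :
    ∑ j, π j * ∫ z, π i * M.u i t π z ∂(M.eta j t) =
      π i * (M.totalRate i t - ∑ j, π j * M.totalRate j t) := by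
  rcases eq_or_lt_of_le (hπ.1 i) with h0 | hpos
  · simp [← h0]
  have hm : Measurable fun z => M.mixDens i t π z :=
    Finset.measurable_sum _ fun j _ =>
      ((M.measurable_dens j i).comp measurable_prodMk_left).const_mul _
  -- Since `dens i i = 1`, the mixture is at least `π i`; this bounds the integrand, and the case `π
  -- i = 0` is trivial.
  have hb : ∀ j, ∀ᵐ z ∂(M.eta j t), ‖1 / M.mixDens i t π z‖ ≤ 1 / π i := by
    intro j
    filter_upwards [hM.ae_dens_self ht i j] with z hz
    have : π i ≤ M.mixDens i t π z := by
      have := Finset.single_le_sum (f := fun j => π j * M.dens j i t z)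
        (fun j _ => mul_nonneg (hπ.1 j) (M.dens_nonneg j i t z)) (Finset.mem_univ i)
      rw [hz, mul_one] at this
      exact this
    rw [Real.norm_of_nonneg (one_div_pos.2 (hpos.trans_le this)).le]
    exact one_div_le_one_div_of_le hpos this
  have hI : ∀ j, Integrable (fun z => 1 / M.mixDens i t π z) (M.eta j t) := fun j =>
    Integrable.of_bound (measurable_const.div hm).aestronglyMeasurable _ (hb j)
  have e1 : ∀ j, ∫ z, π i * M.u i t π z ∂(M.eta j t) =
      π i * ((∫ z, 1 / M.mixDens i t π z ∂(M.eta j t)) - M.totalRate j t) := by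
    intro j
    rw [integral_const_mul]
    congr 1
    have : ∀ z, M.u i t π z = 1 / M.mixDens i t π z - 1 := fun z => by
      rw [← one_add_u]; ring
    simp only [this]
    rw [integral_sub (hI j) (integrable_const _)]
    simp [totalRate]
  have e2 : ∑ j, π j * ∫ z, 1 / M.mixDens i t π z ∂(M.eta j t) = M.totalRate i t := by
    have h1 : ∀ j, ∫ z, 1 / M.mixDens i t π z ∂(M.eta j t) =
        ∫ z, M.dens j i t z * (1 / M.mixDens i t π z) ∂(M.eta i t) := by
      intro j
      rw [← integral_rnDeriv_smul (hM.eta_ac t ht i j)]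
      refine integral_congr_ae ?_
      filter_upwards [hM.ae_dens_eq ht j i i] with z hz
      rw [hz, smul_eq_mul]
    have h2 : ∀ j, Integrable (fun z => π j * (M.dens j i t z * (1 / M.mixDens i t π z)))
        (M.eta i t) := by
      intro j
      have := (integrable_rnDeriv_smul_iff (hM.eta_ac t ht i j)).2 (hI j)
      refine (this.congr ?_).const_mul _
      filter_upwards [hM.ae_dens_eq ht j i i] with z hz
      rw [hz, smul_eq_mul]
    simp only [h1, ← integral_const_mul]
    rw [← integral_finsetSum _ fun j _ => h2 j]
    have : ∀ᵐ z ∂(M.eta i t), ∑ j, π j * (M.dens j i t z * (1 / M.mixDens i t π z)) = 1 := by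
      filter_upwards [hM.ae_mixDens_pos ht hπ i i] with z hz
      simp only [← mul_assoc, ← Finset.sum_mul]
      exact mul_one_div_cancel hz.ne'
    rw [integral_congr_ae this]
    simp [totalRate]
  simp only [e1]
  calc _ = π i * (∑ j, π j * ∫ z, 1 / M.mixDens i t π z ∂(M.eta j t)) -
        π i * ∑ j, π j * M.totalRate j t := by
        rw [Finset.mul_sum, Finset.mul_sum, ← Finset.sum_sub_distrib]
        exact Finset.sum_congr rfl fun j _ => by ring
    _ = _ := by rw [e2]; ring

theorem Standing.g_eq (hM : M.Standing) {x : State K} (hx : x ∈ M.stateSpace) (h : ℝ) :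
    M.g x h = (1, x.2.1 * (1 - h) * M.ρ, fun i => (∑ j, x.2.2 j * M.q j i h) -
      x.2.2 i * (M.totalRate i x.1 - ∑ j, x.2.2 j * M.totalRate j x.1)) := by
  rw [g]
  congr 2
  funext i
  rw [← hM.filter_drift hx.1 hx.2.2 i, ← Finset.sum_sub_distrib]
  exact Finset.sum_congr rfl fun j _ => by ring

variable (M)

theorem rate_eq (x : State K) : M.rate x = ∑ i, x.2.2 i * M.totalRate i x.1 := rfl

theorem rate_nonneg {x : State K} (hx : x ∈ M.stateSpace) : 0 ≤ M.rate x :=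
  Finset.sum_nonneg fun i _ => mul_nonneg (hx.2.2.1 i) (M.totalRate_nonneg i _)

theorem rate_le {x : State K} (hx : x ∈ M.stateSpace) : M.rate x ≤ M.ς.real univ := by
  rw [rate_eq]
  calc _ ≤ ∑ i, x.2.2 i * M.ς.real univ :=
        Finset.sum_le_sum fun i _ => mul_le_mul_of_nonneg_left (M.totalRate_le i _) (hx.2.2.1 i)
    _ = _ := by rw [← Finset.sum_mul, hx.2.2.2, one_mul]

theorem measurable_rate : Measurable M.rate := by
  refine Finset.measurable_sum _ fun i _ => Measurable.mul ?_ ?_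
  · exact (measurable_pi_apply i).comp measurable_snd.snd
  · exact (M.measurable_totalRate i).comp measurable_fst

theorem measurableSet_stateSpace : MeasurableSet M.stateSpace := by
  refine (measurableSet_Icc.preimage measurable_fst).inter
    ((measurableSet_Ioi.preimage measurable_snd.fst).inter
    ((isClosed_stdSimplex ℝ (Fin K)).measurableSet.preimage measurable_snd.snd))

theorem measurable_jumpMap :
    Measurable fun p : State K × ℝ × ℝ => M.jumpMap p.1 p.2.1 p.2.2 := by
  refine measurable_fst.fst.prodMk (Measurable.prodMk ?_ (measurable_pi_lambda _ fun i => ?_))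
  · exact measurable_fst.snd.fst.mul ((measurable_snd.fst.mul measurable_snd.snd).const_add 1)
  · refine ((measurable_pi_apply i).comp measurable_fst.snd.snd).mul (Measurable.const_add ?_ 1)
    exact (M.measurable_u i).comp
      (measurable_fst.fst.prodMk (measurable_fst.snd.snd.prodMk measurable_snd.snd))

theorem measurable_lintegral_jumpMap {f : State K → ℝ≥0∞} (hf : Measurable f) (j : Fin K) :
    Measurable fun p : State K × ℝ => ∫⁻ z, f (M.jumpMap p.1 p.2 z) ∂(M.eta j p.1.1) := by
  have := Measurable.lintegral_kernel_prod_right'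
    (κ := (M.eta j).comap (fun p : State K × ℝ => p.1.1) measurable_fst.fst)
    (f := fun p : (State K × ℝ) × ℝ => f (M.jumpMap p.1.1 p.1.2 p.2))
    (hf.comp (M.measurable_jumpMap.comp
      (measurable_fst.fst.prodMk (measurable_fst.snd.prodMk measurable_snd))))
  simpa only [Kernel.comap_apply] using this

theorem measurable_jumpOp {f : State K → ℝ≥0∞} (hf : Measurable f) :
    Measurable fun p : State K × ℝ => M.jumpOp f p.1 p.2 := by
  refine Measurable.div (Finset.measurable_sum _ fun j _ => Measurable.mul ?_
    (M.measurable_lintegral_jumpMap hf j)) (M.measurable_rate.comp measurable_fst).ennreal_ofReal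
  exact ((measurable_pi_apply j).comp measurable_fst.snd.snd).ennreal_ofReal

theorem sum_eta_univ {x : State K} (hx : x ∈ M.stateSpace) :
    ∑ j, ENNReal.ofReal (x.2.2 j) * M.eta j x.1 univ = ENNReal.ofReal (M.rate x) := by
  rw [rate, ENNReal.ofReal_sum_of_nonneg fun i _ => mul_nonneg (hx.2.2.1 i) measureReal_nonneg]
  refine Finset.sum_congr rfl fun j _ => ?_
  rw [ENNReal.ofReal_mul (hx.2.2.1 j), ofReal_measureReal]

theorem jumpOp_const {x : State K} (hx : x ∈ M.stateSpace) (h : ℝ) (c : ℝ≥0∞) :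
    ENNReal.ofReal (M.rate x) * M.jumpOp (fun _ => c) x h = ENNReal.ofReal (M.rate x) * c := by
  simp only [jumpOp, lintegral_const, mul_comm c, ← mul_assoc]
  rw [← Finset.sum_mul, M.sum_eta_univ hx]
  rcases eq_or_ne (ENNReal.ofReal (M.rate x)) 0 with h0 | h0
  · simp [h0]
  · rw [mul_div_assoc, ENNReal.mul_div_cancel h0 ENNReal.ofReal_ne_top]

/-- Where the rate vanishes, each `π j • η(t, e_j)` is the zero measure, so no exception is needed
for the division in `jumpOp`. -/
theorem rate_mul_jumpOp {x : State K} (hx : x ∈ M.stateSpace) (h : ℝ) (f : State K → ℝ≥0∞) :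
    ENNReal.ofReal (M.rate x) * M.jumpOp f x h =
      ∑ j, ENNReal.ofReal (x.2.2 j) * ∫⁻ z, f (M.jumpMap x h z) ∂(M.eta j x.1) := by
  rcases eq_or_ne (ENNReal.ofReal (M.rate x)) 0 with h0 | h0
  · rw [h0, zero_mul]
    rw [← M.sum_eta_univ hx] at h0
    symm
    refine Finset.sum_eq_zero fun j hj => ?_
    have := (Finset.sum_eq_zero_iff.1 h0) j hj
    rcases mul_eq_zero.1 this with h1 | h1
    · rw [h1, zero_mul]
    · rw [Measure.measure_univ_eq_zero.1 h1, lintegral_zero_measure, mul_zero]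
  · rw [jumpOp, ENNReal.mul_div_cancel h0 ENNReal.ofReal_ne_top]

end MarketData

/-! ### Linear systems with nonnegative measurable coefficients -/

section LinearSystem

variable {Ω ι : Type*} [Fintype ι]

/-- The Picard iterates of the system `pᵢ' = ∑ⱼ pⱼ bⱼᵢ`, `p(0) = p₀`. -/
noncomputable def picard (b : Ω → ℝ → ι → ι → ℝ≥0∞) (p₀ : Ω → ι → ℝ≥0∞) :
    ℕ → Ω → ℝ → ι → ℝ≥0∞
  | 0 => fun x _ i => p₀ x i
  | n + 1 => fun x s i => p₀ x i + ∫⁻ r in Ioc 0 s, ∑ j, picard b p₀ n x r j * b x r j i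

variable {b : Ω → ℝ → ι → ι → ℝ≥0∞} {p₀ : Ω → ι → ℝ≥0∞}

/-- The moving endpoint becomes an indicator on the product space, so that the measure of
integration no longer depends on the parameter. -/
theorem measurable_lintegral_Ioc {Ω : Type*} [MeasurableSpace Ω] {f : Ω → ℝ → ℝ≥0∞} (hf : Measurable (Function.uncurry f)) :
    Measurable fun p : Ω × ℝ => ∫⁻ r in Ioc 0 p.2, f p.1 r := by
  have hS : MeasurableSet {q : (Ω × ℝ) × ℝ | 0 < q.2 ∧ q.2 ≤ q.1.2} :=
    (measurableSet_lt measurable_const measurable_snd).inter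
      (measurableSet_le measurable_snd measurable_fst.snd)
  have h1 : Measurable fun q : (Ω × ℝ) × ℝ =>
      {q : (Ω × ℝ) × ℝ | 0 < q.2 ∧ q.2 ≤ q.1.2}.indicator (fun q => f q.1.1 q.2) q :=
    (hf.comp (measurable_fst.fst.prodMk measurable_snd)).indicator hS
  convert! h1.lintegral_prod_right' (ν := volume) using 2 with p
  rw [← lintegral_indicator measurableSet_Ioc]
  rfl

theorem measurable_picard [MeasurableSpace Ω] (hb : ∀ j i, Measurable fun p : Ω × ℝ => b p.1 p.2 j i)
    (hp : ∀ i, Measurable fun x => p₀ x i) (n : ℕ) (i : ι) :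
    Measurable fun p : Ω × ℝ => picard b p₀ n p.1 p.2 i := by
  induction n generalizing i with
  | zero => exact (hp i).comp measurable_fst
  | succ n ih =>
    refine ((hp i).comp measurable_fst).add (measurable_lintegral_Ioc
      (f := fun x r => ∑ j, picard b p₀ n x r j * b x r j i) ?_)
    exact Finset.measurable_sum _ fun j _ => (ih j).mul (hb j i)

/-- Nonnegative coefficients make the iterates increase. The solution can thus be taken as a
supremum, which preserves measurability in the parameter and permits monotone convergence. -/
theorem picard_mono : Monotone (picard b p₀) := by
  refine monotone_nat_of_le_succ fun n => ?_
  induction n with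
  | zero => exact fun x s i => le_self_add
  | succ n ih =>
    intro x s i
    refine add_le_add le_rfl (lintegral_mono fun r => Finset.sum_le_sum fun j _ => ?_)
    exact mul_le_mul_left (ih x r j) _

theorem lintegral_exp_growth {a : ℝ} {s : ℝ} (ha : 0 ≤ a) (hs : 0 ≤ s) :
    ∫⁻ r in Ioc 0 s, ENNReal.ofReal (a * Real.exp (a * r)) =
      ENNReal.ofReal (Real.exp (a * s) - 1) := by
  rw [← ofReal_integral_eq_lintegral_ofReal, ← intervalIntegral.integral_of_le hs]
  · rw [intervalIntegral.integral_eq_sub_of_hasDerivAt (f := fun v => Real.exp (a * v))]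
    · simp
    · intro x _
      have := ((hasDerivAt_id x).const_mul a).exp
      simpa [mul_comm] using this
    · exact Continuous.intervalIntegrable (by fun_prop) _ _
  · exact (intervalIntegrable_iff_integrableOn_Ioc_of_le hs).1
      (Continuous.intervalIntegrable (by fun_prop) _ _)
  · exact Eventually.of_forall fun r => by positivity

/-- The bound solves the system in which every coefficient is `C` and every initial value is `c`, so
each iterate inherits it from the preceding one. It makes the supremum of the iterates finite. -/
theorem picard_le {C c : ℝ} (hC : 0 ≤ C) (hc : 0 ≤ c)
    (hb : ∀ x r j i, b x r j i ≤ ENNReal.ofReal C)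
    {x : Ω} (hp : ∀ i, p₀ x i ≤ ENNReal.ofReal c) (n : ℕ) (s : ℝ) (hs : 0 ≤ s) (i : ι) :
    picard b p₀ n x s i ≤ ENNReal.ofReal (c * Real.exp (Fintype.card ι * C * s)) := by
  induction n generalizing s i with
  | zero =>
    refine (hp i).trans (ENNReal.ofReal_le_ofReal ?_)
    exact le_mul_of_one_le_right hc (Real.one_le_exp (by positivity))
  | succ n ih =>
    have h1 : ∫⁻ r in Ioc 0 s, ∑ j, picard b p₀ n x r j * b x r j i ≤
        ENNReal.ofReal c * ENNReal.ofReal (Real.exp (Fintype.card ι * C * s) - 1) := by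
      rw [← lintegral_exp_growth (by positivity) hs, ← lintegral_const_mul' _ _ ENNReal.ofReal_ne_top]
      refine setLIntegral_mono' measurableSet_Ioc fun r hr => ?_
      calc ∑ j, picard b p₀ n x r j * b x r j i
          ≤ ∑ _j : ι, ENNReal.ofReal (c * Real.exp (Fintype.card ι * C * r)) * ENNReal.ofReal C :=
            Finset.sum_le_sum fun j _ => mul_le_mul' (ih r hr.1.le j) (hb x r j i)
        _ = _ := by
            rw [Finset.sum_const, Finset.card_univ, nsmul_eq_mul, ← ENNReal.ofReal_mul (by positivity),
              ← ENNReal.ofReal_natCast, ← ENNReal.ofReal_mul (by positivity),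
              ← ENNReal.ofReal_mul (by positivity)]
            congr 1; ring
    calc picard b p₀ (n + 1) x s i
        ≤ ENNReal.ofReal c + ENNReal.ofReal c *
          ENNReal.ofReal (Real.exp (Fintype.card ι * C * s) - 1) := add_le_add (hp i) h1
      _ = _ := by
        have : 0 ≤ Real.exp (Fintype.card ι * C * s) - 1 := by
          have := Real.one_le_exp (x := Fintype.card ι * C * s) (by positivity)
          linarith
        rw [← ENNReal.ofReal_mul hc, ← ENNReal.ofReal_add hc (by positivity)]
        congr 1; ring

/-- A linear system with bounded, nonnegative, measurable coefficients has a nonnegative solution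
depending measurably on parameters. -/
theorem exists_linear_flow [MeasurableSpace Ω] {b : Ω → ℝ → ι → ι → ℝ} {C : ℝ} {p₀ : Ω → ι → ℝ}
    (hb : ∀ j i, Measurable fun p : Ω × ℝ => b p.1 p.2 j i)
    (hb0 : ∀ x r j i, 0 ≤ b x r j i) (hbC : ∀ x r j i, b x r j i ≤ C)
    (hp : ∀ i, Measurable fun x => p₀ x i) :
    ∃ P : Ω → ℝ → ι → ℝ, (∀ i, Measurable fun p : Ω × ℝ => P p.1 p.2 i) ∧
      (∀ x s i, 0 ≤ P x s i) ∧
      ∀ x, (∀ i, 0 ≤ p₀ x i) → ∀ s, 0 ≤ s → ∀ i,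
        IntervalIntegrable (fun r => ∑ j, P x r j * b x r j i) volume 0 s ∧
        P x s i = p₀ x i + ∫ r in 0..s, ∑ j, P x r j * b x r j i := by
  set b' : Ω → ℝ → ι → ι → ℝ≥0∞ := fun x r j i => ENNReal.ofReal (b x r j i) with hb'
  set p' : Ω → ι → ℝ≥0∞ := fun x i => ENNReal.ofReal (p₀ x i) with hp'
  set p : Ω → ℝ → ι → ℝ≥0∞ := fun x s i => ⨆ n, picard b' p' n x s i with hpdef
  have hb'm : ∀ j i, Measurable fun p : Ω × ℝ => b' p.1 p.2 j i := fun j i => (hb j i).ennreal_ofReal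
  have hp'm : ∀ i, Measurable fun x => p' x i := fun i => (hp i).ennreal_ofReal
  have hpm : ∀ i, Measurable fun q : Ω × ℝ => p q.1 q.2 i := fun i =>
    Measurable.iSup fun n => measurable_picard hb'm hp'm n i
  have hle : ∀ x s i, 0 ≤ s → p x s i ≤
      ENNReal.ofReal ((∑ i, |p₀ x i|) * Real.exp (Fintype.card ι * |C| * s)) := by
    intro x s i hs
    refine iSup_le fun n => picard_le (abs_nonneg C) (Finset.sum_nonneg fun _ _ => abs_nonneg _)
      (fun x r j i => ENNReal.ofReal_le_ofReal ((hbC x r j i).trans (le_abs_self C)))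
      (fun i => ENNReal.ofReal_le_ofReal ?_) n s hs i
    exact (le_abs_self _).trans
      (Finset.single_le_sum (f := fun i => |p₀ x i|) (fun _ _ => abs_nonneg _) (Finset.mem_univ i))
  -- By monotone convergence the supremum is a fixed point of the Picard map; finiteness then allows
  -- the return to real numbers.
  have hfix : ∀ x s i, p x s i = p' x i + ∫⁻ r in Ioc 0 s, ∑ j, p x r j * b' x r j i := by
    intro x s i
    have h1 : ∫⁻ r in Ioc 0 s, ∑ j, p x r j * b' x r j i =
        ⨆ n, ∫⁻ r in Ioc 0 s, ∑ j, picard b' p' n x r j * b' x r j i := by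
      rw [← lintegral_iSup]
      · congr 1 with r
        rw [← ENNReal.finsetSum_iSup_of_monotone]
        · exact Finset.sum_congr rfl fun j _ => ENNReal.iSup_mul _ _
        · intro j n m hnm
          exact mul_le_mul_left (picard_mono hnm x r j) _
      · intro n
        exact Finset.measurable_sum _ fun j _ => ((measurable_picard hb'm hp'm n j).comp
          measurable_prodMk_left).mul ((hb'm j i).comp measurable_prodMk_left)
      · intro n m hnm r
        exact Finset.sum_le_sum fun j _ => mul_le_mul_left (picard_mono hnm x r j) _
    rw [h1, ENNReal.add_iSup]
    have h2 := (picard_mono (b := b') (p₀ := p')).iSup_nat_add 1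
    have h3 : (⨆ n, picard b' p' (n + 1)) x s i = ⨆ n, picard b' p' (n + 1) x s i := by
      simp only [iSup_apply]
    have h4 : (⨆ n, picard b' p' n) x s i = p x s i := by
      simp only [iSup_apply, hpdef]
    rw [← h4, ← h2, h3]
    rfl
  have hfin : ∀ x s i, 0 ≤ s → p x s i ≠ ⊤ := fun x s i hs =>
    ((hle x s i hs).trans_lt ENNReal.ofReal_lt_top).ne
  refine ⟨fun x s i => (p x s i).toReal, fun i => (hpm i).ennreal_toReal,
    fun _ _ _ => ENNReal.toReal_nonneg, fun x hx s hs i => ?_⟩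
  have hm : Measurable fun r => ∑ j, (p x r j).toReal * b x r j i :=
    Finset.measurable_sum _ fun j _ => ((hpm j).comp measurable_prodMk_left).ennreal_toReal.mul
      ((hb j i).comp measurable_prodMk_left)
  have h0 : ∀ r, 0 ≤ ∑ j, (p x r j).toReal * b x r j i := fun r =>
    Finset.sum_nonneg fun j _ => mul_nonneg ENNReal.toReal_nonneg (hb0 x r j i)
  have hL : ∫⁻ r in Ioc 0 s, ENNReal.ofReal (∑ j, (p x r j).toReal * b x r j i) =
      ∫⁻ r in Ioc 0 s, ∑ j, p x r j * b' x r j i := by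
    refine setLIntegral_congr_fun measurableSet_Ioc fun r hr => ?_
    rw [ENNReal.ofReal_sum_of_nonneg fun j _ => mul_nonneg ENNReal.toReal_nonneg (hb0 x r j i)]
    refine Finset.sum_congr rfl fun j _ => ?_
    rw [ENNReal.ofReal_mul ENNReal.toReal_nonneg, ENNReal.ofReal_toReal (hfin x r j hr.1.le)]
  have hLfin : ∫⁻ r in Ioc 0 s, ∑ j, p x r j * b' x r j i ≠ ⊤ := by
    have := hfin x s i hs
    rw [hfix] at this
    exact (ENNReal.add_ne_top.1 this).2
  constructor
  · rw [intervalIntegrable_iff_integrableOn_Ioc_of_le hs]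
    refine ⟨hm.aestronglyMeasurable, ?_⟩
    rw [hasFiniteIntegral_iff_ofReal (Eventually.of_forall h0), hL]
    exact lt_top_iff_ne_top.2 hLfin
  · change (p x s i).toReal = _
    rw [hfix, ENNReal.toReal_add ENNReal.ofReal_ne_top hLfin, ENNReal.toReal_ofReal (hx i),
      intervalIntegral.integral_of_le hs, integral_eq_lintegral_of_nonneg_ae
        (Eventually.of_forall h0) hm.aestronglyMeasurable, hL]

end LinearSystem

/-! ### Parameter integrals and bounded integrands -/

theorem measurable_integral_Ioc {Ω : Type*} [MeasurableSpace Ω] {f : Ω → ℝ → ℝ}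
    (hf : Measurable (Function.uncurry f)) :
    Measurable fun p : Ω × ℝ => ∫ r in Ioc 0 p.2, f p.1 r := by
  have hS : MeasurableSet {q : (Ω × ℝ) × ℝ | 0 < q.2 ∧ q.2 ≤ q.1.2} :=
    (measurableSet_lt measurable_const measurable_snd).inter
      (measurableSet_le measurable_snd measurable_fst.snd)
  have h1 : StronglyMeasurable fun q : (Ω × ℝ) × ℝ =>
      {q : (Ω × ℝ) × ℝ | 0 < q.2 ∧ q.2 ≤ q.1.2}.indicator (fun q => f q.1.1 q.2) q :=
    ((hf.comp (measurable_fst.fst.prodMk measurable_snd)).indicator hS).stronglyMeasurable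
  convert! (h1.integral_prod_right' (ν := volume)).measurable using 2 with p
  rw [← integral_indicator measurableSet_Ioc]
  rfl

theorem intervalIntegrable_of_bound {f : ℝ → ℝ} {τ C : ℝ} (hf : Measurable f) (hτ : 0 ≤ τ)
    (hC : ∀ r ∈ Icc 0 τ, |f r| ≤ C) : IntervalIntegrable f volume 0 τ := by
  rw [intervalIntegrable_iff_integrableOn_Ioc_of_le hτ]
  exact Measure.integrableOn_of_bounded (M := C) (by simp) hf.aestronglyMeasurable
    ((ae_restrict_iff' measurableSet_Ioc).2
      (Eventually.of_forall fun r hr => hC r ⟨hr.1.le, hr.2⟩))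

namespace MarketData

variable {K : ℕ} {M : MarketData K}

/-! ### The flow -/

theorem Standing.q_continuousOn (hM : M.Standing) (i j : Fin K) :
    ContinuousOn (M.q i j) (Icc (-M.L) M.L) := by
  rcases eq_or_ne i j with rfl | h
  · refine ContinuousOn.congr (ContinuousOn.neg (f := fun h => ∑ j ∈ Finset.univ.erase i, M.q i j h)
      ?_) (fun h hh => hM.q_diag i h hh)
    exact continuousOn_finsetSum _ fun j hj =>
      hM.q_continuous i j (Finset.ne_of_mem_erase hj).symm
  · exact hM.q_continuous i j h

theorem Standing.q_row (hM : M.Standing) (i : Fin K) {h : ℝ} (hh : h ∈ Icc (-M.L) M.L) :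
    ∑ j, M.q i j h = 0 := by
  rw [← Finset.add_sum_erase _ _ (Finset.mem_univ i), hM.q_diag i h hh]
  ring

theorem Standing.exists_q_bound (hM : M.Standing) :
    ∃ C, 0 ≤ C ∧ ∀ i j, ∀ h ∈ Icc (-M.L) M.L, |M.q i j h| ≤ C := by
  have h1 : ∀ i j, ∃ C, ∀ h ∈ Icc (-M.L) M.L, ‖M.q i j h‖ ≤ C := fun i j =>
    isCompact_Icc.exists_bound_of_continuousOn (hM.q_continuousOn i j)
  choose C hC using h1
  refine ⟨∑ i, ∑ j, |C i j|, by positivity, fun i j h hh => ?_⟩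
  calc |M.q i j h| ≤ |C i j| := (hC i j h hh).trans (le_abs_self _)
    _ ≤ ∑ j, |C i j| :=
      Finset.single_le_sum (f := fun j => |C i j|) (fun _ _ => abs_nonneg _) (Finset.mem_univ j)
    _ ≤ _ := Finset.single_le_sum (f := fun i => ∑ j, |C i j|) (fun _ _ => by positivity)
      (Finset.mem_univ i)

variable (M) in
/-- Measurable feedback maps with values in `[-L, L]`. -/
structure IsControl (α : State K → ℝ → ℝ) : Prop where
  measurable : Measurable (Function.uncurry α)
  mem_Icc : ∀ x ∈ M.stateSpace, ∀ s ∈ Icc 0 M.T, α x s ∈ Icc (-M.L) M.L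

variable (M) in
/-- Truncation to `[-L, L]`. -/
noncomputable def clip (h : ℝ) : ℝ := max (-M.L) (min M.L h)

theorem measurable_clip : Measurable M.clip := by unfold clip; fun_prop

theorem Standing.clip_mem (hM : M.Standing) (h : ℝ) : M.clip h ∈ Icc (-M.L) M.L := by
  have := hM.L_pos
  exact ⟨le_max_left _ _, max_le (by linarith) (min_le_left _ _)⟩

theorem clip_eq {h : ℝ} (hh : h ∈ Icc (-M.L) M.L) : M.clip h = h := by
  rw [clip, min_eq_right hh.2, max_eq_right hh.1]

theorem Standing.measurable_q_clip (hM : M.Standing) (i j : Fin K) :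
    Measurable fun h => M.q i j (M.clip h) := by
  have : Continuous fun h => M.q i j (M.clip h) :=
    (hM.q_continuousOn i j).comp_continuous (by unfold clip; fun_prop) hM.clip_mem
  exact this.measurable

theorem abs_rate_sub_le {π π' : Fin K → ℝ} (t : ℝ) :
    |∑ j, π j * M.totalRate j t - ∑ j, π' j * M.totalRate j t| ≤
      K * M.ς.real univ * ‖π - π'‖ := by
  rw [← Finset.sum_sub_distrib]
  calc _ ≤ ∑ j, |π j * M.totalRate j t - π' j * M.totalRate j t| := Finset.abs_sum_le_sum_abs _ _
    _ ≤ ∑ _j : Fin K, ‖π - π'‖ * M.ς.real univ := by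
      refine Finset.sum_le_sum fun j _ => ?_
      rw [← sub_mul, abs_mul, abs_of_nonneg (M.totalRate_nonneg j t)]
      exact mul_le_mul (norm_le_pi_norm (π - π') j) (M.totalRate_le j t) (M.totalRate_nonneg j t)
        (norm_nonneg _)
    _ = _ := by simp; ring

/-- By `g_eq` the field is linear in the wealth and quadratic in the filter, with bounded
coefficients; on the simplex the quadratic part is Lipschitz. Only states at equal times are
compared, so no regularity of the rates in time is needed. -/
theorem Standing.exists_lipschitz (hM : M.Standing) :
    ∃ C, ∀ y ∈ M.stateSpace, ∀ y' ∈ M.stateSpace, y.1 = y'.1 → ∀ h ∈ Icc (-M.L) M.L,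
      ‖M.g y h - M.g y' h‖ ≤ C * ‖y - y'‖ := by
  obtain ⟨C, hC0, hC⟩ := hM.exists_q_bound
  have hς : 0 ≤ M.ς.real univ := measureReal_nonneg
  have hL := hM.L_pos
  have hρ := hM.ρ_pos
  refine ⟨(1 + M.L) * M.ρ + (K * C + (2 + K) * M.ς.real univ), fun y hy y' hy' hyy h hh => ?_⟩
  have hn1 : ‖y.2.1 - y'.2.1‖ ≤ ‖y - y'‖ := (norm_fst_le (y - y').2).trans (norm_snd_le (y - y'))
  have hn2 : ‖y.2.2 - y'.2.2‖ ≤ ‖y - y'‖ := (norm_snd_le (y - y').2).trans (norm_snd_le (y - y'))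
  set N := ‖y - y'‖
  have hN : 0 ≤ N := norm_nonneg _
  rw [hM.g_eq hy, hM.g_eq hy', ← hyy]
  have e2 : 0 ≤ (K * C + (2 + K) * M.ς.real univ) * N := by positivity
  have e1 : 0 ≤ (1 + M.L) * M.ρ * N := by positivity
  rw [add_mul]
  refine norm_prod_le_iff.2 ⟨?_, norm_prod_le_iff.2 ⟨?_, ?_⟩⟩
  · simp only [Prod.fst_sub, sub_self, norm_zero]; positivity
  · simp only [Prod.snd_sub, Prod.fst_sub]
    have : y.2.1 * (1 - h) * M.ρ - y'.2.1 * (1 - h) * M.ρ = ((1 - h) * M.ρ) * (y.2.1 - y'.2.1) := by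
      ring
    rw [this, norm_mul, norm_mul, Real.norm_of_nonneg hρ.le]
    have h1 : ‖1 - h‖ ≤ 1 + M.L := by
      rw [Real.norm_eq_abs, abs_le]; constructor <;> linarith [hh.1, hh.2]
    have : ‖1 - h‖ * M.ρ * ‖y.2.1 - y'.2.1‖ ≤ (1 + M.L) * M.ρ * N := by gcongr
    linarith
  · refine le_trans ?_ (le_add_of_nonneg_left e1)
    refine (pi_norm_le_iff_of_nonneg e2).2 fun i => ?_
    simp only [Prod.snd_sub, Pi.sub_apply]
    have hd : ∀ j, |y.2.2 j - y'.2.2 j| ≤ N := fun j =>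
      (norm_le_pi_norm (y.2.2 - y'.2.2) j).trans hn2
    have a1 : |∑ j, y.2.2 j * M.q j i h - ∑ j, y'.2.2 j * M.q j i h| ≤ K * C * N := by
      rw [← Finset.sum_sub_distrib]
      calc _ ≤ ∑ j, |y.2.2 j * M.q j i h - y'.2.2 j * M.q j i h| :=
            Finset.abs_sum_le_sum_abs _ _
        _ ≤ ∑ _j : Fin K, N * C := by
          refine Finset.sum_le_sum fun j _ => ?_
          rw [← sub_mul, abs_mul]
          exact mul_le_mul (hd j) (hC j i h hh) (abs_nonneg _) hN
        _ = _ := by simp; ring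
    have a2 := (abs_rate_sub_le (M := M) (π := y.2.2) (π' := y'.2.2) y.1).trans
      (mul_le_mul_of_nonneg_left hn2 (by positivity))
    have a3 : |y.2.2 i * M.totalRate i y.1 - y'.2.2 i * M.totalRate i y.1| ≤ N * M.ς.real univ := by
      rw [← sub_mul, abs_mul, abs_of_nonneg (M.totalRate_nonneg i _)]
      exact mul_le_mul (hd i) (M.totalRate_le i _) (M.totalRate_nonneg i _) hN
    -- The quadratic term is split as `π i R - π' i R' = (π i - π' i) R + π' i (R - R')`, with `0 ≤
    -- R ≤ ς(ℝ)` and `0 ≤ π' i ≤ 1`.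
    set R := ∑ j, y.2.2 j * M.totalRate j y.1
    set R' := ∑ j, y'.2.2 j * M.totalRate j y.1
    have hR : |R| ≤ M.ς.real univ := by
      have h0 := M.rate_nonneg hy
      rw [rate_eq] at h0
      rw [abs_of_nonneg h0, ← rate_eq]; exact M.rate_le hy
    have hy1 : |y'.2.2 i| ≤ 1 := by
      rw [abs_of_nonneg (hy'.2.2.1 i), ← hy'.2.2.2]
      exact Finset.single_le_sum (fun j _ => hy'.2.2.1 j) (Finset.mem_univ i)
    have a4 : |(y.2.2 i - y'.2.2 i) * R| ≤ N * M.ς.real univ := by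
      rw [abs_mul]; exact mul_le_mul (hd i) hR (abs_nonneg _) hN
    have a5 : |y'.2.2 i * (R - R')| ≤ 1 * (K * M.ς.real univ * N) := by
      rw [abs_mul]; exact mul_le_mul hy1 a2 (abs_nonneg _) zero_le_one
    rw [Real.norm_eq_abs, abs_le]
    rw [abs_le] at a1 a3 a4 a5
    constructor <;> nlinarith

theorem IsTrajectory.fst_eq {a : ℝ → ℝ} {x : State K} {φ : ℝ → State K}
    (hφ : M.IsTrajectory a x φ) {s : ℝ} (hs : s ∈ Icc 0 (M.T - x.1)) : (φ s).1 = x.1 + s := by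
  have hsub : uIcc 0 s ⊆ uIcc 0 (M.T - x.1) := by
    rw [uIcc_of_le hs.1, uIcc_of_le (hs.1.trans hs.2)]; exact Icc_subset_Icc le_rfl hs.2
  have h := hφ.integrable.mono_set hsub
  rw [hφ.eq s hs, Prod.fst_add, intervalIntegral.integral_of_le hs.1,
    fst_integral ((intervalIntegrable_iff_integrableOn_Ioc_of_le hs.1).1 h),
    ← intervalIntegral.integral_of_le hs.1]
  simp [g]

theorem IsTrajectory.continuousOn {a : ℝ → ℝ} {x : State K} {φ : ℝ → State K}
    (hφ : M.IsTrajectory a x φ) : ContinuousOn φ (Icc 0 (M.T - x.1)) := by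
  rcases le_or_gt 0 (M.T - x.1) with h0 | h0
  · refine ContinuousOn.congr (continuousOn_const.add
      (intervalIntegral.continuousOn_primitive_interval'
      (b₁ := 0) (b₂ := M.T - x.1) (a := 0) hφ.integrable (by simp)))
      (fun s hs => hφ.eq s (by rwa [uIcc_of_le h0] at hs)) |>.mono ?_
    rw [uIcc_of_le h0]
  · rw [Icc_eq_empty (not_le.2 h0)]; exact continuousOn_empty _

/-- Trajectories are unique. -/
theorem Standing.trajectory_unique (hM : M.Standing) {a : ℝ → ℝ} {x : State K}
    (ha : ∀ s ∈ Icc 0 (M.T - x.1), a s ∈ Icc (-M.L) M.L)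
    {φ ψ : ℝ → State K} (hφ : M.IsTrajectory a x φ) (hψ : M.IsTrajectory a x ψ) :
    ∀ s ∈ Icc 0 (M.T - x.1), φ s = ψ s := by
  obtain ⟨C, hC⟩ := hM.exists_lipschitz
  have hcont := (hφ.continuousOn.sub hψ.continuousOn).norm
  -- Grönwall for the distance of the two trajectories. Their time components coincide, which is
  -- what the Lipschitz bound requires.
  have key := eq_zero_of_le_mul_integral (u := fun s => ‖φ s - ψ s‖) (C := C) hcont
    (fun s _ => norm_nonneg _) ?_
  · exact fun s hs => sub_eq_zero.1 (norm_eq_zero.1 (key s hs))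
  intro s hs
  have h0 := hs.1.trans hs.2
  have hsub : uIcc 0 s ⊆ uIcc 0 (M.T - x.1) := by
    rw [uIcc_of_le hs.1, uIcc_of_le h0]; exact Icc_subset_Icc le_rfl hs.2
  have h1 := hφ.integrable.mono_set hsub
  have h2 := hψ.integrable.mono_set hsub
  have e : φ s - ψ s = ∫ r in 0..s, (M.g (φ r) (a r) - M.g (ψ r) (a r)) := by
    rw [intervalIntegral.integral_sub h1 h2, hφ.eq s hs, hψ.eq s hs]; abel
  rw [e, ← intervalIntegral.integral_const_mul]
  refine intervalIntegral.norm_integral_le_of_norm_le hs.1 (Eventually.of_forall fun r hr => ?_) ?_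
  · have hr' : r ∈ Icc 0 (M.T - x.1) := ⟨hr.1.le, hr.2.trans hs.2⟩
    exact hC _ (hφ.mem r hr') _ (hψ.mem r hr') ((hφ.fst_eq hr').trans (hψ.fst_eq hr').symm) _
      (ha r hr')
  · refine (ContinuousOn.intervalIntegrable ?_).const_mul C
    rw [uIcc_of_le hs.1]
    exact hcont.mono (Icc_subset_Icc le_rfl hs.2)

/-- Uniqueness makes the choice in `flow` harmless: it agrees with any trajectory that can be
constructed. -/
theorem flow_eq_of_isTrajectory (hM : M.Standing) {a : ℝ → ℝ} {x : State K}
    (ha : ∀ s ∈ Icc 0 (M.T - x.1), a s ∈ Icc (-M.L) M.L)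
    {φ : ℝ → State K} (hφ : M.IsTrajectory a x φ) {s : ℝ} (hs : s ∈ Icc 0 (M.T - x.1)) :
    M.flow a x s = φ s := by
  have H : ∃ φ, M.IsTrajectory a x φ := ⟨φ, hφ⟩
  rw [flow, dif_pos H]
  exact hM.trajectory_unique ha H.choose_spec hφ s hs

end MarketData

namespace MarketData

variable {K : ℕ} {M : MarketData K}

theorem intervalIntegral_prod_mk {E F : Type*} [NormedAddCommGroup E] [NormedSpace ℝ E]
    [NormedAddCommGroup F] [NormedSpace ℝ F] [CompleteSpace E] [CompleteSpace F]
    {f : ℝ → E} {g : ℝ → F} {a b : ℝ}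
    (hf : IntervalIntegrable f volume a b) (hg : IntervalIntegrable g volume a b) :
    IntervalIntegrable (fun r => (f r, g r)) volume a b ∧
      ∫ r in a..b, (f r, g r) = (∫ r in a..b, f r, ∫ r in a..b, g r) := by
  have hfg : IntervalIntegrable (fun r => (f r, g r)) volume a b :=
    ⟨hf.1.prodMk hg.1, hf.2.prodMk hg.2⟩
  refine ⟨hfg, ?_⟩
  simp only [intervalIntegral]
  rw [integral_pair hf.1 hg.1, integral_pair hf.2 hg.2]
  rfl

theorem intervalIntegral_pi {ι : Type*} [Fintype ι] {f : ℝ → ι → ℝ} {a b : ℝ}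
    (hf : ∀ i, IntervalIntegrable (fun r => f r i) volume a b) :
    IntervalIntegrable f volume a b ∧
      ∫ r in a..b, f r = fun i => ∫ r in a..b, f r i := by
  refine ⟨⟨Integrable.of_eval fun i => (hf i).1, Integrable.of_eval fun i => (hf i).2⟩, ?_⟩
  funext i
  simp only [intervalIntegral, Pi.sub_apply]
  rw [eval_integral fun i => (hf i).1, eval_integral fun i => (hf i).2]

/-- The normalised solution of a linear system solves the associated projective system. -/
theorem normalized_eq {ι : Type*} [Fintype ι] {P : ℝ → ι → ℝ} {P' : ℝ → ι → ℝ} {p₀ : ι → ℝ}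
    {τ : ℝ} (hP' : ∀ i, IntervalIntegrable (fun r => P' r i) volume 0 τ)
    (hP : ∀ s ∈ Icc 0 τ, ∀ i, P s i = p₀ i + ∫ r in 0..s, P' r i)
    (h1 : ∑ i, p₀ i = 1) {β : ℝ → ℝ} (hβ : IntervalIntegrable β volume 0 τ)
    (hPβ : ∀ s ∈ Icc 0 τ, ∑ i, P' s i = (∑ i, P s i) * β s) {s : ℝ} (hs : s ∈ Icc 0 τ) (i : ι) :
    P s i / ∑ j, P s j = p₀ i + ∫ r in 0..s, (P' r i / (∑ j, P r j) -
      P r i / (∑ j, P r j) * β r) := by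
  -- The total mass satisfies `S' = S β`, `S 0 = 1`, so `E` is its reciprocal (`hSE`). Division by
  -- `S` becomes multiplication by `E`, and the product rule yields the projective equation.
  set E : ℝ → ℝ := fun s => Real.exp (∫ r in 0..s, (-β) r) with hE
  have hEint : IntervalIntegrable (fun r => (-β) r * E r) volume 0 τ :=
    hβ.neg.mul_continuousOn
      (hβ.neg.absolutelyContinuousOnInterval_intervalIntegral (c := 0) (by simp)).continuousOn.rexp
  have hEs : ∀ s ∈ Icc 0 τ, 1 + ∫ r in 0..s, (-β) r * E r = E s := fun s hs => by
    rw [exp_primitive hβ.neg hs]; simp only [hE]; ring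
  have hmul : ∀ (f : ℝ → ℝ) (c : ℝ), IntervalIntegrable f volume 0 τ → ∀ s ∈ Icc 0 τ,
      ∫ r in 0..s, (f r - (c + ∫ v in 0..r, f v) * β r) * E r = (c + ∫ v in 0..s, f v) * E s - c := by
    intro f c hf s hs
    have := mul_primitive hf hEint c 1 hs
    rw [hEs s hs, mul_one] at this
    rw [← this]
    refine intervalIntegral.integral_congr fun r hr => ?_
    rw [uIcc_of_le hs.1] at hr
    have h2 := hEs r ⟨hr.1, hr.2.trans hs.2⟩
    simp only [Pi.neg_apply] at h2 ⊢
    rw [h2]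
    ring
  have hSint : IntervalIntegrable (fun r => ∑ i, P' r i) volume 0 τ := by
    have := IntervalIntegrable.sum (f := fun i r => P' r i) Finset.univ fun i _ => hP' i
    convert! this using 1
    ext r; simp
  have hS : ∀ s ∈ Icc 0 τ, 1 + ∫ r in 0..s, ∑ i, P' r i = ∑ i, P s i := by
    intro s hs
    have hsub : uIcc 0 s ⊆ uIcc 0 τ := by
      rw [uIcc_of_le hs.1, uIcc_of_le (hs.1.trans hs.2)]; exact Icc_subset_Icc le_rfl hs.2
    rw [intervalIntegral.integral_finsetSum fun i _ => (hP' i).mono_set hsub, ← h1,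
      ← Finset.sum_add_distrib]
    exact Finset.sum_congr rfl fun i _ => (hP s hs i).symm
  have hSE : ∀ s ∈ Icc 0 τ, (∑ i, P s i) * E s = 1 := by
    intro s hs
    have h2 := hmul _ 1 hSint s hs
    have h3 : ∫ r in 0..s, (∑ i, P' r i - (1 + ∫ v in 0..r, ∑ i, P' v i) * β r) * E r = 0 := by
      rw [intervalIntegral.integral_congr (g := fun _ => 0), intervalIntegral.integral_zero]
      intro r hr
      rw [uIcc_of_le hs.1] at hr
      have hr' : r ∈ Icc 0 τ := ⟨hr.1, hr.2.trans hs.2⟩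
      simp only [hS r hr', hPβ r hr', sub_self, zero_mul]
    rw [h3, hS s hs] at h2
    linarith
  have hinv : ∀ s ∈ Icc 0 τ, E s = (∑ j, P s j)⁻¹ := fun s hs =>
    eq_inv_of_mul_eq_one_right (hSE s hs)
  have h4 := hmul _ (p₀ i) (hP' i) s hs
  rw [← hP s hs i, hinv s hs] at h4
  have h5 : ∫ r in 0..s, (P' r i / (∑ j, P r j) - P r i / (∑ j, P r j) * β r) =
      ∫ r in 0..s, (P' r i - (p₀ i + ∫ v in 0..r, P' v i) * β r) * E r := by
    refine intervalIntegral.integral_congr fun r hr => ?_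
    rw [uIcc_of_le hs.1] at hr
    have hr' : r ∈ Icc 0 τ := ⟨hr.1, hr.2.trans hs.2⟩
    simp only [← hP r hr' i, hinv r hr']
    ring
  rw [h5, h4, div_eq_mul_inv]
  ring

/-- Trajectories exist, and they depend measurably on the initial state. -/
theorem Standing.exists_measurable_trajectory (hM : M.Standing) {α : State K → ℝ → ℝ}
    (hα : M.IsControl α) :
    ∃ Φ : State K → ℝ → State K, Measurable (Function.uncurry Φ) ∧
      ∀ x ∈ M.stateSpace, M.IsTrajectory (α x) x (Φ x) ∧
        ∀ s ∈ Icc 0 (M.T - x.1),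
          (Φ x s).2.1 = x.2.1 * Real.exp (∫ r in 0..s, M.ρ * (1 - α x r)) := by
  obtain ⟨C, hC0, hC⟩ := hM.exists_q_bound
  have hς : 0 ≤ M.ς.real univ := measureReal_nonneg
  -- The truncated control keeps the coefficients bounded for all arguments; on the state space, up
  -- to the horizon, it is the given control.
  set a : State K → ℝ → ℝ := fun x r => M.clip (α x r) with ha
  have ham : Measurable (Function.uncurry a) := measurable_clip.comp hα.measurable
  have hamem : ∀ x r, a x r ∈ Icc (-M.L) M.L := fun x r => hM.clip_mem _
  have haα : ∀ x ∈ M.stateSpace, ∀ r ∈ Icc 0 (M.T - x.1), a x r = α x r := fun x hx r hr =>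
    clip_eq (hα.mem_Icc x hx r ⟨hr.1, hr.2.trans (by linarith [hx.1.1])⟩)
  -- The coefficients of the unnormalised filter, `q` minus the total rates on the diagonal, shifted
  -- by the constant `C + ς(ℝ)` on the diagonal. The shift makes all of them nonnegative, as `|q| ≤
  -- C` and the total rates are at most `ς(ℝ)`. It multiplies solutions by an exponential, which
  -- normalisation removes.
  set b : State K → ℝ → Fin K → Fin K → ℝ := fun x r j i =>
    M.q j i (a x r) + if j = i then C + M.ς.real univ - M.totalRate j (x.1 + r) else 0 with hb
  have hbm : ∀ j i, Measurable fun p : State K × ℝ => b p.1 p.2 j i := by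
    intro j i
    refine Measurable.add ((hM.measurable_q_clip j i).comp hα.measurable) ?_
    by_cases hji : j = i
    · simp only [hji, if_true]
      exact ((M.measurable_totalRate i).comp (measurable_fst.fst.add measurable_snd)).const_sub _
    · simp only [hji, if_false]; exact measurable_const
  have hb0 : ∀ x r j i, 0 ≤ b x r j i := by
    intro x r j i
    by_cases hji : j = i
    · have h1 := (abs_le.1 (hC j i _ (hamem x r))).1
      have h2 := M.totalRate_le j (x.1 + r)
      simp only [hb, hji, if_true]
      subst hji
      linarith
    · simp only [hb, hji, if_false, add_zero]
      exact hM.q_nonneg j i hji _ (hamem x r)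
  have hbC : ∀ x r j i, b x r j i ≤ C + (C + M.ς.real univ) := by
    intro x r j i
    have h1 := (abs_le.1 (hC j i _ (hamem x r))).2
    have h2 := M.totalRate_nonneg j (x.1 + r)
    refine add_le_add h1 ?_
    split_ifs <;> linarith
  have hbsum : ∀ x r j, ∑ i, b x r j i = C + M.ς.real univ - M.totalRate j (x.1 + r) := by
    intro x r j
    simp only [hb, Finset.sum_add_distrib, hM.q_row j (hamem x r), Finset.sum_ite_eq,
      Finset.mem_univ, if_true, zero_add]
  obtain ⟨P, hPm, hP0, hP⟩ := exists_linear_flow (p₀ := fun (x : State K) i => x.2.2 i) hbm hb0 hbC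
    (fun i => (measurable_pi_apply i).comp measurable_snd.snd)
  have hSm : Measurable fun p : State K × ℝ => ∑ i, P p.1 p.2 i :=
    Finset.measurable_sum _ fun i _ => hPm i
  have hWm : Measurable fun p : State K × ℝ => ∫ r in Ioc 0 p.2, M.ρ * (1 - a p.1 r) :=
    measurable_integral_Ioc (f := fun x r => M.ρ * (1 - a x r)) ((ham.const_sub 1).const_mul M.ρ)
  -- The candidate: time runs at unit speed, the wealth is an explicit exponential, and the filter
  -- is the normalised linear solution.
  refine ⟨fun x s => (x.1 + s, x.2.1 * Real.exp (∫ r in Ioc 0 s, M.ρ * (1 - a x r)),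
    fun i => P x s i / ∑ j, P x s j), ?_, fun x hx => ?_⟩
  · refine (measurable_fst.fst.add measurable_snd).prodMk (Measurable.prodMk ?_
      (measurable_pi_lambda _ fun i => (hPm i).div hSm))
    exact measurable_fst.snd.fst.mul hWm.exp
  have hτ : 0 ≤ M.T - x.1 := sub_nonneg.2 hx.1.2
  set Φ : ℝ → State K := fun s => (x.1 + s, x.2.1 * Real.exp (∫ r in Ioc 0 s, M.ρ * (1 - a x r)),
    fun i => P x s i / ∑ j, P x s j) with hΦ
  change M.IsTrajectory (α x) x Φ ∧ ∀ s ∈ Icc 0 (M.T - x.1),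
    (Φ s).2.1 = x.2.1 * Real.exp (∫ r in 0..s, M.ρ * (1 - α x r))
  have hx0 : ∀ i, 0 ≤ x.2.2 i := hx.2.2.1
  -- Nonnegative coefficients keep the mass above its initial value one, so the normalisation never
  -- divides by zero.
  have hS1 : ∀ s, 0 ≤ s → 1 ≤ ∑ i, P x s i := by
    intro s hs
    rw [← hx.2.2.2]
    refine Finset.sum_le_sum fun i _ => ?_
    rw [(hP x hx0 s hs i).2]
    exact le_add_of_nonneg_right (intervalIntegral.integral_nonneg hs fun r _ =>
      Finset.sum_nonneg fun j _ => mul_nonneg (hP0 x r j) (hb0 x r j i))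
  have hmem : ∀ s ∈ Icc 0 (M.T - x.1), Φ s ∈ M.stateSpace := by
    intro s hs
    have hS := hS1 s hs.1
    refine ⟨⟨by have := hx.1.1; have := hs.1; simp only [hΦ]; linarith, by
      have := hs.2; simp only [hΦ]; linarith⟩, mul_pos hx.2.1 (Real.exp_pos _), fun i =>
        div_nonneg (hP0 x s i) (by linarith), ?_⟩
    simp only [hΦ]
    rw [← Finset.sum_div, div_self (by linarith)]
  have hg : ∀ r ∈ Icc 0 (M.T - x.1), M.g (Φ r) (α x r) =
      (1, (M.ρ * (1 - a x r)) * (x.2.1 * Real.exp (∫ r in Ioc 0 r, M.ρ * (1 - a x r))), fun i =>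
        (∑ j, P x r j / (∑ j, P x r j) * M.q j i (a x r)) -
        P x r i / (∑ j, P x r j) * (M.totalRate i (x.1 + r) -
          ∑ j, P x r j / (∑ j, P x r j) * M.totalRate j (x.1 + r))) := by
    intro r hr
    rw [hM.g_eq (hmem r hr), haα x hx r hr]
    simp only [hΦ]
    congr 2
    ring
  have hm1 : Measurable fun r => a x r := ham.comp measurable_prodMk_left
  have hPr : ∀ i, Measurable fun r => P x r i := fun i => (hPm i).comp measurable_prodMk_left
  have hdiv : ∀ r ∈ Icc 0 (M.T - x.1), ∀ j, 0 ≤ P x r j / (∑ j, P x r j) ∧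
      P x r j / (∑ j, P x r j) ≤ 1 := fun r hr j =>
    ⟨(hmem r hr).2.2.1 j, by
      have h := (hmem r hr).2.2
      rw [← h.2]
      exact Finset.single_le_sum (fun j _ => h.1 j) (Finset.mem_univ j)⟩
  have hπm : ∀ i, Measurable fun r => P x r i / (∑ j, P x r j) := fun i =>
    (hPr i).div (Finset.measurable_sum _ fun j _ => hPr j)
  have hlm : ∀ i, Measurable fun r => M.totalRate i (x.1 + r) := fun i =>
    (M.measurable_totalRate i).comp (measurable_const_add x.1)
  have hqm : ∀ j i, Measurable fun r => M.q j i (a x r) := fun j i =>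
    (hM.measurable_q_clip j i).comp ((hα.measurable).comp measurable_prodMk_left)
  have hlb : ∀ i r, |M.totalRate i (x.1 + r)| ≤ M.ς.real univ := fun i r => by
    rw [abs_of_nonneg (M.totalRate_nonneg i _)]; exact M.totalRate_le i _
  have hπb : ∀ r ∈ Icc 0 (M.T - x.1), ∀ j, |P x r j / (∑ j, P x r j)| ≤ 1 := fun r hr j => by
    rw [abs_of_nonneg (hdiv r hr j).1]; exact (hdiv r hr j).2
  have hII : ∀ i, IntervalIntegrable (fun r =>
        (∑ j, P x r j / (∑ j, P x r j) * M.q j i (a x r)) -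
        P x r i / (∑ j, P x r j) * (M.totalRate i (x.1 + r) -
          ∑ j, P x r j / (∑ j, P x r j) * M.totalRate j (x.1 + r))) volume 0 (M.T - x.1) := by
    intro i
    refine intervalIntegrable_of_bound (C := K * C + (M.ς.real univ + K * M.ς.real univ))
      (Measurable.sub (Finset.measurable_sum _ fun j _ => (hπm j).mul (hqm j i))
        ((hπm i).mul ((hlm i).sub (Finset.measurable_sum _ fun j _ => (hπm j).mul (hlm j)))))
      hτ fun r hr => ?_
    have hsum : ∀ (f : Fin K → ℝ) (c : ℝ), (∀ j, |f j| ≤ c) →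
        |∑ j, P x r j / (∑ j, P x r j) * f j| ≤ K * c := by
      intro f c hf
      calc _ ≤ ∑ j, |P x r j / (∑ j, P x r j) * f j| := Finset.abs_sum_le_sum_abs _ _
        _ ≤ ∑ _j : Fin K, 1 * c := Finset.sum_le_sum fun j _ => by
          rw [abs_mul]; exact mul_le_mul (hπb r hr j) (hf j) (abs_nonneg _) zero_le_one
        _ = K * c := by simp
    have h1 := hsum _ _ fun j => hC j i _ (hamem x r)
    have h2 := hsum _ _ fun j => hlb j r
    refine (abs_sub _ _).trans (add_le_add h1 ?_)
    rw [abs_mul]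
    calc _ ≤ 1 * (M.ς.real univ + K * M.ς.real univ) :=
          mul_le_mul (hπb r hr i) ((abs_sub _ _).trans (add_le_add (hlb i r) h2)) (abs_nonneg _)
            zero_le_one
      _ = _ := one_mul _
  set v : ℝ → ℝ := fun r => M.ρ * (1 - a x r) with hv
  have hvi : IntervalIntegrable v volume 0 (M.T - x.1) := by
    refine intervalIntegrable_of_bound (C := M.ρ * (1 + M.L))
      ((hm1.const_sub 1).const_mul M.ρ) hτ fun r hr => ?_
    have := hamem x r
    rw [hv, abs_mul, abs_of_pos hM.ρ_pos]
    refine mul_le_mul_of_nonneg_left ?_ hM.ρ_pos.le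
    rw [abs_le]; constructor <;> linarith [this.1, this.2]
  have hvE : ∀ s ∈ Icc 0 (M.T - x.1), x.2.1 * Real.exp (∫ r in Ioc 0 s, v r) =
      x.2.1 * Real.exp (∫ r in 0..s, v r) := fun s hs => by
    rw [intervalIntegral.integral_of_le hs.1]
  have hwi : IntervalIntegrable (fun r => v r * (x.2.1 * Real.exp (∫ r in Ioc 0 r, v r)))
      volume 0 (M.T - x.1) := by
    have h1 : IntervalIntegrable (fun r => v r * (x.2.1 * Real.exp (∫ v' in 0..r, v v')))
        volume 0 (M.T - x.1) := hvi.mul_continuousOn (continuousOn_const.mul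
      (hvi.absolutelyContinuousOnInterval_intervalIntegral (c := 0) (by simp)).continuousOn.rexp)
    refine h1.congr fun r hr => ?_
    rw [uIoc_of_le hτ] at hr
    simp only [hvE r ⟨hr.1.le, hr.2⟩]
  have hGi := intervalIntegral_prod_mk (intervalIntegrable_const (μ := volume) (a := 0)
    (b := M.T - x.1) (c := (1 : ℝ))) (intervalIntegral_prod_mk hwi (intervalIntegral_pi hII).1).1
  refine ⟨⟨hmem, hGi.1.congr fun r hr => ?_, fun s hs => ?_⟩, fun s hs => ?_⟩
  · rw [uIoc_of_le hτ] at hr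
    exact (hg r ⟨hr.1.le, hr.2⟩).symm
  · have hsub : uIcc 0 s ⊆ uIcc 0 (M.T - x.1) := by
      rw [uIcc_of_le hs.1, uIcc_of_le hτ]; exact Icc_subset_Icc le_rfl hs.2
    have hr' : ∀ r ∈ uIcc 0 s, r ∈ Icc 0 (M.T - x.1) := fun r hr => uIcc_of_le hτ ▸ hsub hr
    rw [intervalIntegral.integral_congr fun r hr => hg r (hr' r hr)]
    rw [(intervalIntegral_prod_mk intervalIntegrable_const
      ((intervalIntegral_prod_mk hwi (intervalIntegral_pi hII).1).1.mono_set hsub)).2,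
      (intervalIntegral_prod_mk (hwi.mono_set hsub) ((intervalIntegral_pi hII).1.mono_set hsub)).2,
      (intervalIntegral_pi fun i => (hII i).mono_set hsub).2]
    refine Prod.ext ?_ (Prod.ext ?_ ?_)
    · simp [hΦ]
    · simp only [hΦ, Prod.snd_add, Prod.fst_add]
      have h1 : ∫ r in 0..s, v r * (x.2.1 * Real.exp (∫ r in Ioc 0 r, v r)) =
          x.2.1 * ∫ r in 0..s, v r * Real.exp (∫ r in 0..r, v r) := by
        rw [← intervalIntegral.integral_const_mul]
        refine intervalIntegral.integral_congr fun r hr => ?_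
        rw [uIcc_of_le hs.1] at hr
        simp only [hvE r ⟨hr.1, hr.2.trans hs.2⟩]
        ring
      rw [h1, exp_primitive hvi hs, hvE s hs]
      ring
    · funext i
      simp only [hΦ, Prod.snd_add, Pi.add_apply]
      have hβ : IntervalIntegrable (fun r => ∑ j, P x r j / (∑ j, P x r j) *
          (C + M.ς.real univ - M.totalRate j (x.1 + r))) volume 0 (M.T - x.1) := by
        refine intervalIntegrable_of_bound (C := ∑ j : Fin K, 1 * (C + M.ς.real univ))
          (Finset.measurable_sum _ fun j _ => (hπm j).mul ((hlm j).const_sub _)) hτ fun r hr => ?_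
        refine (Finset.abs_sum_le_sum_abs _ _).trans (Finset.sum_le_sum fun j _ => ?_)
        rw [abs_mul]
        have h1 := M.totalRate_le j (x.1 + r)
        have h2 := M.totalRate_nonneg j (x.1 + r)
        refine mul_le_mul (hπb r hr j) ?_ (abs_nonneg _) zero_le_one
        rw [abs_le]; constructor <;> linarith
      -- The growth rate `β` of the total mass is the average of the row sums of `b`. The constant
      -- `C + ς(ℝ)` occurs both in `P' i / S` and in `π i * β`, and cancels.
      rw [normalized_eq (P := P x) (P' := fun r i => ∑ j, P x r j * b x r j i) (p₀ := x.2.2)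
        (fun i => (hP x hx0 _ hτ i).1) (fun s hs i => (hP x hx0 s hs.1 i).2) hx.2.2.2 hβ ?_ hs i]
      · congr 1
        refine intervalIntegral.integral_congr fun r hr => ?_
        rw [uIcc_of_le hs.1] at hr
        have hr' : r ∈ Icc 0 (M.T - x.1) := ⟨hr.1, hr.2.trans hs.2⟩
        have hS : (∑ j, P x r j) ≠ 0 := by have := hS1 r hr.1; linarith
        have hone : ∑ j, P x r j / (∑ j, P x r j) = 1 := (hmem r hr').2.2.2
        simp only [hb]
        rw [Finset.sum_div]
        have e1 : ∀ j, P x r j * (M.q j i (a x r) + if j = i then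
            C + M.ς.real univ - M.totalRate j (x.1 + r) else 0) / (∑ j, P x r j) =
            P x r j / (∑ j, P x r j) * M.q j i (a x r) + if j = i then P x r j / (∑ j, P x r j) *
              (C + M.ς.real univ - M.totalRate j (x.1 + r)) else 0 := by
          intro j; split_ifs <;> ring
        have e2 : ∑ j, P x r j / (∑ j, P x r j) * (C + M.ς.real univ - M.totalRate j (x.1 + r)) =
            C + M.ς.real univ - ∑ j, P x r j / (∑ j, P x r j) * M.totalRate j (x.1 + r) := by
          simp only [mul_sub, Finset.sum_sub_distrib, ← Finset.sum_mul, mul_add, hone,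
            Finset.sum_add_distrib, one_mul]
        simp only [e1, e2, Finset.sum_add_distrib, Finset.sum_ite_eq', Finset.mem_univ, if_true]
        ring
      · intro r hr
        have hS : (∑ j, P x r j) ≠ 0 := by have := hS1 r hr.1; linarith
        rw [Finset.sum_comm, Finset.mul_sum]
        refine Finset.sum_congr rfl fun j _ => ?_
        rw [← Finset.mul_sum, hbsum]
        field_simp
  · rw [hΦ]
    simp only [hvE s hs]
    congr 2
    refine intervalIntegral.integral_congr fun r hr => ?_
    rw [uIcc_of_le hs.1] at hr
    simp only [hv, haα x hx r ⟨hr.1, hr.2.trans hs.2⟩]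

end MarketData

/-! ### Time-inhomogeneous Markov chains -/

section Chain

variable {E : Type*} [MeasurableSpace E]

/-- `μ` is the law of the Markov chain with transition kernels `κ n` started in `e`. -/
structure IsChainLaw (κ : ℕ → Kernel E E) (e : E) (μ : Measure (ℕ → E)) : Prop where
  prob : IsProbabilityMeasure μ
  initial : ∀ᵐ ω ∂μ, ω 0 = e
  transition : ∀ n, ∀ A : Set (ℕ → E), MeasurableSet[Filtration.piLE n] A →
    ∀ f : E → ℝ≥0∞, Measurable f →
    ∫⁻ ω in A, f (ω (n + 1)) ∂μ = ∫⁻ ω in A, ∫⁻ e', f e' ∂(κ n (ω n)) ∂μ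

theorem measurable_piLE_eval {k n : ℕ} (hkn : k ≤ n) :
    Measurable[Filtration.piLE n] fun ω : ℕ → E => ω k := by
  rw [Filtration.piLE_eq_comap_frestrictLe]
  have : (fun ω : ℕ → E => ω k) = (fun a : (i : Finset.Iic n) → E => a ⟨k, Finset.mem_Iic.2 hkn⟩) ∘
      Preorder.frestrictLe n := rfl
  rw [this]
  exact (measurable_pi_apply _).comp (comap_measurable _)

/-- An event of the past together with a condition on the next state: these are the sets whose
measure the transition property prescribes. -/
theorem piLE_succ_eq (n : ℕ) : (Filtration.piLE (n + 1) : MeasurableSpace (ℕ → E)) =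
    MeasurableSpace.generateFrom {D | ∃ A B, MeasurableSet[Filtration.piLE n] A ∧
      MeasurableSet B ∧ D = A ∩ (fun ω : ℕ → E => ω (n + 1)) ⁻¹' B} := by
  apply le_antisymm
  · rw [Filtration.piLE_eq_comap_frestrictLe, MeasurableSpace.comap_le_iff_le_map]
    refine (@measurable_pi_iff (ℕ → E) (Finset.Iic (n + 1)) (fun _ => E)
      (MeasurableSpace.generateFrom _) _ (Preorder.frestrictLe (n + 1))).2 fun i => ?_
    intro B hB
    rcases Nat.lt_or_ge n i.1 with h | h
    · have hi : i.1 = n + 1 := le_antisymm (Finset.mem_Iic.1 i.2) h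
      refine MeasurableSpace.measurableSet_generateFrom
        ⟨univ, B, @MeasurableSet.univ _ (Filtration.piLE n), hB, ?_⟩
      rw [univ_inter]
      ext ω
      change ω i.1 ∈ B ↔ ω (n + 1) ∈ B
      rw [hi]
    · refine MeasurableSpace.measurableSet_generateFrom
        ⟨(fun ω : ℕ → E => ω i.1) ⁻¹' B, univ, measurable_piLE_eval h hB, MeasurableSet.univ, ?_⟩
      rw [preimage_univ, inter_univ]
      rfl
  · refine MeasurableSpace.generateFrom_le ?_
    rintro _ ⟨A, B, hA, hB, rfl⟩
    exact MeasurableSet.inter (Filtration.piLE.mono n.le_succ A hA)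
      (measurable_piLE_eval le_rfl hB)

theorem isPiSystem_succ (n : ℕ) : IsPiSystem {D : Set (ℕ → E) | ∃ A B,
    MeasurableSet[Filtration.piLE n] A ∧ MeasurableSet B ∧
      D = A ∩ (fun ω : ℕ → E => ω (n + 1)) ⁻¹' B} := by
  rintro _ ⟨A, B, hA, hB, rfl⟩ _ ⟨A', B', hA', hB', rfl⟩ -
  refine ⟨A ∩ A', B ∩ B', MeasurableSet.inter hA hA', hB.inter hB', ?_⟩
  rw [preimage_inter]
  ac_rfl

theorem IsChainLaw.measure_inter {κ : ℕ → Kernel E E} {e : E} {μ : Measure (ℕ → E)}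
    (hμ : IsChainLaw κ e μ) {n : ℕ} {A : Set (ℕ → E)} (hA : MeasurableSet[Filtration.piLE n] A)
    {B : Set E} (hB : MeasurableSet B) :
    μ (A ∩ (fun ω : ℕ → E => ω (n + 1)) ⁻¹' B) = ∫⁻ ω in A, κ n (ω n) B ∂μ := by
  have h := hμ.transition n A hA (B.indicator 1) (measurable_one.indicator hB)
  have h1 : ∀ ω : ℕ → E, ∫⁻ e', B.indicator 1 e' ∂(κ n (ω n)) = κ n (ω n) B := fun ω =>
    lintegral_indicator_one hB
  simp only [h1] at h
  rw [← h]
  have hm : MeasurableSet ((fun ω : ℕ → E => ω (n + 1)) ⁻¹' B) := measurable_pi_apply _ hB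
  have h2 : (fun ω : ℕ → E => B.indicator (1 : E → ℝ≥0∞) (ω (n + 1))) =
      ((fun ω : ℕ → E => ω (n + 1)) ⁻¹' B).indicator 1 := rfl
  rw [h2, lintegral_indicator_one hm, Measure.restrict_apply hm, inter_comm]

/-- The restrictions of the laws to the first `n` coordinates agree by induction, because the
transition property expresses the measure of a generating set at stage `n + 1` by an integral over
the past. The events of finite stages form a π-system that generates the product σ-algebra. -/
theorem IsChainLaw.unique {κ : ℕ → Kernel E E} {e : E} {μ ν : Measure (ℕ → E)}
    (hμ : IsChainLaw κ e μ) (hν : IsChainLaw κ e ν) : μ = ν := by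
  have := hμ.prob
  have := hν.prob
  have key : ∀ n, μ.trim (Filtration.piLE.le n) = ν.trim (Filtration.piLE.le n) := by
    intro n
    induction n with
    | zero =>
      refine @Measure.ext _ (Filtration.piLE 0) _ _ fun A hA => ?_
      rw [trim_measurableSet_eq _ hA, trim_measurableSet_eq _ hA]
      rw [Filtration.piLE_eq_comap_frestrictLe] at hA
      obtain ⟨A', hA', rfl⟩ := hA
      have h0 : ∀ ω : ℕ → E, ω 0 = e → (ω ∈ Preorder.frestrictLe (π := fun _ : ℕ => E) 0 ⁻¹' A' ↔
          (fun _ => e) ∈ A') := by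
        intro ω hω
        have : Preorder.frestrictLe (π := fun _ : ℕ => E) 0 ω = fun _ => e := by
          funext i
          have hi : i.1 = 0 := Nat.le_zero.1 (Finset.mem_Iic.1 i.2)
          change ω i.1 = e
          rw [hi, hω]
        rw [mem_preimage, this]
      -- Both laws start in `e`, so an event at time `0` has probability one or zero according to
      -- whether it contains the constant `e`.
      by_cases hc : (fun _ => e) ∈ A'
      · rw [(prob_compl_eq_zero_iff₀ ?_).1, (prob_compl_eq_zero_iff₀ ?_).1]
        · filter_upwards [hν.initial] with ω hω using (h0 ω hω).2 hc
        · exact (Preorder.measurable_frestrictLe 0 hA').nullMeasurableSet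
        · filter_upwards [hμ.initial] with ω hω using (h0 ω hω).2 hc
        · exact (Preorder.measurable_frestrictLe 0 hA').nullMeasurableSet
      · rw [measure_eq_zero_iff_ae_notMem.2, measure_eq_zero_iff_ae_notMem.2]
        · filter_upwards [hν.initial] with ω hω using fun h => hc ((h0 ω hω).1 h)
        · filter_upwards [hμ.initial] with ω hω using fun h => hc ((h0 ω hω).1 h)
    | succ n ih =>
      refine ext_of_generate_finite _ (piLE_succ_eq n) (isPiSystem_succ n) ?_ ?_
      · rintro _ ⟨A, B, hA, hB, rfl⟩
        have hD : MeasurableSet[Filtration.piLE (n + 1)]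
            (A ∩ (fun ω : ℕ → E => ω (n + 1)) ⁻¹' B) :=
          MeasurableSet.inter (Filtration.piLE.mono n.le_succ A hA) (measurable_piLE_eval le_rfl hB)
        rw [trim_measurableSet_eq _ hD, trim_measurableSet_eq _ hD, hμ.measure_inter hA hB,
          hν.measure_inter hA hB]
        have hf : Measurable[Filtration.piLE n] fun ω : ℕ → E => κ n (ω n) B :=
          ((κ n).measurable_coe hB).comp (measurable_piLE_eval le_rfl)
        rw [← setLIntegral_trim (Filtration.piLE.le n) hf hA,
          ← setLIntegral_trim (Filtration.piLE.le n) hf hA, ih]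
      · rw [trim_measurableSet_eq _ MeasurableSet.univ, trim_measurableSet_eq _ MeasurableSet.univ,
          measure_univ, measure_univ]
  have hgen : (MeasurableSpace.pi : MeasurableSpace (ℕ → E)) =
      MeasurableSpace.generateFrom {A | ∃ n, MeasurableSet[Filtration.piLE n] A} := by
    apply le_antisymm
    · refine iSup_le fun k => ?_
      rintro _ ⟨B, hB, rfl⟩
      exact MeasurableSpace.measurableSet_generateFrom ⟨k, measurable_piLE_eval le_rfl hB⟩
    · refine MeasurableSpace.generateFrom_le ?_
      rintro A ⟨n, hA⟩
      exact Filtration.piLE.le n A hA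
  refine ext_of_generate_finite _ hgen ?_ ?_ (by rw [measure_univ, measure_univ])
  · rintro A ⟨n, hA⟩ B ⟨m, hB⟩ -
    exact ⟨max n m, MeasurableSet.inter (Filtration.piLE.mono (le_max_left _ _) A hA)
      (Filtration.piLE.mono (le_max_right _ _) B hB)⟩
  · rintro A ⟨n, hA⟩
    rw [← trim_measurableSet_eq (Filtration.piLE.le n) hA,
      ← trim_measurableSet_eq (Filtration.piLE.le n) hA, key]

/-- The Ionescu-Tulcea theorem for kernels on histories which look only at the last coordinate. -/
theorem exists_isChainLaw [MeasurableSingletonClass E] (κ : ℕ → Kernel E E) [∀ n, IsMarkovKernel (κ n)] (e : E) :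
    ∃ μ, IsChainLaw κ e μ := by
  set κ' : (n : ℕ) → Kernel ((i : Finset.Iic n) → E) E := fun n =>
    (κ n).comap (fun a => a ⟨n, Finset.mem_Iic.2 le_rfl⟩) (measurable_pi_apply _) with hκ'
  have : ∀ n, IsMarkovKernel (κ' n) := fun n => by rw [hκ']; infer_instance
  refine ⟨Kernel.trajMeasure (X := fun _ => E) (Measure.dirac e) κ', inferInstance, ?_, ?_⟩
  · have h := Measure.map_comp (Measure.map (MeasurableEquiv.piUnique fun i : Finset.Iic 0 => E).symm
      (Measure.dirac e)) (Kernel.traj (X := fun _ => E) κ' 0)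
      (Preorder.measurable_frestrictLe (X := fun _ => E) 0)
    rw [Kernel.traj_map_frestrictLe, Kernel.partialTraj_self, Measure.id_comp] at h
    have h2 : ∀ᵐ a ∂(Measure.map (MeasurableEquiv.piUnique fun i : Finset.Iic 0 => E).symm
      (Measure.dirac e)), a ∈ {a : (i : Finset.Iic 0) → E | a ⟨0, by simp⟩ = e} := by
      have hev : Measurable fun a : (i : Finset.Iic 0) → E => a ⟨0, by simp⟩ :=
        measurable_pi_apply _
      have hs : MeasurableSet {a : (i : Finset.Iic 0) → E | a ⟨0, by simp⟩ = e} :=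
        hev (measurableSet_singleton e)
      refine (ae_map_iff (MeasurableEquiv.measurable _).aemeasurable hs).2 ?_
      rw [ae_dirac_eq]
      exact eventually_pure.2 rfl
    rw [← h] at h2
    exact ae_of_ae_map (Preorder.measurable_frestrictLe (X := fun _ => E) 0).aemeasurable h2
  · intro n A hA f hf
    rw [Filtration.piLE_eq_comap_frestrictLe] at hA
    obtain ⟨A', hA', rfl⟩ := hA
    set μ := Kernel.trajMeasure (X := fun _ => E) (Measure.dirac e) κ'
    have h := Kernel.map_frestrictLe_trajMeasure_compProd_eq_map_trajMeasure (X := fun _ => E)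
      (μ₀ := Measure.dirac e) (κ := κ') (a := n)
    -- The disintegration of the law of history and next state is tested with the indicator of a
    -- past event times a function of the next state.
    have hg : Measurable fun p : ((i : Finset.Iic n) → E) × E => A'.indicator 1 p.1 * f p.2 :=
      ((measurable_one.indicator hA').comp measurable_fst).mul (hf.comp measurable_snd)
    have hfr := Preorder.measurable_frestrictLe (X := fun _ : ℕ => E) n
    have h3 := congrArg (fun m => ∫⁻ p, A'.indicator (1 : ((i : Finset.Iic n) → E) → ℝ≥0∞) p.1 * f p.2 ∂m) h
    have hf2 : Measurable fun a : (i : Finset.Iic n) → E => ∫⁻ e', f e' ∂(κ' n a) :=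
      hf.lintegral_kernel
    rw [Measure.lintegral_compProd hg, lintegral_map hg (hfr.prodMk (measurable_pi_apply _))] at h3
    simp only at h3
    have h4 : ∀ a, ∫⁻ e', A'.indicator (1 : ((i : Finset.Iic n) → E) → ℝ≥0∞) a * f e' ∂(κ' n a) =
        A'.indicator (fun a => ∫⁻ e', f e' ∂(κ' n a)) a := by
      intro a
      by_cases ha : a ∈ A' <;> simp [ha]
    simp only [h4] at h3
    rw [lintegral_map (hf2.indicator hA') hfr] at h3
    rw [← lintegral_indicator (hfr hA'), ← lintegral_indicator (hfr hA')]
    convert! h3.symm using 1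
    · congr 1 with ω
      by_cases ha : ω ∈ Preorder.frestrictLe (π := fun _ : ℕ => E) n ⁻¹' A'
      · rw [indicator_of_mem ha]; rw [mem_preimage] at ha; simp [ha]
      · rw [indicator_of_notMem ha]; rw [mem_preimage] at ha; simp [ha]

end Chain

instance {α β : Type*} [MeasurableSpace α] [MeasurableSpace β] [MeasurableSingletonClass α]
    [MeasurableSingletonClass β] : MeasurableSingletonClass (α ⊕ β) where
  measurableSet_singleton := by
    rintro (a | b)
    · rw [← image_singleton]; exact (measurableSet_singleton a).inl_image
    · rw [← image_singleton]; exact (measurableSet_singleton b).inr_image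

namespace MarketData

variable {K : ℕ} {M : MarketData K}

/-! ### Measurable versions of the flow and of the transition operator -/

variable (M) in
/-- `Φ` is a jointly measurable version of the flow under the feedback control `α`. -/
structure IsFlowVersion (α : State K → ℝ → ℝ) (Φ : State K → ℝ → State K) : Prop where
  measurable : Measurable (Function.uncurry Φ)
  mem : ∀ x ∈ M.stateSpace, ∀ s ∈ Icc 0 (M.T - x.1), Φ x s ∈ M.stateSpace
  flow_eq : ∀ x ∈ M.stateSpace, ∀ s ∈ Icc 0 (M.T - x.1), M.flow (α x) x s = Φ x s
  fst_eq : ∀ x ∈ M.stateSpace, ∀ s ∈ Icc 0 (M.T - x.1), (Φ x s).1 = x.1 + s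
  wealth_eq : ∀ x ∈ M.stateSpace, ∀ s ∈ Icc 0 (M.T - x.1),
    (Φ x s).2.1 = x.2.1 * Real.exp (∫ r in 0..s, M.ρ * (1 - α x r))

/-- `flow` is chosen separately for each initial state, so its definition does not yield joint
measurability. All kernels are therefore built from `Φ`. -/
theorem Standing.exists_flowVersion (hM : M.Standing) {α : State K → ℝ → ℝ}
    (hα : M.IsControl α) : ∃ Φ, M.IsFlowVersion α Φ := by
  obtain ⟨Φ, hΦm, hΦ⟩ := hM.exists_measurable_trajectory hα
  refine ⟨Φ, hΦm, fun x hx => (hΦ x hx).1.mem, fun x hx s hs => ?_,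
    fun x hx s hs => (hΦ x hx).1.fst_eq hs, fun x hx => (hΦ x hx).2⟩
  exact flow_eq_of_isTrajectory hM (fun s hs => hα.mem_Icc x hx s ⟨hs.1, hs.2.trans
    (by linarith [hx.1.1])⟩) (hΦ x hx).1 hs

variable (M) in
/-- The cumulated jump rate along a version of the flow. -/
noncomputable def hazard (Φ : State K → ℝ → State K) (x : State K) (s : ℝ) : ℝ :=
  ∫ r in Ioc 0 s, M.rate (Φ x r)

variable (M) in
/-- The density of the waiting time for the next jump. -/
noncomputable def jumpDens (Φ : State K → ℝ → State K) (x : State K) (v : ℝ) : ℝ≥0∞ :=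
  ENNReal.ofReal (M.rate (Φ x v) * Real.exp (-M.hazard Φ x v))

variable (M) in
/-- The probability that there is no further jump. -/
noncomputable def noJump (Φ : State K → ℝ → State K) (x : State K) : ℝ≥0∞ :=
  ENNReal.ofReal (Real.exp (-M.hazard Φ x (M.T - x.1)))

namespace IsFlowVersion

variable {α : State K → ℝ → ℝ} {Φ : State K → ℝ → State K}

theorem measurable_rate (hΦ : M.IsFlowVersion α Φ) :
    Measurable fun p : State K × ℝ => M.rate (Φ p.1 p.2) :=
  M.measurable_rate.comp hΦ.measurable

theorem measurable_hazard (hΦ : M.IsFlowVersion α Φ) :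
    Measurable fun p : State K × ℝ => M.hazard Φ p.1 p.2 :=
  measurable_integral_Ioc (f := fun x r => M.rate (Φ x r)) hΦ.measurable_rate

theorem measurable_jumpDens (hΦ : M.IsFlowVersion α Φ) :
    Measurable fun p : State K × ℝ => M.jumpDens Φ p.1 p.2 :=
  (hΦ.measurable_rate.mul hΦ.measurable_hazard.neg.exp).ennreal_ofReal

theorem measurable_noJump (hΦ : M.IsFlowVersion α Φ) : Measurable (M.noJump Φ) :=
  (hΦ.measurable_hazard.comp
    (measurable_id.prodMk (measurable_fst.const_sub M.T))).neg.exp.ennreal_ofReal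

theorem cumRate_eq (hΦ : M.IsFlowVersion α Φ) {x : State K} (hx : x ∈ M.stateSpace) {s : ℝ}
    (hs : s ∈ Icc 0 (M.T - x.1)) : M.cumRate (α x) x s = M.hazard Φ x s := by
  rw [cumRate, intervalIntegral.integral_of_le hs.1, hazard]
  refine setIntegral_congr_fun measurableSet_Ioc fun r hr => ?_
  simp only [hΦ.flow_eq x hx r ⟨hr.1.le, hr.2.trans hs.2⟩]

theorem intervalIntegrable_rate (hΦ : M.IsFlowVersion α Φ) {x : State K} (hx : x ∈ M.stateSpace) :
    IntervalIntegrable (fun r => M.rate (Φ x r)) volume 0 (M.T - x.1) := by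
  refine intervalIntegrable_of_bound (C := M.ς.real univ)
    (hΦ.measurable_rate.comp measurable_prodMk_left) (sub_nonneg.2 hx.1.2) fun r hr => ?_
  have := hΦ.mem x hx r hr
  rw [abs_of_nonneg (M.rate_nonneg this)]
  exact M.rate_le this

theorem mass (hΦ : M.IsFlowVersion α Φ) {x : State K} (hx : x ∈ M.stateSpace) {s : ℝ}
    (hs : s ∈ Icc 0 (M.T - x.1)) :
    (∫⁻ v in Ioc s (M.T - x.1), M.jumpDens Φ x v) + M.noJump Φ x =
      ENNReal.ofReal (Real.exp (-M.hazard Φ x s)) := by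
  have h := lintegral_hazard (hΦ.intervalIntegrable_rate hx)
    (fun r hr => M.rate_nonneg (hΦ.mem x hx r hr)) hs
  have e : ∀ v, 0 ≤ v → ∫ r in 0..v, M.rate (Φ x r) = M.hazard Φ x v := fun v hv => by
    rw [hazard, intervalIntegral.integral_of_le hv]
  rw [e s hs.1, e _ (sub_nonneg.2 hx.1.2)] at h
  rw [← h, noJump]
  congr 1
  refine setLIntegral_congr_fun measurableSet_Ioc fun v hv => ?_
  rw [jumpDens, e v (hs.1.trans hv.1.le)]

theorem mass_zero (hΦ : M.IsFlowVersion α Φ) {x : State K} (hx : x ∈ M.stateSpace) :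
    (∫⁻ v in Ioc 0 (M.T - x.1), M.jumpDens Φ x v) + M.noJump Φ x = 1 := by
  rw [hΦ.mass hx ⟨le_rfl, sub_nonneg.2 hx.1.2⟩]
  simp [hazard]

theorem noJump_eq (hΦ : M.IsFlowVersion α Φ) {x : State K} (hx : x ∈ M.stateSpace) :
    ENNReal.ofReal (Real.exp (-M.cumRate (α x) x (M.T - x.1))) = M.noJump Φ x := by
  rw [noJump, hΦ.cumRate_eq hx ⟨sub_nonneg.2 hx.1.2, le_rfl⟩]

/-- The rate is at most `ς(ℝ)` and the remaining time at most `T`. The lower bound does not depend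
on the state or the control, which forces absorption. -/
theorem le_noJump (hΦ : M.IsFlowVersion α Φ) {x : State K} (hx : x ∈ M.stateSpace) :
    ENNReal.ofReal (Real.exp (-(M.ς.real univ * M.T))) ≤ M.noJump Φ x := by
  refine ENNReal.ofReal_le_ofReal (Real.exp_le_exp.2 (neg_le_neg ?_))
  have hτ := sub_nonneg.2 hx.1.2
  have hς : 0 ≤ M.ς.real univ := measureReal_nonneg
  have h1 : M.hazard Φ x (M.T - x.1) ≤ ∫ _r in Ioc 0 (M.T - x.1), M.ς.real univ := by
    refine setIntegral_mono_on ((intervalIntegrable_iff_integrableOn_Ioc_of_le hτ).1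
      (hΦ.intervalIntegrable_rate hx)) (integrableOn_const (by simp)) measurableSet_Ioc
      fun r hr => M.rate_le (hΦ.mem x hx r ⟨hr.1.le, hr.2⟩)
  refine h1.trans ?_
  rw [setIntegral_const]
  simp only [Real.volume_real_Ioc_of_le hτ, sub_zero, smul_eq_mul]
  nlinarith [hx.1.1]

end IsFlowVersion

variable (M) in
/-- The measurable version of the transition operator `Q_L`. -/
noncomputable def transOp (α : State K → ℝ → ℝ) (Φ : State K → ℝ → State K)
    (f : ExtState K → ℝ≥0∞) (x : State K) : ℝ≥0∞ :=
  (∫⁻ v in Ioc 0 (M.T - x.1), M.jumpDens Φ x v *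
    M.jumpOp (fun y => f (Sum.inl y)) (Φ x v) (α x v)) + M.noJump Φ x * f (Sum.inr ())

namespace IsFlowVersion

variable {α : State K → ℝ → ℝ} {Φ : State K → ℝ → State K}

theorem mdmOp_eq (hΦ : M.IsFlowVersion α Φ) {x : State K} (hx : x ∈ M.stateSpace)
    (f : ExtState K → ℝ≥0∞) : M.mdmOp f x (α x) = M.transOp α Φ f x := by
  rw [mdmOp, transOp, hΦ.noJump_eq hx]
  congr 1
  refine setLIntegral_congr_fun measurableSet_Ioc fun v hv => ?_
  have hv' : v ∈ Icc 0 (M.T - x.1) := ⟨hv.1.le, hv.2⟩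
  simp only [hΦ.flow_eq x hx v hv', hΦ.cumRate_eq hx hv', jumpDens]

theorem measurable_jumpOp (hα : Measurable (Function.uncurry α)) (hΦ : M.IsFlowVersion α Φ)
    {f : State K → ℝ≥0∞} (hf : Measurable f) :
    Measurable fun p : State K × ℝ => M.jumpOp f (Φ p.1 p.2) (α p.1 p.2) := by
  have h : Measurable fun p : State K × ℝ => (Φ p.1 p.2, α p.1 p.2) :=
    Measurable.prodMk hΦ.measurable hα
  have h2 := (M.measurable_jumpOp hf).comp h
  exact h2

theorem measurable_transOp (hα : Measurable (Function.uncurry α)) (hΦ : M.IsFlowVersion α Φ)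
    {f : ExtState K → ℝ≥0∞} (hf : Measurable f) : Measurable (M.transOp α Φ f) := by
  refine Measurable.add ?_ (hΦ.measurable_noJump.mul_const _)
  exact (measurable_lintegral_Ioc (f := fun x v => M.jumpDens Φ x v *
    M.jumpOp (fun y => f (Sum.inl y)) (Φ x v) (α x v))
    (hΦ.measurable_jumpDens.mul (measurable_jumpOp hα hΦ (hf.comp measurable_inl)))).comp
    (measurable_id.prodMk (measurable_fst.const_sub M.T))

end IsFlowVersion

variable (M) in
/-- The jump kernel `Q`. -/
noncomputable def jumpKernel : Kernel (State K × ℝ) (State K) where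
  toFun p := (ENNReal.ofReal (M.rate p.1))⁻¹ • ∑ j, ENNReal.ofReal (p.1.2.2 j) •
    (M.eta j p.1.1).map (M.jumpMap p.1 p.2)
  measurable' := by
    refine Measure.measurable_of_measurable_coe _ fun C hC => ?_
    have := M.measurable_jumpOp (f := C.indicator 1) (measurable_one.indicator hC)
    convert! this using 2 with p
    have hm : Measurable (M.jumpMap p.1 p.2) := M.measurable_jumpMap.comp
      (measurable_const.prodMk (measurable_const.prodMk measurable_id))
    rw [jumpOp, Measure.smul_apply, Measure.finsetSum_apply, smul_eq_mul, mul_comm,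
      ← ENNReal.div_eq_inv_mul.trans (mul_comm _ _)]
    congr 1
    refine Finset.sum_congr rfl fun j _ => ?_
    rw [Measure.smul_apply, smul_eq_mul, Measure.map_apply hm hC,
      ← lintegral_indicator_one (hm hC)]
    rfl

theorem lintegral_jumpKernel {f : State K → ℝ≥0∞} (hf : Measurable f) (p : State K × ℝ) :
    ∫⁻ y, f y ∂(M.jumpKernel p) = M.jumpOp f p.1 p.2 := by
  have hm : Measurable (M.jumpMap p.1 p.2) := M.measurable_jumpMap.comp
    (measurable_const.prodMk (measurable_const.prodMk measurable_id))
  change ∫⁻ y, f y ∂((ENNReal.ofReal (M.rate p.1))⁻¹ • ∑ j, ENNReal.ofReal (p.1.2.2 j) •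
    (M.eta j p.1.1).map (M.jumpMap p.1 p.2)) = _
  rw [lintegral_smul_measure, lintegral_finsetSum_measure, jumpOp, smul_eq_mul,
    ENNReal.div_eq_inv_mul]
  congr 1
  refine Finset.sum_congr rfl fun j _ => ?_
  rw [lintegral_smul_measure, lintegral_map hf hm, smul_eq_mul]

variable (M) in
/-- The transition measure of the embedded chain. -/
noncomputable def transMeasure (α : State K → ℝ → ℝ) (Φ : State K → ℝ → State K) (x : State K) :
    Measure (ExtState K) :=
  (((volume.restrict (Ioc 0 (M.T - x.1))).withDensity (M.jumpDens Φ x)).bind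
    fun v => M.jumpKernel (Φ x v, α x v)).map Sum.inl + M.noJump Φ x • Measure.dirac (Sum.inr ())

theorem IsFlowVersion.lintegral_transMeasure {α : State K → ℝ → ℝ} {Φ : State K → ℝ → State K}
    (hα : Measurable (Function.uncurry α)) (hΦ : M.IsFlowVersion α Φ)
    {f : ExtState K → ℝ≥0∞} (hf : Measurable f) (x : State K) :
    ∫⁻ e, f e ∂(M.transMeasure α Φ x) = M.transOp α Φ f x := by
  have hfl : Measurable fun y : State K => f (Sum.inl y) := hf.comp measurable_inl
  have hd : Measurable (M.jumpDens Φ x) := by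
    have h := hΦ.measurable_jumpDens.comp (measurable_prodMk_left (x := x))
    exact h
  have hp : Measurable fun v => (Φ x v, α x v) :=
    (hΦ.measurable.comp measurable_prodMk_left).prodMk (hα.comp measurable_prodMk_left)
  have hJ : Measurable fun v => M.jumpKernel (Φ x v, α x v) := by
    have h := M.jumpKernel.measurable.comp hp
    exact h
  have hO := (IsFlowVersion.measurable_jumpOp hα hΦ hfl).comp (measurable_prodMk_left (x := x))
  rw [transMeasure, lintegral_add_measure, lintegral_map hf measurable_inl,
    Measure.lintegral_bind hJ.aemeasurable hfl.aemeasurable, lintegral_smul_measure,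
    lintegral_dirac' _ hf, transOp, smul_eq_mul]
  congr 1
  simp only [lintegral_jumpKernel hfl]
  have h := lintegral_withDensity_eq_lintegral_mul (volume.restrict (Ioc 0 (M.T - x.1))) hd hO
  simp only [Pi.mul_apply, Function.comp_apply] at h
  exact h

variable (M) in
/-- The states of the chain: the state space and the cemetery. -/
def chainSpace : Set (ExtState K) := {e | ∀ y, e = Sum.inl y → y ∈ M.stateSpace}

@[simp] theorem inl_mem_chainSpace {y : State K} :
    (Sum.inl y : ExtState K) ∈ M.chainSpace ↔ y ∈ M.stateSpace :=
  ⟨fun h => h y rfl, fun h y' hy' => by rwa [← Sum.inl_injective hy']⟩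

@[simp] theorem inr_mem_chainSpace {u : Unit} : (Sum.inr u : ExtState K) ∈ M.chainSpace :=
  fun y hy => by simp at hy

theorem measurableSet_chainSpace : MeasurableSet M.chainSpace := by
  refine measurableSet_sum_iff.2 ⟨?_, ?_⟩
  · convert M.measurableSet_stateSpace using 1
    ext y; simp
  · convert MeasurableSet.univ using 1
    ext y; simp

/-- The transition operator does not leave the state space. -/
theorem IsFlowVersion.jumpOp_compl (hM : M.Standing) {α : State K → ℝ → ℝ}
    {Φ : State K → ℝ → State K} (hΦ : M.IsFlowVersion α Φ) {x : State K} (hx : x ∈ M.stateSpace)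
    (hw : ∀ s ∈ Icc 0 (M.T - x.1), ∀ i, M.eta i (x.1 + s) {z | 1 + α x s * z ≤ 0} = 0) {v : ℝ}
    (hv : v ∈ Icc 0 (M.T - x.1)) {f : State K → ℝ≥0∞} (hf : ∀ y ∈ M.stateSpace, f y = 0) :
    M.jumpOp f (Φ x v) (α x v) = 0 := by
  have hy := hΦ.mem x hx v hv
  rw [jumpOp]
  refine ENNReal.div_eq_zero_iff.2 (Or.inl (Finset.sum_eq_zero fun j _ => ?_))
  refine mul_eq_zero_of_right _ ?_
  rw [lintegral_congr_ae (g := fun _ => 0), lintegral_zero]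
  have h1 := hw v hv j
  rw [← hΦ.fst_eq x hx v hv] at h1
  -- After a jump the filter lies in the simplex by Bayes' formula, and the wealth is positive by
  -- admissibility.
  filter_upwards [hM.ae_filter_mem hy.1 hy.2.2 j, measure_eq_zero_iff_ae_notMem.1 h1] with z h2 h3
  refine hf _ ⟨hy.1, mul_pos hy.2.1 (not_le.1 h3), h2⟩

theorem IsFlowVersion.transOp_compl (hM : M.Standing) {α : State K → ℝ → ℝ}
    {Φ : State K → ℝ → State K} (hΦ : M.IsFlowVersion α Φ) {x : State K} (hx : x ∈ M.stateSpace)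
    (hw : ∀ s ∈ Icc 0 (M.T - x.1), ∀ i, M.eta i (x.1 + s) {z | 1 + α x s * z ≤ 0} = 0)
    {f : ExtState K → ℝ≥0∞} (hf : ∀ e ∈ M.chainSpace, f e = 0) :
    M.transOp α Φ f x = 0 := by
  rw [transOp, hf _ inr_mem_chainSpace, mul_zero, add_zero]
  rw [setLIntegral_congr_fun measurableSet_Ioc (g := fun _ => 0), lintegral_zero]
  intro v hv
  simp only
  rw [hΦ.jumpOp_compl hM hx hw ⟨hv.1.le, hv.2⟩ fun y hy => hf _ (inl_mem_chainSpace.2 hy), mul_zero]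

theorem IsFlowVersion.transOp_const {α : State K → ℝ → ℝ}
    {Φ : State K → ℝ → State K} (hΦ : M.IsFlowVersion α Φ) {x : State K} (hx : x ∈ M.stateSpace) :
    M.transOp α Φ (fun _ => 1) x = 1 := by
  rw [transOp, mul_one]
  refine Eq.trans ?_ (hΦ.mass_zero hx)
  congr 1
  refine setLIntegral_congr_fun measurableSet_Ioc fun v hv => ?_
  have hy := hΦ.mem x hx v ⟨hv.1.le, hv.2⟩
  simp only [jumpDens]
  rw [ENNReal.ofReal_mul (M.rate_nonneg hy), mul_right_comm, M.jumpOp_const hy, mul_one]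

open Classical in
/-- The transition operator of the Markov decision model under a feedback control is given by a
Markov kernel. -/
theorem IsFlowVersion.exists_kernel {α : State K → ℝ → ℝ} {Φ : State K → ℝ → State K}
    (hα : Measurable (Function.uncurry α)) (hΦ : M.IsFlowVersion α Φ) :
    ∃ κ : Kernel (ExtState K) (ExtState K), IsMarkovKernel κ ∧ ∀ f, Measurable f →
      ∀ e ∈ M.chainSpace, ∫⁻ e', f e' ∂(κ e) =
        Sum.elim (fun y => M.mdmOp f y (α y)) (fun _ => f (Sum.inr ())) e := by
  -- Outside the state space the kernel moves to the cemetery, only in order to be Markov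
  -- everywhere.
  have hm : Measurable (Sum.elim
      (fun y => if y ∈ M.stateSpace then M.transMeasure α Φ y else Measure.dirac (Sum.inr ()))
      (fun _ => Measure.dirac (Sum.inr ())) : ExtState K → Measure (ExtState K)) := by
    refine Measurable.sumElim (Measurable.ite M.measurableSet_stateSpace ?_ measurable_const)
      measurable_const
    refine Measure.measurable_of_measurable_coe _ fun C hC => ?_
    have := measurable_transOp hα hΦ (f := C.indicator 1) (measurable_one.indicator hC)
    convert! this using 2 with x
    rw [← lintegral_transMeasure hα hΦ (measurable_one.indicator hC), lintegral_indicator_one hC]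
  refine ⟨⟨_, hm⟩, ⟨?_⟩, ?_⟩
  · rintro (y | u)
    · change IsProbabilityMeasure (if y ∈ M.stateSpace then _ else _)
      split_ifs with hy
      · refine ⟨?_⟩
        rw [← hΦ.transOp_const hy, ← lintegral_transMeasure hα hΦ measurable_const]
        simp
      · infer_instance
    · change IsProbabilityMeasure (Measure.dirac _)
      infer_instance
  · rintro f hf (y | u) he
    · change ∫⁻ e', f e' ∂(if y ∈ M.stateSpace then M.transMeasure α Φ y else _) = M.mdmOp f y (α y)
      have hy := inl_mem_chainSpace.1 he
      rw [if_pos hy, lintegral_transMeasure hα hΦ hf, hΦ.mdmOp_eq hy]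
    · change ∫⁻ e', f e' ∂(Measure.dirac _) = f (Sum.inr ())
      rw [lintegral_dirac' _ hf]

end MarketData

/-- Markov property for functions of two consecutive states. -/
theorem IsChainLaw.transition_pair {E : Type*} [MeasurableSpace E] {κ : ℕ → Kernel E E}
    [∀ n, IsMarkovKernel (κ n)] {e : E}
    {μ : Measure (ℕ → E)} (hμ : IsChainLaw κ e μ) (n : ℕ) {A : Set (ℕ → E)}
    (hA : MeasurableSet[Filtration.piLE n] A) {F : E × E → ℝ≥0∞} (hF : Measurable F) :
    ∫⁻ ω in A, F (ω n, ω (n + 1)) ∂μ = ∫⁻ ω in A, ∫⁻ e', F (ω n, e') ∂(κ n (ω n)) ∂μ := by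
  have := hμ.prob
  have hn : Measurable fun ω : ℕ → E => ω n := measurable_pi_apply n
  have hnn : Measurable fun ω : ℕ → E => (ω n, ω (n + 1)) := hn.prodMk (measurable_pi_apply _)
  -- The joint law is identified on rectangles: the condition on the current state is absorbed into
  -- the past event `A`.
  have key : (μ.restrict A).map (fun ω => (ω n, ω (n + 1))) =
      (μ.restrict A).map (fun ω => ω n) ⊗ₘ κ n := by
    refine ext_of_generate_finite _ generateFrom_prod.symm isPiSystem_prod ?_ ?_
    · rintro _ ⟨B, hB, C, hC, rfl⟩
      rw [Measure.map_apply hnn (hB.prod hC), Measure.compProd_apply_prod hB hC,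
        setLIntegral_map hB ((κ n).measurable_coe hC) hn,
        Measure.restrict_restrict (hn hB), Measure.restrict_apply (hnn (hB.prod hC))]
      have hAB : MeasurableSet[Filtration.piLE n] ((fun ω : ℕ → E => ω n) ⁻¹' B ∩ A) :=
        MeasurableSet.inter (measurable_piLE_eval le_rfl hB) hA
      rw [← hμ.measure_inter hAB hC]
      congr 1
      ext ω
      simp only [mem_inter_iff, mem_preimage, mem_prod]
      tauto
    · rw [Measure.map_apply hnn MeasurableSet.univ, preimage_univ, Measure.compProd_apply_univ,
        Measure.map_apply hn MeasurableSet.univ, preimage_univ]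
  rw [← lintegral_map hF hnn, key, Measure.lintegral_compProd hF, lintegral_map ?_ hn]
  exact hF.lintegral_kernel_prod_right'

namespace MarketData

variable {K : ℕ} {M : MarketData K}

theorem Admissible.isControl {h : Strategy K} (hh : M.Admissible h) (n : ℕ) : M.IsControl (h n) :=
  ⟨hh.measurable n, hh.mem_Icc n⟩

/-! ### The law of the Markov decision model -/

variable (M) in
/-- The Markov property of the Markov decision model at stage `n`. -/
def StepAt (h : Strategy K) (μ : Measure (PathSpace K)) (n : ℕ) : Prop :=
  ∀ A : Set (PathSpace K), MeasurableSet[Filtration.piLE n] A →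
    ∀ f : ExtState K → ℝ≥0∞, Measurable f →
    ∫⁻ ω in A, f (ω (n + 1)) ∂μ =
      ∫⁻ ω in A, Sum.elim (fun y => M.mdmOp f y (h n y)) (fun _ => f (Sum.inr ())) (ω n) ∂μ

theorem ae_mem_chainSpace_zero {x : State K} (hx : x ∈ M.stateSpace) {μ : Measure (PathSpace K)}
    (h0 : ∀ᵐ ω ∂μ, ω 0 = Sum.inl x) : ∀ᵐ ω ∂μ, ω 0 ∈ M.chainSpace := by
  filter_upwards [h0] with ω hω
  rw [hω]; exact inl_mem_chainSpace.2 hx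

/-- Stated for one step and an arbitrary measure, because the step property at stage `n` is itself
often known only once the `n`-th state is known to lie in the state space. The two facts then
alternate in an induction. -/
theorem StepAt.ae_mem_chainSpace (hM : M.Standing) {h : Strategy K} (hh : M.Admissible h)
    {μ : Measure (PathSpace K)} {n : ℕ} (hs : M.StepAt h μ n)
    (hn : ∀ᵐ ω ∂μ, ω n ∈ M.chainSpace) : ∀ᵐ ω ∂μ, ω (n + 1) ∈ M.chainSpace := by
  obtain ⟨Φ, hΦ⟩ := hM.exists_flowVersion (hh.isControl n)
  have hm : MeasurableSet M.chainSpaceᶜ := measurableSet_chainSpace.compl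
  have hf : Measurable (M.chainSpaceᶜ.indicator (1 : ExtState K → ℝ≥0∞)) :=
    measurable_one.indicator hm
  have h1 := hs univ (@MeasurableSet.univ _ (Filtration.piLE n)) _ hf
  rw [Measure.restrict_univ] at h1
  have h2 : (fun ω : PathSpace K => Sum.elim
      (fun y => M.mdmOp (M.chainSpaceᶜ.indicator 1) y (h n y))
      (fun _ => M.chainSpaceᶜ.indicator (1 : ExtState K → ℝ≥0∞) (Sum.inr ())) (ω n))
      =ᵐ[μ] fun _ => 0 := by
    filter_upwards [hn] with ω hω
    rcases hy : ω n with y | u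
    · rw [hy, inl_mem_chainSpace] at hω
      simp only [Sum.elim_inl]
      rw [hΦ.mdmOp_eq hω, hΦ.transOp_compl hM hω (hh.wealth_pos n y hω)]
      intro e he
      exact indicator_of_notMem (not_not.2 he) _
    · simp
  rw [lintegral_congr_ae h2, lintegral_zero] at h1
  have hmn : Measurable fun ω : PathSpace K => ω (n + 1) := measurable_pi_apply _
  have h3 := (lintegral_eq_zero_iff (hf.comp hmn)).1 h1
  filter_upwards [h3] with ω hω
  by_contra hc
  simp [indicator_of_mem (show ω (n + 1) ∈ M.chainSpaceᶜ from hc)] at hω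

theorem IsMDMLaw.ae_mem_chainSpace (hM : M.Standing) {h : Strategy K} (hh : M.Admissible h)
    {x : State K} (hx : x ∈ M.stateSpace) {μ : Measure (PathSpace K)} (hμ : M.IsMDMLaw h x μ)
    (n : ℕ) : ∀ᵐ ω ∂μ, ω n ∈ M.chainSpace := by
  induction n with
  | zero => exact ae_mem_chainSpace_zero hx hμ.initial
  | succ n ih => exact StepAt.ae_mem_chainSpace hM hh (hμ.transition n) ih

/-- The laws of the Markov decision model are the laws of a Markov chain. -/
theorem exists_kernel_isMDMLaw_iff (hM : M.Standing) {h : Strategy K} (hh : M.Admissible h)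
    {x : State K} (hx : x ∈ M.stateSpace) :
    ∃ κ : ℕ → Kernel (ExtState K) (ExtState K), (∀ n, IsMarkovKernel (κ n)) ∧
      (∀ n f, Measurable f → ∀ e ∈ M.chainSpace, ∫⁻ e', f e' ∂(κ n e) =
        Sum.elim (fun y => M.mdmOp f y (h n y)) (fun _ => f (Sum.inr ())) e) ∧
      ∀ μ, M.IsMDMLaw h x μ ↔ IsChainLaw κ (Sum.inl x) μ := by
  have hk : ∀ n, ∃ κ : Kernel (ExtState K) (ExtState K), IsMarkovKernel κ ∧ ∀ f, Measurable f →
      ∀ e ∈ M.chainSpace, ∫⁻ e', f e' ∂(κ e) =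
        Sum.elim (fun y => M.mdmOp f y (h n y)) (fun _ => f (Sum.inr ())) e := by
    intro n
    obtain ⟨Φ, hΦ⟩ := hM.exists_flowVersion (hh.isControl n)
    exact hΦ.exists_kernel (hh.measurable n)
  choose κ hκ hκ' using hk
  refine ⟨κ, hκ, hκ', fun μ => ⟨fun hμ => ⟨hμ.prob, hμ.initial, fun n A hA f hf => ?_⟩,
    fun hμ => ?_⟩⟩
  · rw [hμ.transition n A hA f hf]
    refine lintegral_congr_ae (ae_restrict_of_ae ?_)
    filter_upwards [hμ.ae_mem_chainSpace hM hh hx n] with ω hω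
    rw [hκ' n f hf _ hω]
  -- The kernels represent `mdmOp` only on `chainSpace`, so the support is needed before the step
  -- property.
  · have hstep : ∀ n, (∀ᵐ ω ∂μ, ω n ∈ M.chainSpace) → M.StepAt h μ n := by
      intro n hn A hA f hf
      rw [hμ.transition n A hA f hf]
      refine lintegral_congr_ae (ae_restrict_of_ae ?_)
      filter_upwards [hn] with ω hω
      rw [hκ' n f hf _ hω]
    have hsupp : ∀ n, ∀ᵐ ω ∂μ, ω n ∈ M.chainSpace := by
      intro n
      induction n with
      | zero => exact ae_mem_chainSpace_zero hx hμ.initial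
      | succ n ih => exact StepAt.ae_mem_chainSpace hM hh (hstep n ih) ih
    exact ⟨hμ.prob, hμ.initial, fun n => hstep n (hsupp n)⟩

theorem existsUnique_isMDMLaw (hM : M.Standing) {h : Strategy K} (hh : M.Admissible h)
    {x : State K} (hx : x ∈ M.stateSpace) : ∃! μ, M.IsMDMLaw h x μ := by
  obtain ⟨κ, hκ, -, hiff⟩ := exists_kernel_isMDMLaw_iff hM hh hx
  obtain ⟨μ, hμ⟩ := exists_isChainLaw κ (Sum.inl x : ExtState K)
  exact ⟨μ, (hiff μ).2 hμ, fun ν hν => ((hiff ν).1 hν).unique hμ⟩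

/-- Markov property of the Markov decision model for functions of two consecutive states. -/
theorem IsMDMLaw.transition_pair (hM : M.Standing) {h : Strategy K} (hh : M.Admissible h)
    {x : State K} (hx : x ∈ M.stateSpace) {μ : Measure (PathSpace K)} (hμ : M.IsMDMLaw h x μ)
    (n : ℕ) {A : Set (PathSpace K)} (hA : MeasurableSet[Filtration.piLE n] A)
    {F : ExtState K × ExtState K → ℝ≥0∞} (hF : Measurable F) :
    ∫⁻ ω in A, F (ω n, ω (n + 1)) ∂μ = ∫⁻ ω in A,
      Sum.elim (fun y => M.mdmOp (fun e => F (Sum.inl y, e)) y (h n y))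
        (fun _ => F (Sum.inr (), Sum.inr ())) (ω n) ∂μ := by
  obtain ⟨κ, hκ, hκ', hiff⟩ := exists_kernel_isMDMLaw_iff hM hh hx
  rw [((hiff μ).1 hμ).transition_pair n hA hF]
  refine lintegral_congr_ae (ae_restrict_of_ae ?_)
  filter_upwards [hμ.ae_mem_chainSpace hM hh hx n] with ω hω
  rw [hκ' n (fun e => F (ω n, e)) (hF.comp measurable_prodMk_left) _ hω]
  rcases ω n with y | u <;> rfl

end MarketData

namespace MarketData

variable {K : ℕ} {M : MarketData K}

/-! ### Functions of two consecutive states -/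

/-- A function of two consecutive states, vanishing if the first one is the cemetery. -/
def pairFun (g : State K → State K → ℝ≥0∞) (b : State K → ℝ≥0∞) (e e' : ExtState K) : ℝ≥0∞ :=
  Sum.elim (fun y => Sum.elim (fun y' => g y y') (fun _ => b y) e') (fun _ => 0) e

theorem measurable_outl : Measurable (Sum.elim id (fun _ => 0) : ExtState K → State K) :=
  Measurable.sumElim measurable_id measurable_const

theorem measurable_pairFun {g : State K → State K → ℝ≥0∞} {b : State K → ℝ≥0∞}
    (hg : Measurable (Function.uncurry g)) (hb : Measurable b) :
    Measurable fun p : ExtState K × ExtState K => pairFun g b p.1 p.2 := by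
  have hl : MeasurableSet (range (Sum.inl : State K → ExtState K)) := measurableSet_range_inl
  have h1 : Measurable fun p : ExtState K × ExtState K =>
      ((Sum.elim id (fun _ => 0) p.1 : State K), (Sum.elim id (fun _ => 0) p.2 : State K)) :=
    (measurable_outl.comp measurable_fst).prodMk (measurable_outl.comp measurable_snd)
  have h2 : Measurable fun p : ExtState K × ExtState K =>
      (Prod.fst ⁻¹' range (Sum.inl : State K → ExtState K) ∩
        Prod.snd ⁻¹' range (Sum.inl : State K → ExtState K)).indicator
        (fun p => g (Sum.elim id (fun _ => 0) p.1) (Sum.elim id (fun _ => 0) p.2)) p +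
      (Prod.fst ⁻¹' range (Sum.inl : State K → ExtState K) \
        Prod.snd ⁻¹' range (Sum.inl : State K → ExtState K)).indicator
        (fun p => b (Sum.elim id (fun _ => 0) p.1)) p := by
    refine Measurable.add (Measurable.indicator (hg.comp h1)
      ((measurable_fst hl).inter (measurable_snd hl))) (Measurable.indicator (hb.comp ?_)
      ((measurable_fst hl).diff (measurable_snd hl)))
    exact measurable_outl.comp measurable_fst
  convert h2 using 2 with p
  rcases p with ⟨y | u, y' | u'⟩ <;> simp [pairFun]

/-- Jumps do not change the time, so a function of time is a constant for `Q`. -/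
theorem jumpOp_time_mul {f : State K → ℝ≥0∞} (hf : Measurable f) (c : ℝ → ℝ≥0∞) (x : State K)
    (a : ℝ) : M.jumpOp (fun y => c y.1 * f y) x a = c x.1 * M.jumpOp f x a := by
  have hm : Measurable (M.jumpMap x a) := by
    have h := M.measurable_jumpMap.comp
      ((measurable_const (a := x)).prodMk ((measurable_const (a := a)).prodMk measurable_id))
    exact h
  have h1 : ∀ j, ∫⁻ z, c (M.jumpMap x a z).1 * f (M.jumpMap x a z) ∂(M.eta j x.1) =
      c x.1 * ∫⁻ z, f (M.jumpMap x a z) ∂(M.eta j x.1) := fun j => by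
    have h := lintegral_const_mul (μ := M.eta j x.1) (c x.1) (hf.comp hm)
    exact h
  simp only [jumpOp, h1]
  rw [← mul_div_assoc, Finset.mul_sum]
  congr 1
  exact Finset.sum_congr rfl fun j _ => by ring

/-- `Q` has mass one where the rate is positive; elsewhere the density vanishes. -/
theorem IsFlowVersion.jumpDens_mul_const {α : State K → ℝ → ℝ} {Φ : State K → ℝ → State K}
    (hΦ : M.IsFlowVersion α Φ) {y : State K} (hy : y ∈ M.stateSpace) {v : ℝ}
    (hv : v ∈ Icc 0 (M.T - y.1)) (a : ℝ) :
    M.jumpDens Φ y v * M.jumpOp (fun _ => 1) (Φ y v) a = M.jumpDens Φ y v := by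
  have hyv := hΦ.mem y hy v hv
  rw [jumpDens, ENNReal.ofReal_mul (M.rate_nonneg hyv), mul_right_comm, M.jumpOp_const hyv, mul_one]

/-- After the waiting time `v` the new time is `y.1 + v`. Hence a factor depending on the new time
turns into a function of the waiting time and leaves `Q`. -/
theorem IsFlowVersion.mdmOp_pairFun {α : State K → ℝ → ℝ} {Φ : State K → ℝ → State K}
    (hΦ : M.IsFlowVersion α Φ) {y : State K} (hy : y ∈ M.stateSpace) {f : State K → ℝ≥0∞}
    (hf : Measurable f) (c : ℝ → ℝ≥0∞) (g : State K → State K → ℝ≥0∞) (b : State K → ℝ≥0∞)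
    (hg : ∀ y', g y y' = c y'.1 * f y') :
    M.mdmOp (fun e => pairFun g b (Sum.inl y) e) y (α y) =
      (∫⁻ v in Ioc 0 (M.T - y.1), c (y.1 + v) * (M.jumpDens Φ y v * M.jumpOp f (Φ y v) (α y v))) +
        M.noJump Φ y * b y := by
  rw [hΦ.mdmOp_eq hy, transOp]
  congr 1
  refine setLIntegral_congr_fun measurableSet_Ioc fun v hv => ?_
  have hv' : v ∈ Icc 0 (M.T - y.1) := ⟨hv.1.le, hv.2⟩
  simp only [pairFun, Sum.elim_inl, hg]
  rw [jumpOp_time_mul hf, hΦ.fst_eq y hy v hv', mul_left_comm]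

theorem IsFlowVersion.mdmOp_pairFun_time {α : State K → ℝ → ℝ} {Φ : State K → ℝ → State K}
    (hΦ : M.IsFlowVersion α Φ) {y : State K} (hy : y ∈ M.stateSpace)
    (c : ℝ → ℝ≥0∞) (g : State K → State K → ℝ≥0∞) (b : State K → ℝ≥0∞)
    (hg : ∀ y', g y y' = c y'.1) :
    M.mdmOp (fun e => pairFun g b (Sum.inl y) e) y (α y) =
      (∫⁻ v in Ioc 0 (M.T - y.1), c (y.1 + v) * M.jumpDens Φ y v) + M.noJump Φ y * b y := by
  rw [hΦ.mdmOp_pairFun hy measurable_const c g b (f := fun _ => 1) fun y' => by rw [hg, mul_one]]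
  congr 1
  refine setLIntegral_congr_fun measurableSet_Ioc fun v hv => ?_
  simp only [hΦ.jumpDens_mul_const hy ⟨hv.1.le, hv.2⟩]

/-- The waiting times lie in the time interval that is left. -/
def goodPair (M : MarketData K) (y y' : State K) : Prop := y'.1 - y.1 ∈ Ioc 0 (M.T - y.1)

open Classical in
theorem measurable_badPair : Measurable (Function.uncurry fun y y' : State K =>
    if M.goodPair y y' then (0 : ℝ≥0∞) else 1) := by
  refine Measurable.ite ?_ measurable_const measurable_const
  have h1 : Measurable fun p : State K × State K => p.2.1 - p.1.1 :=
    measurable_snd.fst.sub measurable_fst.fst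
  exact (measurableSet_lt measurable_const h1).inter
    (measurableSet_le h1 (measurable_fst.fst.const_sub M.T))

open Classical in
theorem ae_goodPair_of_lintegral {μ : Measure (PathSpace K)} {n : ℕ}
    (h : ∫⁻ ω, pairFun (fun y y' => if M.goodPair y y' then (0 : ℝ≥0∞) else 1) (fun _ => 0)
      (ω n) (ω (n + 1)) ∂μ = 0) :
    ∀ᵐ ω ∂μ, ∀ y y', ω n = Sum.inl y → ω (n + 1) = Sum.inl y' → M.goodPair y y' := by
  have hm : Measurable fun ω : PathSpace K => (ω n, ω (n + 1)) :=
    (measurable_pi_apply n).prodMk (measurable_pi_apply _)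
  have hm2 := (measurable_pairFun (measurable_badPair (M := M))
    (measurable_const (a := (0 : ℝ≥0∞)))).comp hm
  have h2 := (lintegral_eq_zero_iff hm2).1 h
  filter_upwards [h2] with ω hω y y' hy hy'
  by_contra hc
  simp [hy, hy', pairFun, hc] at hω

-- The waiting time has a density that lives on `(0, T - t]`. This matters because `Φ` is known to
-- agree with `flow` only up to the horizon.
open Classical in
theorem IsMDMLaw.ae_goodPair (hM : M.Standing) {h : Strategy K} (hh : M.Admissible h)
    {x : State K} (hx : x ∈ M.stateSpace) {μ : Measure (PathSpace K)} (hμ : M.IsMDMLaw h x μ)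
    (n : ℕ) :
    ∀ᵐ ω ∂μ, ∀ y y', ω n = Sum.inl y → ω (n + 1) = Sum.inl y' → M.goodPair y y' := by
  obtain ⟨Φ, hΦ⟩ := hM.exists_flowVersion (hh.isControl n)
  apply ae_goodPair_of_lintegral
  have h1 := hμ.transition_pair hM hh hx n (@MeasurableSet.univ _ (Filtration.piLE n))
    (measurable_pairFun (measurable_badPair (M := M)) (measurable_const (a := (0 : ℝ≥0∞))))
  rw [Measure.restrict_univ] at h1
  rw [h1]
  have h2 : ∀ᵐ ω ∂μ, Sum.elim (fun y => M.mdmOp (fun e => pairFun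
      (fun y y' => if M.goodPair y y' then (0 : ℝ≥0∞) else 1) (fun _ => 0) (Sum.inl y) e) y (h n y))
        (fun _ => pairFun (fun y y' => if M.goodPair y y' then (0 : ℝ≥0∞) else 1) (fun _ => 0)
          (Sum.inr ()) (Sum.inr ())) (ω n) = 0 := by
    filter_upwards [hμ.ae_mem_chainSpace hM hh hx n] with ω hω
    rcases hn : ω n with y | u
    · rw [hn] at hω
      have hy := inl_mem_chainSpace.1 hω
      simp only [Sum.elim_inl]
      rw [hΦ.mdmOp_pairFun_time hy
        (fun t => if M.goodPair y (t, 0) then (0 : ℝ≥0∞) else 1) _ _ fun y' => rfl]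
      rw [mul_zero, add_zero]
      refine (setLIntegral_congr_fun measurableSet_Ioc fun v hv => ?_).trans lintegral_zero
      have hgp : M.goodPair y (y.1 + v, 0) := by simpa [goodPair] using hv
      simp only [hgp, if_true, zero_mul]
    · rfl
  exact (lintegral_congr_ae h2).trans lintegral_zero

/-! ### The law of the Markov decision model is the law of the PDMP -/

theorem measurable_survivalFun (s : ℝ) : Measurable (Function.uncurry fun y y' : State K =>
    if y.1 + s < y'.1 then (1 : ℝ≥0∞) else 0) := by
  refine Measurable.ite ?_ measurable_const measurable_const
  exact measurableSet_lt (measurable_fst.fst.add_const s) measurable_snd.fst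

-- The cemetery has jump time `⊤`, so absence of a further jump counts as survival; this is the
-- second function, constantly `1`.
open Classical in
theorem measure_inter_survival (μ : Measure (PathSpace K)) (n : ℕ) {A : Set (PathSpace K)}
    (s : ℝ) :
    μ (A ∩ {ω | ∃ y, ω n = Sum.inl y ∧ ((y.1 + s : ℝ) : EReal) < jumpTime ω (n + 1)}) =
      ∫⁻ ω in A, pairFun (fun y y' => if y.1 + s < y'.1 then 1 else 0) (fun _ => 1)
        (ω n) (ω (n + 1)) ∂μ := by
  obtain ⟨D, hD⟩ : ∃ D, D = {ω : PathSpace K | ∃ y, ω n = Sum.inl y ∧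
    ((y.1 + s : ℝ) : EReal) < jumpTime ω (n + 1)} := ⟨_, rfl⟩
  rw [← hD]
  have hm : Measurable fun ω : PathSpace K => (ω n, ω (n + 1)) :=
    (measurable_pi_apply n).prodMk (measurable_pi_apply _)
  have hm2 := (measurable_pairFun (measurable_survivalFun (K := K) s)
    (measurable_const (a := (1 : ℝ≥0∞)))).comp hm
  have key : ∀ ω, pairFun (fun y y' => if y.1 + s < y'.1 then 1 else 0) (fun _ => 1)
        (ω n) (ω (n + 1)) = D.indicator 1 ω := by
    intro ω
    have hiff : ω ∈ D ↔ ∃ y, ω n = Sum.inl y ∧ ((y.1 + s : ℝ) : EReal) < jumpTime ω (n + 1) := by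
      rw [hD]; rfl
    rw [indicator_apply]
    simp only [hiff, jumpTime, Pi.one_apply]
    rcases ω n with y | u
    · rcases ω (n + 1) with y' | u'
      · simp [pairFun, EReal.coe_lt_coe_iff, -EReal.coe_add]
      · simp [pairFun, EReal.coe_lt_top, -EReal.coe_add]
    · simp [pairFun]
  have hDm : MeasurableSet D := by
    have : D = (fun ω : PathSpace K => pairFun (fun y y' => if y.1 + s < y'.1 then 1 else 0)
        (fun _ => 1) (ω n) (ω (n + 1))) ⁻¹' {1} := by
      ext ω
      rw [mem_preimage, key, mem_singleton_iff]
      by_cases h : ω ∈ D <;> simp [h]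
    rw [this]
    exact hm2 (measurableSet_singleton 1)
  simp only [key]
  rw [lintegral_indicator_one hDm, Measure.restrict_apply hDm, inter_comm]

/-- The mass identity at `min s (T - t)`: for `s` beyond the horizon the integral vanishes and only
the event without jump remains. -/
theorem IsFlowVersion.lintegral_jumpDens_gt {α : State K → ℝ → ℝ} {Φ : State K → ℝ → State K}
    (hΦ : M.IsFlowVersion α Φ) {y : State K} (hy : y ∈ M.stateSpace) {s : ℝ} (hs : 0 ≤ s) :
    (∫⁻ v in Ioc 0 (M.T - y.1), (if s < v then 1 else 0) * M.jumpDens Φ y v) + M.noJump Φ y =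
      ENNReal.ofReal (Real.exp (-M.cumRate (α y) y (min s (M.T - y.1)))) := by
  have hτ : 0 ≤ M.T - y.1 := sub_nonneg.2 hy.1.2
  have hs' : min s (M.T - y.1) ∈ Icc 0 (M.T - y.1) := ⟨le_min hs hτ, min_le_right _ _⟩
  rw [hΦ.cumRate_eq hy hs', ← hΦ.mass hy hs']
  congr 1
  have h1 : ∀ v, (if s < v then (1 : ℝ≥0∞) else 0) * M.jumpDens Φ y v =
      (Ioi s).indicator (fun v => M.jumpDens Φ y v) v := by
    intro v
    by_cases h : s < v
    · rw [indicator_of_mem (show v ∈ Ioi s from h), if_pos h, one_mul]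
    · rw [indicator_of_notMem (show v ∉ Ioi s from h), if_neg h, zero_mul]
  simp only [h1]
  rw [lintegral_indicator measurableSet_Ioi, Measure.restrict_restrict measurableSet_Ioi]
  congr 2
  ext v
  simp only [mem_inter_iff, mem_Ioi, mem_Ioc, min_lt_iff]
  constructor
  · rintro ⟨h2, h3, h4⟩; exact ⟨Or.inl h2, h4⟩
  · rintro ⟨h2 | h2, h3⟩
    · exact ⟨h2, hs.trans_lt h2, h3⟩
    · exact absurd h2 (not_lt.2 h3)

/-- The transition property is tested with the indicator of the living states on the event that the
chain is already in the cemetery. -/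
theorem IsMDMLaw.absorbed {h : Strategy K} {x : State K} {μ : Measure (PathSpace K)}
    (hμ : M.IsMDMLaw h x μ) (n : ℕ) : ∀ᵐ ω ∂μ, ω n = Sum.inr () → ω (n + 1) = Sum.inr () := by
  have hr : MeasurableSet (range (Sum.inr : Unit → ExtState K)) := measurableSet_range_inr
  have hAm : MeasurableSet[Filtration.piLE n]
      ((fun ω : PathSpace K => ω n) ⁻¹' range (Sum.inr : Unit → ExtState K)) :=
    measurable_piLE_eval le_rfl hr
  obtain ⟨f, hfdef⟩ : ∃ f : ExtState K → ℝ≥0∞,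
      f = (range (Sum.inr : Unit → ExtState K))ᶜ.indicator 1 := ⟨_, rfl⟩
  have hf : Measurable f := by rw [hfdef]; exact measurable_one.indicator hr.compl
  have hf0 : ∀ u, f (Sum.inr u) = 0 := fun u => by
    rw [hfdef]; exact indicator_of_notMem (by simp) _
  have hf1 : ∀ y, f (Sum.inl y) = 1 := fun y => by
    rw [hfdef]; exact indicator_of_mem (by simp) _
  have h1 := hμ.transition n _ hAm f hf
  have hAm' := Filtration.piLE.le n _ hAm
  have h2 : ∫⁻ ω in (fun ω : PathSpace K => ω n) ⁻¹' range (Sum.inr : Unit → ExtState K),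
      Sum.elim (fun y => M.mdmOp f y (h n y)) (fun _ => f (Sum.inr ())) (ω n) ∂μ = 0 := by
    refine (setLIntegral_congr_fun hAm' fun ω hω => ?_).trans lintegral_zero
    obtain ⟨u, hu⟩ := hω
    simp only [← hu, Sum.elim_inr, hf0]
  rw [h2] at h1
  have hmn : Measurable fun ω : PathSpace K => ω (n + 1) := measurable_pi_apply _
  have h3 := (lintegral_eq_zero_iff (hf.comp hmn)).1 h1
  have h4 := (ae_restrict_iff' hAm').1 h3
  filter_upwards [h4] with ω hω hn
  have h5 := hω ⟨(), hn.symm⟩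
  rcases hy : ω (n + 1) with y | u
  · simp [hy, hf1] at h5
  · rfl

theorem IsMDMLaw.survival (hM : M.Standing) {h : Strategy K} (hh : M.Admissible h)
    {x : State K} (hx : x ∈ M.stateSpace) {μ : Measure (PathSpace K)} (hμ : M.IsMDMLaw h x μ)
    (n : ℕ) {A : Set (PathSpace K)} (hA : MeasurableSet[Filtration.piLE n] A) {s : ℝ}
    (hs : 0 ≤ s) :
    μ (A ∩ {ω | ∃ y, ω n = Sum.inl y ∧ ((y.1 + s : ℝ) : EReal) < jumpTime ω (n + 1)}) =
      ∫⁻ ω in A, Sum.elim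
        (fun y => ENNReal.ofReal (Real.exp (-M.cumRate (h n y) y (min s (M.T - y.1)))))
        (fun _ => 0) (ω n) ∂μ := by
  obtain ⟨Φ, hΦ⟩ := hM.exists_flowVersion (hh.isControl n)
  rw [measure_inter_survival, hμ.transition_pair hM hh hx n hA
    (measurable_pairFun (measurable_survivalFun s) measurable_const)]
  refine lintegral_congr_ae (ae_restrict_of_ae ?_)
  filter_upwards [hμ.ae_mem_chainSpace hM hh hx n] with ω hω
  rcases hn : ω n with y | u
  · rw [hn] at hω
    have hy := inl_mem_chainSpace.1 hω
    simp only [Sum.elim_inl]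
    rw [hΦ.mdmOp_pairFun_time hy (fun t => if y.1 + s < t then 1 else 0) _ _ fun y' => rfl,
      ← hΦ.lintegral_jumpDens_gt hy hs, mul_one]
    simp only [add_lt_add_iff_left]
  · simp [pairFun]

theorem measurable_relative {f : State K → ℝ → ℝ≥0∞} (hf : Measurable (Function.uncurry f)) :
    Measurable (Function.uncurry fun y y' : State K => f y (y'.1 - y.1)) := by
  have hsh : Measurable fun p : State K × State K => (p.1, p.2.1 - p.1.1) :=
    measurable_fst.prodMk (measurable_snd.fst.sub measurable_fst.fst)
  exact hf.comp hsh

/-- Both integrands are functions of two consecutive states: `g₁` evaluates `f` at the new state,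
`g₂` evaluates `Q f` just before the jump. One transition gives them the same value. In the first
case `Q` acts on `f`; in the second the integrand depends only on the waiting time and `Q` acts as
mass one. -/
theorem IsMDMLaw.location (hM : M.Standing) {h : Strategy K} (hh : M.Admissible h)
    {x : State K} (hx : x ∈ M.stateSpace) {μ : Measure (PathSpace K)} (hμ : M.IsMDMLaw h x μ)
    (n : ℕ) {A : Set (PathSpace K)} (hA : MeasurableSet[Filtration.piLE n] A) {B : Set ℝ}
    (hB : MeasurableSet B) {f : State K → ℝ≥0∞} (hf : Measurable f) :
    ∫⁻ ω in A, Sum.elim (fun y' => B.indicator 1 y'.1 * f y') (fun _ => 0) (ω (n + 1)) ∂μ =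
      ∫⁻ ω in A, Sum.elim
        (fun y => Sum.elim
          (fun y' => B.indicator 1 y'.1 *
            M.jumpOp f (M.flow (h n y) y (y'.1 - y.1)) (h n y (y'.1 - y.1)))
          (fun _ => 0) (ω (n + 1)))
        (fun _ => 0) (ω n) ∂μ := by
  obtain ⟨Φ, hΦ⟩ := hM.exists_flowVersion (hh.isControl n)
  have hBm : Measurable (B.indicator (1 : ℝ → ℝ≥0∞)) := measurable_one.indicator hB
  have hO := IsFlowVersion.measurable_jumpOp (hh.measurable n) hΦ hf
  obtain ⟨g₁, hg₁⟩ : ∃ g : State K → State K → ℝ≥0∞,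
      g = fun _ y' => B.indicator 1 y'.1 * f y' := ⟨_, rfl⟩
  obtain ⟨g₂, hg₂⟩ : ∃ g : State K → State K → ℝ≥0∞, g = fun y y' => B.indicator 1 y'.1 *
        M.jumpOp f (Φ y (y'.1 - y.1)) (h n y (y'.1 - y.1)) := ⟨_, rfl⟩
  have hm₁ : Measurable (Function.uncurry g₁) := by
    rw [hg₁]; exact (hBm.comp measurable_snd.fst).mul (hf.comp measurable_snd)
  have hO2 := measurable_relative (f := fun y v => M.jumpOp f (Φ y v) (h n y v)) hO
  have hm₂ : Measurable (Function.uncurry g₂) := by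
    rw [hg₂]; exact Measurable.mul (hBm.comp measurable_snd.fst) hO2
  have e1 := hμ.transition_pair hM hh hx n hA
    (measurable_pairFun hm₁ (measurable_const (a := (0 : ℝ≥0∞))))
  have e2 := hμ.transition_pair hM hh hx n hA
    (measurable_pairFun hm₂ (measurable_const (a := (0 : ℝ≥0∞))))
  refine Eq.trans ?_ (e1.trans (Eq.trans ?_ (e2.symm.trans ?_)))
  · refine lintegral_congr_ae (ae_restrict_of_ae ?_)
    filter_upwards [hμ.absorbed n] with ω hω
    rcases hn : ω n with y | u
    · simp only [pairFun, Sum.elim_inl, hg₁]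
    · rw [hω hn]; simp only [pairFun, Sum.elim_inr]
  · refine lintegral_congr_ae (ae_restrict_of_ae ?_)
    filter_upwards [hμ.ae_mem_chainSpace hM hh hx n] with ω hω
    rcases hn : ω n with y | u
    · rw [hn] at hω
      have hy := inl_mem_chainSpace.1 hω
      simp only [Sum.elim_inl]
      rw [hΦ.mdmOp_pairFun hy hf (B.indicator 1) g₁ _ fun y' => by rw [hg₁],
        hΦ.mdmOp_pairFun_time hy (fun t => B.indicator 1 t *
          M.jumpOp f (Φ y (t - y.1)) (h n y (t - y.1))) g₂ _ fun y' => by rw [hg₂]]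
      congr 1
      refine setLIntegral_congr_fun measurableSet_Ioc fun v hv => ?_
      simp only [add_sub_cancel_left]
      ring
    · simp only [Sum.elim_inr, pairFun]
  · refine lintegral_congr_ae (ae_restrict_of_ae ?_)
    filter_upwards [hμ.ae_mem_chainSpace hM hh hx n, hμ.ae_goodPair hM hh hx n] with ω hω hgood
    rcases hn : ω n with y | u
    · rcases hn' : ω (n + 1) with y' | u'
      · have hy : y ∈ M.stateSpace := by rw [hn] at hω; exact inl_mem_chainSpace.1 hω
        have hgp := hgood y y' hn hn'
        simp only [pairFun, Sum.elim_inl, hg₂]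
        rw [hΦ.flow_eq y hy _ ⟨hgp.1.le, hgp.2⟩]
      · simp only [pairFun, Sum.elim_inl, Sum.elim_inr]
    · simp only [pairFun, Sum.elim_inr]

theorem IsMDMLaw.isPDMPLaw (hM : M.Standing) {h : Strategy K} (hh : M.Admissible h)
    {x : State K} (hx : x ∈ M.stateSpace) {μ : Measure (PathSpace K)} (hμ : M.IsMDMLaw h x μ) :
    M.IsPDMPLaw h x μ :=
  ⟨hμ.prob, hμ.initial, hμ.absorbed, fun n _ hA _ hs => hμ.survival hM hh hx n hA hs,
    fun n _ hA _ hB _ hf => hμ.location hM hh hx n hA hB hf⟩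

end MarketData

namespace MarketData

variable {K : ℕ} {M : MarketData K}

/-! ### The law of the PDMP is the law of the Markov decision model -/

theorem measurable_consecutive (n : ℕ) :
    Measurable fun ω : PathSpace K => (ω n, ω (n + 1)) :=
  (measurable_pi_apply n).prodMk (measurable_pi_apply _)

theorem measurable_pairFun_path {g : State K → State K → ℝ≥0∞} {b : State K → ℝ≥0∞}
    (hg : Measurable (Function.uncurry g)) (hb : Measurable b) (n : ℕ) :
    Measurable fun ω : PathSpace K => pairFun g b (ω n) (ω (n + 1)) :=
  (measurable_pairFun hg hb).comp (measurable_consecutive n)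

theorem measurable_elim_path {b : State K → ℝ≥0∞} (hb : Measurable b) (c : ℝ≥0∞) (n : ℕ) :
    Measurable fun ω : PathSpace K => Sum.elim b (fun _ => c) (ω n) :=
  (Measurable.sumElim hb measurable_const).comp (measurable_pi_apply n)

variable (M) in
/-- The subdensity of the waiting time, as a function on the whole line. -/
noncomputable def waitDens (Φ : State K → ℝ → State K) (y : State K) (v : ℝ) : ℝ≥0∞ :=
  (Ioc 0 (M.T - y.1)).indicator (M.jumpDens Φ y) v

theorem IsFlowVersion.measurable_waitDens {α : State K → ℝ → ℝ} {Φ : State K → ℝ → State K}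
    (hΦ : M.IsFlowVersion α Φ) : Measurable (Function.uncurry (M.waitDens Φ)) := by
  have hS : MeasurableSet {p : State K × ℝ | 0 < p.2 ∧ p.2 ≤ M.T - p.1.1} :=
    (measurableSet_lt measurable_const measurable_snd).inter
      (measurableSet_le measurable_snd (measurable_fst.fst.const_sub M.T))
  exact hΦ.measurable_jumpDens.indicator hS

theorem lintegral_waitDens (Φ : State K → ℝ → State K) (y : State K) (c : ℝ → ℝ≥0∞) :
    ∫⁻ v, c v * M.waitDens Φ y v = ∫⁻ v in Ioc 0 (M.T - y.1), c v * M.jumpDens Φ y v := by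
  rw [← lintegral_indicator measurableSet_Ioc]
  congr 1 with v
  by_cases h : v ∈ Ioc 0 (M.T - y.1) <;> simp [waitDens, h]

theorem IsFlowVersion.measurable_lintegral_waitDens {α : State K → ℝ → ℝ}
    {Φ : State K → ℝ → State K} (hΦ : M.IsFlowVersion α Φ) {g : State K → ℝ → ℝ≥0∞}
    (hg : Measurable (Function.uncurry g)) :
    Measurable fun y => ∫⁻ v, g y v * M.waitDens Φ y v := by
  have h : Measurable (Function.uncurry fun y v => g y v * M.waitDens Φ y v) :=
    hg.mul hΦ.measurable_waitDens
  exact h.lintegral_prod_right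

variable {h : Strategy K} {x : State K} {μ : Measure (PathSpace K)} {n : ℕ}
  {Φ : State K → ℝ → State K}

theorem IsPDMPLaw.lintegral_survival (hμ : M.IsPDMPLaw h x μ) (hΦ : M.IsFlowVersion (h n) Φ)
    (hn : ∀ᵐ ω ∂μ, ω n ∈ M.chainSpace) {A : Set (PathSpace K)}
    (hA : MeasurableSet[Filtration.piLE n] A) {s : ℝ} (hs : 0 ≤ s) :
    ∫⁻ ω in A, pairFun (fun y y' => if y.1 + s < y'.1 then 1 else 0) (fun _ => 1)
        (ω n) (ω (n + 1)) ∂μ =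
      ∫⁻ ω in A, Sum.elim (fun y => (∫⁻ v, (if s < v then 1 else 0) * M.waitDens Φ y v) +
        M.noJump Φ y) (fun _ => 0) (ω n) ∂μ := by
  rw [← measure_inter_survival, hμ.survival n A hA s hs]
  refine lintegral_congr_ae (ae_restrict_of_ae ?_)
  filter_upwards [hn] with ω hω
  rcases hy : ω n with y | u
  · rw [hy] at hω
    simp only [Sum.elim_inl]
    rw [lintegral_waitDens Φ y fun v => if s < v then 1 else 0,
      hΦ.lintegral_jumpDens_gt (inl_mem_chainSpace.1 hω) hs]
  · rfl

/-- "No further jump" is the decreasing limit of "the waiting time exceeds `k`". For `k ≥ T` the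
density contributes nothing and the survival probability is already `noJump`. -/
theorem IsPDMPLaw.lintegral_noJump (hμ : M.IsPDMPLaw h x μ) (hΦ : M.IsFlowVersion (h n) Φ)
    (hn : ∀ᵐ ω ∂μ, ω n ∈ M.chainSpace) {A : Set (PathSpace K)}
    (hA : MeasurableSet[Filtration.piLE n] A) :
    ∫⁻ ω in A, pairFun (fun _ _ => 0) (fun _ => 1) (ω n) (ω (n + 1)) ∂μ =
      ∫⁻ ω in A, Sum.elim (M.noJump Φ) (fun _ => 0) (ω n) ∂μ := by
  have := hμ.prob
  have h1 : ∀ ω : PathSpace K, pairFun (fun _ _ => 0) (fun _ => 1) (ω n) (ω (n + 1)) =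
      ⨅ k : ℕ, pairFun (fun y y' => if y.1 + k < y'.1 then (1 : ℝ≥0∞) else 0) (fun _ => 1)
        (ω n) (ω (n + 1)) := by
    intro ω
    rcases ω n with y | u
    · rcases ω (n + 1) with y' | u'
      · obtain ⟨k, hk⟩ := exists_nat_ge (y'.1 - y.1)
        simp only [pairFun, Sum.elim_inl]
        refine le_antisymm zero_le (iInf_le_of_le k ?_)
        rw [if_neg (by linarith)]
      · simp [pairFun]
    · simp [pairFun]
  have hanti : Antitone fun (k : ℕ) (ω : PathSpace K) =>
      pairFun (fun y y' => if y.1 + k < y'.1 then (1 : ℝ≥0∞) else 0) (fun _ => 1)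
        (ω n) (ω (n + 1)) := by
    intro k l hkl ω
    have hkl' : (k : ℝ) ≤ l := Nat.cast_le.2 hkl
    simp only
    rcases ω n with y | u
    · rcases ω (n + 1) with y' | u'
      · simp only [pairFun, Sum.elim_inl]
        split_ifs with h1 h2
        · exact le_rfl
        · exact absurd (lt_of_le_of_lt (by linarith) h1) h2
        · exact zero_le
        · exact le_rfl
      · exact le_rfl
    · exact le_rfl
  simp only [h1]
  have hfin : ∫⁻ ω in A, pairFun (fun y y' => if y.1 + ((0 : ℕ) : ℝ) < y'.1 then (1 : ℝ≥0∞) else 0)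
      (fun _ => 1) (ω n) (ω (n + 1)) ∂μ ≠ ⊤ := by
    refine ((lintegral_mono (g := fun _ => 1) fun ω => ?_).trans_lt ?_).ne
    · simp only
      rcases ω n with y | u
      · rcases ω (n + 1) with y' | u'
        · simp only [pairFun, Sum.elim_inl]
          split_ifs
          · exact le_rfl
          · exact zero_le
        · exact le_rfl
      · exact zero_le
    · simp
  rw [lintegral_iInf (fun k => measurable_pairFun_path (measurable_survivalFun _) measurable_const n)
    hanti hfin]
  simp only [hμ.lintegral_survival hΦ hn hA (Nat.cast_nonneg _)]
  apply le_antisymm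
  · obtain ⟨k, hk⟩ := exists_nat_ge M.T
    refine iInf_le_of_le k (lintegral_mono_ae (ae_restrict_of_ae ?_))
    filter_upwards [hn] with ω hω
    rcases hy : ω n with y | u
    · rw [hy] at hω
      have hyS := inl_mem_chainSpace.1 hω
      simp only [Sum.elim_inl]
      rw [lintegral_waitDens Φ y fun v => if (k : ℝ) < v then 1 else 0,
        setLIntegral_congr_fun (g := fun _ => 0) measurableSet_Ioc, lintegral_zero, zero_add]
      intro v hv
      simp only
      rw [if_neg (by have := hyS.1.1; have := hv.2; linarith), zero_mul]
    · exact le_rfl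
  · refine le_iInf fun k => lintegral_mono fun ω => ?_
    simp only
    rcases ω n with y | u
    · exact le_add_self
    · exact le_rfl

/-- Survival beyond `s` splits into a later jump and no jump; the second part is known and finite,
so it can be subtracted. -/
theorem IsPDMPLaw.lintegral_gt (hμ : M.IsPDMPLaw h x μ) (hΦ : M.IsFlowVersion (h n) Φ)
    (hn : ∀ᵐ ω ∂μ, ω n ∈ M.chainSpace) {A : Set (PathSpace K)}
    (hA : MeasurableSet[Filtration.piLE n] A) {s : ℝ} (hs : 0 ≤ s) :
    ∫⁻ ω in A, pairFun (fun y y' => if y.1 + s < y'.1 then 1 else 0) (fun _ => 0)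
        (ω n) (ω (n + 1)) ∂μ =
      ∫⁻ ω in A, Sum.elim (fun y => ∫⁻ v, (if s < v then 1 else 0) * M.waitDens Φ y v)
        (fun _ => 0) (ω n) ∂μ := by
  have := hμ.prob
  have h1 := hμ.lintegral_survival hΦ hn hA hs
  have h2 := hμ.lintegral_noJump hΦ hn hA
  have e1 : ∀ ω : PathSpace K, pairFun (fun y y' => if y.1 + s < y'.1 then (1 : ℝ≥0∞) else 0)
      (fun _ => 1) (ω n) (ω (n + 1)) =
      pairFun (fun y y' => if y.1 + s < y'.1 then (1 : ℝ≥0∞) else 0) (fun _ => 0)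
        (ω n) (ω (n + 1)) + pairFun (fun _ _ => 0) (fun _ => 1) (ω n) (ω (n + 1)) := by
    intro ω
    rcases ω n with y | u
    · rcases ω (n + 1) with y' | u' <;> simp [pairFun]
    · simp [pairFun]
  have e2 : ∀ ω : PathSpace K, Sum.elim (fun y => (∫⁻ v, (if s < v then 1 else 0) *
      M.waitDens Φ y v) + M.noJump Φ y) (fun _ => 0) (ω n) =
      Sum.elim (fun y => ∫⁻ v, (if s < v then 1 else 0) * M.waitDens Φ y v) (fun _ => 0) (ω n) +
        Sum.elim (M.noJump Φ) (fun _ => 0) (ω n) := by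
    intro ω
    rcases ω n with y | u <;> simp
  simp only [e1, e2] at h1
  rw [lintegral_add_right _ (measurable_pairFun_path measurable_const measurable_const n),
    lintegral_add_right _ (measurable_elim_path hΦ.measurable_noJump 0 n), h2] at h1
  refine (ENNReal.add_left_inj ?_).1 h1
  rw [← h2]
  refine ((lintegral_mono (g := fun _ => 1) fun ω => ?_).trans_lt ?_).ne
  · simp only
    rcases ω n with y | u
    · rcases ω (n + 1) with y' | u'
      · exact zero_le
      · exact le_rfl
    · exact zero_le
  · simp

/-- Survival at `s = 0` has conditional probability `exp 0 = 1`. This excludes nonpositive waiting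
times, which half-lines `(s, ∞)` with `s ≥ 0` do not see. -/
theorem IsPDMPLaw.ae_lt (hμ : M.IsPDMPLaw h x μ) (hn : ∀ᵐ ω ∂μ, ω n ∈ M.chainSpace) :
    ∀ᵐ ω ∂μ, ∀ y y', ω n = Sum.inl y → ω (n + 1) = Sum.inl y' → y.1 < y'.1 := by
  have := hμ.prob
  have h1 := hμ.survival n univ (@MeasurableSet.univ _ (Filtration.piLE n)) 0 le_rfl
  rw [measure_inter_survival, Measure.restrict_univ] at h1
  have hm : Measurable (Function.uncurry fun y y' : State K =>
      if y.1 + 0 < y'.1 then (0 : ℝ≥0∞) else 1) :=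
    Measurable.ite (measurableSet_lt (measurable_fst.fst.add_const 0) measurable_snd.fst)
      measurable_const measurable_const
  have hm' := measurable_pairFun_path hm (measurable_const (a := (0 : ℝ≥0∞))) n
  have e1 : ∀ ω : PathSpace K, pairFun (fun y y' => if y.1 + 0 < y'.1 then (1 : ℝ≥0∞) else 0)
      (fun _ => 1) (ω n) (ω (n + 1)) +
      pairFun (fun y y' => if y.1 + 0 < y'.1 then (0 : ℝ≥0∞) else 1) (fun _ => 0)
        (ω n) (ω (n + 1)) = Sum.elim (fun _ => 1) (fun _ => 0) (ω n) := by
    intro ω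
    rcases ω n with y | u
    · rcases ω (n + 1) with y' | u'
      · simp only [pairFun, Sum.elim_inl]
        split_ifs <;> simp
      · simp [pairFun]
    · simp [pairFun]
  have e2 : (fun ω : PathSpace K => Sum.elim
        (fun y => ENNReal.ofReal (Real.exp (-M.cumRate (h n y) y (min 0 (M.T - y.1)))))
        (fun _ => 0) (ω n)) =ᵐ[μ] fun ω => Sum.elim (fun _ => 1) (fun _ => 0) (ω n) := by
    filter_upwards [hn] with ω hω
    rcases hy : ω n with y | u
    · rw [hy] at hω
      have h0 : min 0 (M.T - y.1) = 0 :=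
        min_eq_left (sub_nonneg.2 (inl_mem_chainSpace.1 hω).1.2)
      simp [h0, cumRate]
    · rfl
  rw [lintegral_congr_ae e2] at h1
  have h2 := lintegral_add_right (μ := μ) (fun ω : PathSpace K =>
    pairFun (fun y y' => if y.1 + 0 < y'.1 then (1 : ℝ≥0∞) else 0) (fun _ => 1) (ω n) (ω (n + 1))) hm'
  simp only [e1] at h2
  rw [h1] at h2
  have hfin : ∫⁻ ω, Sum.elim (fun _ => (1 : ℝ≥0∞)) (fun _ => 0) (ω n) ∂μ ≠ ⊤ := by
    refine ((lintegral_mono (g := fun _ => 1) fun ω => ?_).trans_lt ?_).ne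
    · simp only
      rcases ω n with y | u
      · exact le_rfl
      · exact zero_le
    · simp
  have h3 : ∫⁻ ω, pairFun (fun y y' => if y.1 + 0 < y'.1 then (0 : ℝ≥0∞) else 1) (fun _ => 0)
        (ω n) (ω (n + 1)) ∂μ = 0 :=
    (ENNReal.add_right_inj hfin).1 (by rw [← h2, add_zero])
  filter_upwards [(lintegral_eq_zero_iff hm').1 h3] with ω hω y y' hy hy'
  by_contra hc
  simp [hy, hy', pairFun, hc] at hω

/-- The joint law of the `n`-th state and the following waiting time. -/
theorem IsPDMPLaw.lintegral_waiting (hμ : M.IsPDMPLaw h x μ) (hΦ : M.IsFlowVersion (h n) Φ)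
    (hn : ∀ᵐ ω ∂μ, ω n ∈ M.chainSpace) {A : Set (PathSpace K)}
    (hA : MeasurableSet[Filtration.piLE n] A) {g : State K → ℝ → ℝ≥0∞}
    (hg : Measurable (Function.uncurry g)) :
    ∫⁻ ω in A, pairFun (fun y y' => g y (y'.1 - y.1)) (fun _ => 0) (ω n) (ω (n + 1)) ∂μ =
      ∫⁻ ω in A, Sum.elim (fun y => ∫⁻ v, g y v * M.waitDens Φ y v) (fun _ => 0) (ω n) ∂μ := by
  have := hμ.prob
  have hl : MeasurableSet (range (Sum.inl : State K → ExtState K)) := measurableSet_range_inl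
  have hE : MeasurableSet ((fun ω : PathSpace K => ω n) ⁻¹' range Sum.inl) :=
    measurable_pi_apply n hl
  have hE' : MeasurableSet ((fun ω : PathSpace K => ω (n + 1)) ⁻¹' range Sum.inl) :=
    measurable_pi_apply (n + 1) hl
  obtain ⟨o, ho⟩ : ∃ o : ExtState K → State K, o = Sum.elim id (fun _ => 0) := ⟨_, rfl⟩
  have hom : Measurable o := by rw [ho]; exact measurable_outl
  have hol : ∀ y, o (Sum.inl y) = y := fun y => by rw [ho]; rfl
  have ho1 : Measurable fun ω : PathSpace K => o (ω n) := hom.comp (measurable_pi_apply n)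
  have ho2 : Measurable fun ω : PathSpace K => o (ω (n + 1)) := hom.comp (measurable_pi_apply _)
  have ho3 : Measurable fun ω : PathSpace K => (o (ω n), (o (ω (n + 1))).1 - (o (ω n)).1) :=
    ho1.prodMk (ho2.fst.sub ho1.fst)
  obtain ⟨τ, hτs, hτ⟩ : ∃ τ : Kernel (State K) ℝ, IsSFiniteKernel τ ∧ ∀ y (c : ℝ → ℝ≥0∞),
      Measurable c → ∫⁻ v, c v ∂(τ y) = ∫⁻ v, c v * M.waitDens Φ y v := by
    refine ⟨(Kernel.const (State K) volume).withDensity (M.waitDens Φ),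
      Kernel.IsSFiniteKernel.withDensity _ fun y v => ?_, fun y c hc => ?_⟩
    · by_cases hv : v ∈ Ioc 0 (M.T - y.1) <;> simp [waitDens, hv, jumpDens]
    · rw [Kernel.lintegral_withDensity _ hΦ.measurable_waitDens _ hc]
      simp only [Kernel.const_apply, mul_comm]
  -- `N₁` is the joint law of state and waiting time on `A`, and `N₂` is the law built from the
  -- density. They are shown to be equal on rectangles.
  obtain ⟨N₁, hN₁, hN₁'⟩ : ∃ N : Measure (State K × ℝ), IsFiniteMeasure N ∧
      ∀ G : State K × ℝ → ℝ≥0∞, Measurable G → ∫⁻ p, G p ∂N =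
        ∫⁻ ω in A, pairFun (fun y y' => G (y, y'.1 - y.1)) (fun _ => 0) (ω n) (ω (n + 1)) ∂μ := by
    refine ⟨((μ.restrict A).restrict ((fun ω : PathSpace K => ω n) ⁻¹' range Sum.inl ∩
      (fun ω : PathSpace K => ω (n + 1)) ⁻¹' range Sum.inl)).map
        (fun ω => (o (ω n), (o (ω (n + 1))).1 - (o (ω n)).1)), inferInstance, fun G hG => ?_⟩
    rw [lintegral_map hG ho3, ← lintegral_indicator (hE.inter hE')]
    congr 1 with ω
    rcases hy : ω n with y | u
    · rcases hy' : ω (n + 1) with y' | u'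
      · rw [indicator_of_mem (show ω ∈ ((fun ω : PathSpace K => ω n) ⁻¹' range Sum.inl ∩
          (fun ω : PathSpace K => ω (n + 1)) ⁻¹' range Sum.inl) from
          ⟨⟨y, hy.symm⟩, ⟨y', hy'.symm⟩⟩)]
        simp [pairFun, hol, hy, hy']
      · rw [indicator_of_notMem (fun hc => by obtain ⟨z, hz⟩ := hc.2; simp [hy'] at hz)]
        simp [pairFun]
    · rw [indicator_of_notMem (fun hc => by obtain ⟨z, hz⟩ := hc.1; simp [hy] at hz)]
      simp [pairFun]
  obtain ⟨N₂, hN₂'⟩ : ∃ N : Measure (State K × ℝ),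
      ∀ G : State K × ℝ → ℝ≥0∞, Measurable G → ∫⁻ p, G p ∂N =
        ∫⁻ ω in A, Sum.elim (fun y => ∫⁻ v, G (y, v) * M.waitDens Φ y v) (fun _ => 0) (ω n) ∂μ := by
    refine ⟨((μ.restrict A).restrict ((fun ω : PathSpace K => ω n) ⁻¹' range Sum.inl)).map
      (fun ω => o (ω n)) ⊗ₘ τ, fun G hG => ?_⟩
    have hGm : ∀ y, Measurable fun v => G (y, v) := fun y => hG.comp measurable_prodMk_left
    rw [Measure.lintegral_compProd hG, lintegral_map hG.lintegral_kernel_prod_right' ho1,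
      ← lintegral_indicator hE]
    congr 1 with ω
    rcases hy : ω n with y | u
    · rw [indicator_of_mem (show ω ∈ ((fun ω : PathSpace K => ω n) ⁻¹' range Sum.inl) from
        ⟨y, hy.symm⟩)]
      simp only [hy, hol, hτ _ _ (hGm _), Sum.elim_inl]
    · rw [indicator_of_notMem (fun hc => by obtain ⟨z, hz⟩ := hc; simp [hy] at hz)]
      simp
  -- The condition on the state is an event of the past, so it joins `A` in the survival formula.
  have hgt : ∀ (C : Set (State K)), MeasurableSet C → ∀ s : ℝ, 0 ≤ s →
      N₁ (C ×ˢ Ioi s) = N₂ (C ×ˢ Ioi s) := by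
    intro C hC s hs
    have hCs : MeasurableSet (C ×ˢ Ioi s) := hC.prod measurableSet_Ioi
    rw [← lintegral_indicator_one hCs, ← lintegral_indicator_one hCs,
      hN₁' _ (measurable_one.indicator hCs), hN₂' _ (measurable_one.indicator hCs)]
    have hCm : MeasurableSet[Filtration.piLE n] ((fun ω : PathSpace K => ω n) ⁻¹' (Sum.inl '' C)) :=
      measurable_piLE_eval le_rfl hC.inl_image
    have hCm' := Filtration.piLE.le n _ hCm
    have h1 := hμ.lintegral_gt hΦ hn (MeasurableSet.inter hCm hA) hs
    rw [← Measure.restrict_restrict hCm', ← lintegral_indicator hCm',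
      ← lintegral_indicator hCm'] at h1
    refine (lintegral_congr fun ω => ?_).trans (h1.trans (lintegral_congr fun ω => ?_))
    · rcases hy : ω n with y | u
      · by_cases hyC : y ∈ C
        · rw [indicator_of_mem (show ω ∈ ((fun ω : PathSpace K => ω n) ⁻¹' (Sum.inl '' C)) from
            ⟨y, hyC, hy.symm⟩)]
          rcases hy' : ω (n + 1) with y' | u' <;>
            simp [pairFun, hy, hyC, indicator, lt_sub_iff_add_lt']
        · rw [indicator_of_notMem (fun hc => by
            obtain ⟨z, hz, hz'⟩ := hc
            change Sum.inl z = ω n at hz'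
            rw [hy] at hz'
            exact hyC (Sum.inl.inj hz' ▸ hz))]
          rcases ω (n + 1) with y' | u' <;> simp [pairFun, hyC]
      · rw [indicator_of_notMem (fun hc => by obtain ⟨z, hz, hz'⟩ := hc; simp [hy] at hz')]
        simp [pairFun]
    · rcases hy : ω n with y | u
      · by_cases hyC : y ∈ C
        · rw [indicator_of_mem (show ω ∈ ((fun ω : PathSpace K => ω n) ⁻¹' (Sum.inl '' C)) from
            ⟨y, hyC, hy.symm⟩)]
          simp [hy, hyC, indicator]
        · rw [indicator_of_notMem (fun hc => by
            obtain ⟨z, hz, hz'⟩ := hc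
            change Sum.inl z = ω n at hz'
            rw [hy] at hz'
            exact hyC (Sum.inl.inj hz' ▸ hz))]
          simp [hyC]
      · rw [indicator_of_notMem (fun hc => by obtain ⟨z, hz, hz'⟩ := hc; simp [hy] at hz')]
        simp
  -- Neither measure charges nonpositive waiting times. So half-lines with `s ≥ 0` suffice, and
  -- half-lines generate the Borel sets.
  have hneg : N₁ (univ ×ˢ Iic 0) = 0 ∧ N₂ (univ ×ˢ Iic 0) = 0 := by
    have hCs : MeasurableSet ((univ : Set (State K)) ×ˢ Iic (0 : ℝ)) :=
      MeasurableSet.univ.prod measurableSet_Iic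
    rw [← lintegral_indicator_one hCs, ← lintegral_indicator_one hCs,
      hN₁' _ (measurable_one.indicator hCs), hN₂' _ (measurable_one.indicator hCs)]
    constructor
    · refine (lintegral_congr_ae (ae_restrict_of_ae ?_)).trans lintegral_zero
      filter_upwards [hμ.ae_lt hn] with ω hω
      rcases hy : ω n with y | u
      · rcases hy' : ω (n + 1) with y' | u'
        · have := hω y y' hy hy'
          simp [pairFun, indicator, this]
        · rfl
      · rfl
    · refine (lintegral_congr fun ω => ?_).trans lintegral_zero
      rcases ω n with y | u
      · simp only [Sum.elim_inl]
        refine (lintegral_congr fun v => ?_).trans lintegral_zero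
        by_cases hv : 0 < v
        · simp [indicator, hv]
        · simp [waitDens, hv]
      · rfl
  have hpos : ∀ N : Measure (State K × ℝ), N (univ ×ˢ Iic 0) = 0 → ∀ C : Set (State K),
      ∀ B : Set ℝ, N (C ×ˢ B) = N (C ×ˢ (B ∩ Ioi 0)) := by
    intro N hN C B
    refine le_antisymm ?_ (measure_mono (prod_mono le_rfl inter_subset_left))
    calc N (C ×ˢ B) ≤ N (C ×ˢ (B ∩ Ioi 0) ∪ univ ×ˢ Iic 0) := measure_mono (by
          rintro ⟨y, v⟩ ⟨hy, hv⟩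
          rcases le_or_gt v 0 with h0 | h0
          · exact Or.inr ⟨trivial, h0⟩
          · exact Or.inl ⟨hy, hv, h0⟩)
      _ ≤ _ := (measure_union_le _ _).trans (by rw [hN, add_zero])
  have hrect : ∀ C : Set (State K), MeasurableSet C → ∀ B : Set ℝ, MeasurableSet B →
      N₁ (C ×ˢ B) = N₂ (C ×ˢ B) := by
    intro C hC B hB
    have hap : ∀ N : Measure (State K × ℝ), ∀ B : Set ℝ, MeasurableSet B →
        ((N.restrict (C ×ˢ univ)).map Prod.snd) B = N (C ×ˢ B) := by
      intro N B hB
      rw [Measure.map_apply measurable_snd hB, Measure.restrict_apply (measurable_snd hB)]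
      congr 1
      ext ⟨y, v⟩
      simp [and_comm]
    have hs : ∀ s : ℝ, N₁ (C ×ˢ Ioi s) = N₂ (C ×ˢ Ioi s) := by
      intro s
      rw [hpos N₁ hneg.1, hpos N₂ hneg.2, Ioi_inter_Ioi]
      exact hgt C hC _ (le_max_right _ _)
    rw [← hap N₁ B hB, ← hap N₂ B hB]
    congr 1
    refine ext_of_generate_finite _ ((BorelSpace.measurable_eq (α := ℝ)).trans
      (borel_eq_generateFrom_Ioi ℝ)) isPiSystem_Ioi ?_ ?_
    · rintro _ ⟨s, rfl⟩
      rw [hap N₁ _ measurableSet_Ioi, hap N₂ _ measurableSet_Ioi, hs]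
    · rw [hap N₁ _ MeasurableSet.univ, hap N₂ _ MeasurableSet.univ, hpos N₁ hneg.1,
        hpos N₂ hneg.2, univ_inter, hs]
  have hN : N₁ = N₂ := by
    refine ext_of_generate_finite _ generateFrom_prod.symm isPiSystem_prod ?_ ?_
    · rintro _ ⟨C, hC, B, hB, rfl⟩
      exact hrect C hC B hB
    · rw [← univ_prod_univ]
      exact hrect _ MeasurableSet.univ _ MeasurableSet.univ
  have h1 := hN₁' _ hg
  rw [hN, hN₂' _ hg] at h1
  exact h1.symm

open Classical in
theorem IsPDMPLaw.ae_goodPair (hμ : M.IsPDMPLaw h x μ) (hΦ : M.IsFlowVersion (h n) Φ)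
    (hn : ∀ᵐ ω ∂μ, ω n ∈ M.chainSpace) :
    ∀ᵐ ω ∂μ, ∀ y y', ω n = Sum.inl y → ω (n + 1) = Sum.inl y' → M.goodPair y y' := by
  apply ae_goodPair_of_lintegral
  have hg : Measurable (Function.uncurry fun (y : State K) v =>
      if v ∈ Ioc 0 (M.T - y.1) then (0 : ℝ≥0∞) else 1) := by
    refine Measurable.ite ?_ measurable_const measurable_const
    exact (measurableSet_lt measurable_const measurable_snd).inter
      (measurableSet_le measurable_snd (measurable_fst.fst.const_sub M.T))
  have h1 := hμ.lintegral_waiting hΦ hn (@MeasurableSet.univ _ (Filtration.piLE n)) hg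
  rw [Measure.restrict_univ] at h1
  refine (lintegral_congr fun ω => ?_).trans
    (h1.trans ((lintegral_congr fun ω => ?_).trans lintegral_zero))
  · rcases ω n with y | u
    · rcases ω (n + 1) with y' | u'
      · simp only [pairFun, goodPair, Sum.elim_inl]
        by_cases hc : y'.1 - y.1 ∈ Ioc 0 (M.T - y.1)
        · exact (if_pos hc).trans (if_pos hc).symm
        · exact (if_neg hc).trans (if_neg hc).symm
      · rfl
    · rfl
  rcases ω n with y | u
  · simp only [Sum.elim_inl]
    refine (lintegral_congr fun v => ?_).trans lintegral_zero
    by_cases hv : v ∈ Ioc 0 (M.T - y.1) <;> simp [waitDens, hv]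
  · rfl

/-- The next value of `f` has three parts: a jump occurs, no jump follows a living state, or the
path is already absorbed. `location` turns the first into `Q f` just before the jump, a function of
state and waiting time, which is integrated against the density. `lintegral_noJump` gives the
second, and together they form `Q_L`. -/
theorem IsPDMPLaw.stepAt (hM : M.Standing) (hh : M.Admissible h) (hμ : M.IsPDMPLaw h x μ)
    (hn : ∀ᵐ ω ∂μ, ω n ∈ M.chainSpace) : M.StepAt h μ n := by
  intro A hA f hf
  obtain ⟨Φ, hΦ⟩ := hM.exists_flowVersion (hh.isControl n)
  have hfl : Measurable fun y : State K => f (Sum.inl y) := hf.comp measurable_inl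
  have hO := IsFlowVersion.measurable_jumpOp (hh.measurable n) hΦ hfl
  obtain ⟨g, hg⟩ : ∃ g : State K → ℝ → ℝ≥0∞, g = fun y v =>
    M.jumpOp (fun y => f (Sum.inl y)) (Φ y v) (h n y v) := ⟨_, rfl⟩
  have hgm : Measurable (Function.uncurry g) := by rw [hg]; exact hO
  have hD := hΦ.measurable_lintegral_waitDens hgm
  have h1 := hμ.lintegral_waiting hΦ hn hA hgm
  have h2 := hμ.lintegral_noJump hΦ hn hA
  have h3 := hμ.location n A hA univ MeasurableSet.univ _ hfl
  have e1 : (fun ω : PathSpace K => f (ω (n + 1))) =ᵐ[μ] fun ω =>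
      Sum.elim (fun y' => univ.indicator 1 y'.1 * f (Sum.inl y')) (fun _ => 0) (ω (n + 1)) +
      (f (Sum.inr ()) * pairFun (fun _ _ => 0) (fun _ => 1) (ω n) (ω (n + 1)) +
        Sum.elim (fun _ => 0) (fun _ => f (Sum.inr ())) (ω n)) := by
    filter_upwards [hμ.absorbed n] with ω hω
    rcases hy : ω n with y | u
    · rcases hy' : ω (n + 1) with y' | u' <;> simp [pairFun]
    · simp [hω hy, pairFun]
  have e2 : (fun ω : PathSpace K => Sum.elim
        (fun y => Sum.elim
          (fun y' => univ.indicator 1 y'.1 * M.jumpOp (fun y => f (Sum.inl y))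
            (M.flow (h n y) y (y'.1 - y.1)) (h n y (y'.1 - y.1)))
          (fun _ => 0) (ω (n + 1))) (fun _ => 0) (ω n)) =ᵐ[μ] fun ω =>
      pairFun (fun y y' => g y (y'.1 - y.1)) (fun _ => 0) (ω n) (ω (n + 1)) := by
    filter_upwards [hn, hμ.ae_goodPair hΦ hn] with ω hω hgood
    rcases hy : ω n with y | u
    · rcases hy' : ω (n + 1) with y' | u'
      · rw [hy] at hω
        have hgp := hgood y y' hy hy'
        simp only [pairFun, Sum.elim_inl, hg, indicator_univ, Pi.one_apply, one_mul]
        rw [hΦ.flow_eq y (inl_mem_chainSpace.1 hω) _ ⟨hgp.1.le, hgp.2⟩]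
      · rfl
    · rfl
  have h00 : Measurable (Function.uncurry fun (_ _ : State K) => (0 : ℝ≥0∞)) := measurable_const
  have hp := measurable_pairFun_path h00 (measurable_const (a := (1 : ℝ≥0∞))) n
  have hq := measurable_elim_path (K := K) (measurable_const (a := (0 : ℝ≥0∞))) (f (Sum.inr ())) n
  have hr : Measurable fun ω : PathSpace K =>
      f (Sum.inr ()) * pairFun (fun _ _ => 0) (fun _ => 1) (ω n) (ω (n + 1)) +
        Sum.elim (fun _ => 0) (fun _ => f (Sum.inr ())) (ω n) := (hp.const_mul _).add hq
  rw [lintegral_congr_ae (ae_restrict_of_ae e1), lintegral_add_right _ hr,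
    lintegral_add_right _ hq, lintegral_const_mul _ hp, h2, h3,
    lintegral_congr_ae (ae_restrict_of_ae e2), h1,
    ← lintegral_const_mul _ (measurable_elim_path hΦ.measurable_noJump 0 n),
    ← lintegral_add_right _ hq, ← lintegral_add_left (measurable_elim_path hD 0 n)]
  refine lintegral_congr_ae (ae_restrict_of_ae ?_)
  filter_upwards [hn] with ω hω
  rcases hy : ω n with y | u
  · rw [hy] at hω
    simp only [Sum.elim_inl, add_zero]
    rw [hΦ.mdmOp_eq (inl_mem_chainSpace.1 hω), transOp, lintegral_waitDens, mul_comm (f _)]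
    congr 1
    refine setLIntegral_congr_fun measurableSet_Ioc fun v hv => ?_
    simp only [hg, mul_comm]
  · simp

theorem IsPDMPLaw.isMDMLaw (hM : M.Standing) (hh : M.Admissible h) (hx : x ∈ M.stateSpace)
    (hμ : M.IsPDMPLaw h x μ) : M.IsMDMLaw h x μ := by
  have hsupp : ∀ n, ∀ᵐ ω ∂μ, ω n ∈ M.chainSpace := by
    intro n
    induction n with
    | zero => exact ae_mem_chainSpace_zero hx hμ.initial
    | succ n ih => exact (hμ.stepAt hM hh ih).ae_mem_chainSpace hM hh ih
  exact ⟨hμ.prob, hμ.initial, fun n => hμ.stepAt hM hh (hsupp n)⟩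

theorem isPDMPLaw_iff_isMDMLaw (hM : M.Standing) (hh : M.Admissible h) (hx : x ∈ M.stateSpace) :
    M.IsPDMPLaw h x μ ↔ M.IsMDMLaw h x μ :=
  ⟨fun hμ => hμ.isMDMLaw hM hh hx, fun hμ => hμ.isPDMPLaw hM hh hx⟩

end MarketData

namespace MarketData

variable {K : ℕ} {M : MarketData K}

/-! ### Absorption and expected payoffs at the horizon -/

/-- `r ≥ 0` on the state space, extended by `0` to the cemetery. -/
def extZero (r : State K → ℝ≥0∞) (e : ExtState K) : ℝ≥0∞ := Sum.elim r (fun _ => 0) e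

theorem measurable_extZero {r : State K → ℝ≥0∞} (hr : Measurable r) : Measurable (extZero r) :=
  Measurable.sumElim hr measurable_const

theorem measurable_extZero_path {r : State K → ℝ≥0∞} (hr : Measurable r) (n : ℕ) :
    Measurable fun ω : PathSpace K => extZero r (ω n) :=
  (measurable_extZero hr).comp (measurable_pi_apply n)

variable {h : Strategy K} {x : State K} {μ : Measure (PathSpace K)}

/-- Expected total payoffs are dominated by superharmonic functions. -/
theorem IsMDMLaw.tsum_lintegral_le (hM : M.Standing) (hh : M.Admissible h) (hx : x ∈ M.stateSpace)
    (hμ : M.IsMDMLaw h x μ) {v : State K → ℝ≥0∞} (hv : Measurable v)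
    {r : ℕ → State K → ℝ≥0∞} (hr : ∀ n, Measurable (r n))
    (hrv : ∀ n, ∀ y ∈ M.stateSpace, M.mdmOp (extZero v) y (h n y) + r n y ≤ v y) :
    ∑' n, ∫⁻ ω, extZero (r n) (ω n) ∂μ ≤ v x := by
  have := hμ.prob
  have hstep : ∀ n, ∫⁻ ω, extZero v (ω (n + 1)) ∂μ + ∫⁻ ω, extZero (r n) (ω n) ∂μ ≤
      ∫⁻ ω, extZero v (ω n) ∂μ := by
    intro n
    have h1 := hμ.transition n univ (@MeasurableSet.univ _ (Filtration.piLE n)) _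
      (measurable_extZero hv)
    rw [Measure.restrict_univ] at h1
    rw [h1, ← lintegral_add_right _ (measurable_extZero_path (hr n) n)]
    refine lintegral_mono_ae ?_
    filter_upwards [hμ.ae_mem_chainSpace hM hh hx n] with ω hω
    rcases hy : ω n with y | u
    · rw [hy] at hω
      exact hrv n y (inl_mem_chainSpace.1 hω)
    · simp [extZero]
  have h0 : ∫⁻ ω, extZero v (ω 0) ∂μ = v x := by
    rw [lintegral_congr_ae (g := fun _ => v x), lintegral_const, measure_univ, mul_one]
    filter_upwards [hμ.initial] with ω hω
    rw [hω]; rfl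
  -- Telescoping: the expected value of `v` at stage `N` is nonnegative and can be dropped at the
  -- end.
  have hsum : ∀ N, ∑ n ∈ Finset.range N, ∫⁻ ω, extZero (r n) (ω n) ∂μ +
      ∫⁻ ω, extZero v (ω N) ∂μ ≤ v x := by
    intro N
    induction N with
    | zero => simp [h0]
    | succ N ih =>
      rw [Finset.sum_range_succ, add_assoc]
      refine le_trans (add_le_add le_rfl ?_) ih
      rw [add_comm]
      exact hstep N
  rw [ENNReal.tsum_eq_iSup_nat]
  exact iSup_le fun N => le_self_add.trans (hsum N)

/-- The constant `1` is harmonic for the payoff "absorbed now"; hence the total absorption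
probability is at most one. -/
theorem IsFlowVersion.mdmOp_one_add {α : State K → ℝ → ℝ} {Φ : State K → ℝ → State K}
    (hΦ : M.IsFlowVersion α Φ) {y : State K} (hy : y ∈ M.stateSpace) :
    M.mdmOp (extZero fun _ => 1) y (α y) + M.noJump Φ y = 1 := by
  rw [hΦ.mdmOp_eq hy, transOp]
  simp only [extZero, Sum.elim_inl, Sum.elim_inr, mul_zero, add_zero]
  refine Eq.trans ?_ (hΦ.mass_zero hy)
  congr 1
  exact setLIntegral_congr_fun measurableSet_Ioc fun v hv =>
    hΦ.jumpDens_mul_const hy ⟨hv.1.le, hv.2⟩ _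

theorem IsMDMLaw.tsum_noJump_le (hM : M.Standing) (hh : M.Admissible h) (hx : x ∈ M.stateSpace)
    (hμ : M.IsMDMLaw h x μ) {Φ : ℕ → State K → ℝ → State K}
    (hΦ : ∀ n, M.IsFlowVersion (h n) (Φ n)) :
    ∑' n, ∫⁻ ω, extZero (M.noJump (Φ n)) (ω n) ∂μ ≤ 1 :=
  hμ.tsum_lintegral_le hM hh hx (v := fun _ => 1) measurable_const
    (fun n => (hΦ n).measurable_noJump) fun n _ hy => ((hΦ n).mdmOp_one_add hy).le

/-- The chain is absorbed in the cemetery after finitely many steps. -/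
theorem IsMDMLaw.ae_absorbed (hM : M.Standing) (hh : M.Admissible h) (hx : x ∈ M.stateSpace)
    (hμ : M.IsMDMLaw h x μ) : ∀ᵐ ω ∂μ, ∃ N, ∀ n ≥ N, ω n = Sum.inr () := by
  have := hμ.prob
  choose Φ hΦ using fun n => hM.exists_flowVersion (hh.isControl n)
  have h1 := hμ.tsum_noJump_le hM hh hx hΦ
  -- At every living stage absorption has probability at least `c`. So the probabilities of being
  -- alive have a sum of at most `1 / c`, and Borel-Cantelli applies.
  obtain ⟨c, hc⟩ : ∃ c, c = ENNReal.ofReal (Real.exp (-(M.ς.real univ * M.T))) := ⟨_, rfl⟩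
  have hc0 : c ≠ 0 := by rw [hc]; simp [Real.exp_pos]
  have hct : c ≠ ⊤ := by rw [hc]; exact ENNReal.ofReal_ne_top
  have hE : ∀ n, MeasurableSet {ω : PathSpace K | ω n ∈ range (Sum.inl : State K → ExtState K)} :=
    fun n => measurable_pi_apply n measurableSet_range_inl
  have h2 : ∀ n, c * μ {ω | ω n ∈ range (Sum.inl : State K → ExtState K)} ≤
      ∫⁻ ω, extZero (M.noJump (Φ n)) (ω n) ∂μ := by
    intro n
    rw [← setLIntegral_const, ← lintegral_indicator (hE n)]
    refine lintegral_mono_ae ?_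
    filter_upwards [hμ.ae_mem_chainSpace hM hh hx n] with ω hω
    rcases hy : ω n with y | u
    · rw [hy] at hω
      rw [indicator_of_mem (show ω ∈ {ω : PathSpace K | ω n ∈ range Sum.inl} from ⟨y, hy.symm⟩), hc]
      exact (hΦ n).le_noJump (inl_mem_chainSpace.1 hω)
    · rw [indicator_of_notMem fun hc => by obtain ⟨z, hz⟩ := hc; simp [hy] at hz]
      exact zero_le
  have h3 : ∑' n, μ {ω | ω n ∈ range (Sum.inl : State K → ExtState K)} ≠ ⊤ := by
    intro htop
    have h4 := (ENNReal.tsum_le_tsum h2).trans h1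
    rw [ENNReal.tsum_mul_left, htop, ENNReal.mul_top hc0] at h4
    simp at h4
  filter_upwards [ae_eventually_notMem h3] with ω hω
  obtain ⟨N, hN⟩ := eventually_atTop.1 hω
  refine ⟨N, fun n hn => ?_⟩
  rcases hy : ω n with y | u
  · exact absurd ⟨y, hy.symm⟩ (hN n hn)
  · rfl

/-- Expected payoffs at the horizon. -/
theorem IsMDMLaw.lintegral_final (hM : M.Standing) (hh : M.Admissible h) (hx : x ∈ M.stateSpace)
    (hμ : M.IsMDMLaw h x μ) {n : ℕ} {Φ : State K → ℝ → State K} (hΦ : M.IsFlowVersion (h n) Φ)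
    {b : State K → ℝ≥0∞} (hb : Measurable b) :
    ∫⁻ ω, pairFun (fun _ _ => 0) b (ω n) (ω (n + 1)) ∂μ =
      ∫⁻ ω, extZero (fun y => M.noJump Φ y * b y) (ω n) ∂μ := by
  have h00 : Measurable (Function.uncurry fun (_ _ : State K) => (0 : ℝ≥0∞)) := measurable_const
  have h1 := hμ.transition_pair hM hh hx n (@MeasurableSet.univ _ (Filtration.piLE n))
    (measurable_pairFun h00 hb)
  rw [Measure.restrict_univ] at h1
  rw [h1]
  refine lintegral_congr_ae ?_
  filter_upwards [hμ.ae_mem_chainSpace hM hh hx n] with ω hω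
  rcases hy : ω n with y | u
  · rw [hy] at hω
    simp only [Sum.elim_inl, extZero]
    rw [hΦ.mdmOp_pairFun_time (inl_mem_chainSpace.1 hω) (fun _ => 0) (fun _ _ => 0) b fun _ => rfl]
    simp
  · rfl

variable (M) in
/-- The wealth at the horizon if there is no further jump. -/
def finalWealth (Φ : State K → ℝ → State K) (y : State K) : ℝ := (Φ y (M.T - y.1)).2.1

theorem IsFlowVersion.measurable_finalWealth {α : State K → ℝ → ℝ} {Φ : State K → ℝ → State K}
    (hΦ : M.IsFlowVersion α Φ) : Measurable (M.finalWealth Φ) :=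
  (hΦ.measurable.comp (measurable_id.prodMk (measurable_fst.const_sub M.T))).snd.fst

theorem IsFlowVersion.finalWealth_pos {α : State K → ℝ → ℝ} {Φ : State K → ℝ → State K}
    (hΦ : M.IsFlowVersion α Φ) {y : State K} (hy : y ∈ M.stateSpace) : 0 < M.finalWealth Φ y :=
  (hΦ.mem y hy _ ⟨sub_nonneg.2 hy.1.2, le_rfl⟩).2.1

theorem IsFlowVersion.finalWealth_eq {α : State K → ℝ → ℝ} {Φ : State K → ℝ → State K}
    (hΦ : M.IsFlowVersion α Φ) {y : State K} (hy : y ∈ M.stateSpace) :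
    (M.flow (α y) y (M.T - y.1)).2.1 = M.finalWealth Φ y := by
  rw [hΦ.flow_eq y hy _ ⟨sub_nonneg.2 hy.1.2, le_rfl⟩, finalWealth]

/-- Almost surely there is a last jump before the horizon. -/
theorem IsMDMLaw.ae_exists_last (hM : M.Standing) (hh : M.Admissible h) (hx : x ∈ M.stateSpace)
    (hμ : M.IsMDMLaw h x μ) : ∀ᵐ ω ∂μ, ∃ n, (∀ k ≤ n, ∃ y ∈ M.stateSpace, ω k = Sum.inl y) ∧
      ∀ k, n < k → ω k = Sum.inr () := by
  have hsupp := ae_all_iff.2 (hμ.ae_mem_chainSpace hM hh hx)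
  filter_upwards [hμ.ae_absorbed hM hh hx, ae_all_iff.2 hμ.absorbed, hsupp, hμ.initial] with
    ω hN habs hs h0
  have hex : ∃ N, ω N = Sum.inr () := by
    obtain ⟨N, hN⟩ := hN
    exact ⟨N, hN N le_rfl⟩
  classical
  have hpos : Nat.find hex ≠ 0 := by
    intro hc
    have := Nat.find_spec hex
    rw [hc, h0] at this
    simp at this
  refine ⟨Nat.find hex - 1, fun k hk => ?_, fun k hk => ?_⟩
  · have hk' : k < Nat.find hex := by omega
    rcases hy : ω k with y | u
    · refine ⟨y, ?_, rfl⟩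
      have := hs k
      rw [hy] at this
      exact inl_mem_chainSpace.1 this
    · exact absurd hy (Nat.find_min hex hk')
  · have hk' : Nat.find hex ≤ k := by omega
    exact Nat.le_induction (Nat.find_spec hex) (fun m _ hm => habs m hm) k hk'

theorem terminalWealth_eq {ω : PathSpace K} {n : ℕ} {Φ : State K → ℝ → State K}
    (hΦ : M.IsFlowVersion (h n) Φ) (hω : ∀ k ≤ n, ∃ y ∈ M.stateSpace, ω k = Sum.inl y)
    (hω' : ∀ k, n < k → ω k = Sum.inr ()) {y : State K} (hy : ω n = Sum.inl y) :
    M.terminalWealth h ω = M.finalWealth Φ y := by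
  classical
  have hyS : y ∈ M.stateSpace := by
    obtain ⟨y', hy', h'⟩ := hω n le_rfl
    rw [hy] at h'
    rwa [Sum.inl.inj h']
  -- Only the last jump qualifies: all earlier ones are followed by a jump at a time at most `T`,
  -- whereas the next jump time after the last one is `⊤`. A jump exactly at `T` is counted.
  have hspec : ∀ k, (jumpTime ω k ≤ (M.T : EReal) ∧ (M.T : EReal) < jumpTime ω (k + 1)) ↔
      k = n := by
    intro k
    constructor
    · rintro ⟨h1, h2⟩
      refine le_antisymm ?_ ?_
      · by_contra hc
        rw [jumpTime, hω' k (not_le.1 hc)] at h1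
        simp at h1
      · by_contra hc
        obtain ⟨y', hy', h'⟩ := hω (k + 1) (by omega)
        rw [jumpTime, h'] at h2
        exact absurd (EReal.coe_lt_coe_iff.1 h2) (not_lt.2 hy'.1.2)
    · rintro rfl
      rw [jumpTime, jumpTime, hy, hω' (k + 1) (Nat.lt_succ_self k)]
      exact ⟨EReal.coe_le_coe_iff.2 hyS.1.2, EReal.coe_lt_top _⟩
  have H : ∃ k, jumpTime ω k ≤ (M.T : EReal) ∧ (M.T : EReal) < jumpTime ω (k + 1) :=
    ⟨n, (hspec n).2 rfl⟩
  have hfind : Nat.find H = n := (hspec _).1 (Nat.find_spec H)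
  rw [terminalWealth, stateAt, dif_pos H, hfind, hy, Sum.elim_inl, hΦ.finalWealth_eq hyS]

/-- Expectations of nonnegative functions of the terminal wealth. -/
theorem IsMDMLaw.lintegral_terminalWealth (hM : M.Standing) (hh : M.Admissible h)
    (hx : x ∈ M.stateSpace) (hμ : M.IsMDMLaw h x μ) {Φ : ℕ → State K → ℝ → State K}
    (hΦ : ∀ n, M.IsFlowVersion (h n) (Φ n)) {f : ℝ → ℝ≥0∞} (hf : Measurable f) :
    ∫⁻ ω, f (M.terminalWealth h ω) ∂μ =
      ∑' n, ∫⁻ ω, extZero (fun y => M.noJump (Φ n) y * f (M.finalWealth (Φ n) y)) (ω n) ∂μ := by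
  have h00 : Measurable (Function.uncurry fun (_ _ : State K) => (0 : ℝ≥0∞)) := measurable_const
  have hb : ∀ n, Measurable fun y => f (M.finalWealth (Φ n) y) := fun n =>
    hf.comp (hΦ n).measurable_finalWealth
  -- The conditional absorption probability is undone: the payoff becomes the event "alive at `n`,
  -- absorbed at `n + 1`". These events are disjoint, so exactly one term of the sum survives on
  -- almost every path.
  rw [tsum_congr fun n => (hμ.lintegral_final hM hh hx (hΦ n) (hb n)).symm,
    ← lintegral_tsum fun n => (measurable_pairFun_path h00 (hb n) n).aemeasurable]
  refine lintegral_congr_ae ?_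
  filter_upwards [hμ.ae_exists_last hM hh hx] with ω ⟨n, hω, hω'⟩
  obtain ⟨y, hyS, hy⟩ := hω n le_rfl
  rw [terminalWealth_eq (hΦ n) hω hω' hy, tsum_eq_single n]
  · rw [hy, hω' (n + 1) (Nat.lt_succ_self n)]
    rfl
  · intro k hk
    rcases lt_or_gt_of_ne hk with hlt | hgt
    · obtain ⟨y₁, -, h₁⟩ := hω k hlt.le
      obtain ⟨y₂, -, h₂⟩ := hω (k + 1) hlt
      rw [h₁, h₂]
      rfl
    · rw [hω' k hgt]
      rfl

/-- The total reward is the difference of the total rewards with positive and negative sign. -/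
theorem totalReward_eq {U : ℝ → ℝ} {ω : PathSpace K} {n : ℕ} {Φ : ℕ → State K → ℝ → State K}
    (hΦ : ∀ n, M.IsFlowVersion (h n) (Φ n))
    (hω : ∀ k ≤ n, ∃ y ∈ M.stateSpace, ω k = Sum.inl y)
    (hω' : ∀ k, n < k → ω k = Sum.inr ()) :
    ∑' k, extZero (fun y => M.noJump (Φ k) y * ENNReal.ofReal (U (M.finalWealth (Φ k) y))) (ω k)
        ≠ ⊤ ∧
    ∑' k, extZero (fun y => M.noJump (Φ k) y * ENNReal.ofReal (-U (M.finalWealth (Φ k) y))) (ω k)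
        ≠ ⊤ ∧
    M.totalReward U h ω =
      (∑' k, extZero (fun y => M.noJump (Φ k) y *
        ENNReal.ofReal (U (M.finalWealth (Φ k) y))) (ω k)).toReal -
      (∑' k, extZero (fun y => M.noJump (Φ k) y *
        ENNReal.ofReal (-U (M.finalWealth (Φ k) y))) (ω k)).toReal := by
  have hz : ∀ r : ℕ → State K → ℝ≥0∞, ∑' k, extZero (r k) (ω k) =
      ∑ k ∈ Finset.range (n + 1), extZero (r k) (ω k) := fun r => by
    refine tsum_eq_sum fun k hk => ?_
    rw [hω' k (by simpa using hk)]
    rfl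
  have ht : ∀ V : ℝ → ℝ, ∀ k, extZero (fun y => M.noJump (Φ k) y *
      ENNReal.ofReal (V (M.finalWealth (Φ k) y))) (ω k) ≠ ⊤ := by
    intro V k
    rcases ω k with y | u
    · exact ENNReal.mul_ne_top ENNReal.ofReal_ne_top ENNReal.ofReal_ne_top
    · exact ENNReal.zero_ne_top
  have ht' := ht fun w => -U w
  rw [hz, hz, totalReward, tsum_eq_sum (s := Finset.range (n + 1))]
  · refine ⟨ENNReal.sum_ne_top.2 fun k _ => ht U k, ENNReal.sum_ne_top.2 fun k _ => ht' k, ?_⟩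
    rw [ENNReal.toReal_sum fun k _ => ht U k, ENNReal.toReal_sum fun k _ => ht' k,
      ← Finset.sum_sub_distrib]
    refine Finset.sum_congr rfl fun k hk => ?_
    obtain ⟨y, hyS, hy⟩ := hω k (by simpa [Nat.lt_succ_iff] using hk)
    rw [hy]
    simp only [extZero, Sum.elim_inl]
    rw [ENNReal.toReal_mul, ENNReal.toReal_mul, ← mul_sub, stageReward, (hΦ k).finalWealth_eq hyS,
      (hΦ k).cumRate_eq hyS ⟨sub_nonneg.2 hyS.1.2, le_rfl⟩, noJump,
      ENNReal.toReal_ofReal (Real.exp_pos _).le, ENNReal.toReal_ofReal', ENNReal.toReal_ofReal',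
      max_zero_sub_max_neg_zero_eq_self]
  · intro k hk
    rw [hω' k (by simpa using hk)]
    rfl

end MarketData

/-- The expectation of a difference. -/
theorem extExpectation_sub {Ω : Type*} [MeasurableSpace Ω] {μ : Measure Ω} {X : Ω → ℝ}
    {a b : Ω → ℝ≥0∞} (ha : Measurable a) (hb : Measurable b) (ha' : ∫⁻ ω, a ω ∂μ ≠ ⊤)
    (hX : ∀ᵐ ω ∂μ, a ω ≠ ⊤ ∧ b ω ≠ ⊤ ∧ X ω = (a ω).toReal - (b ω).toReal) :
    ∫⁻ ω, ENNReal.ofReal (X ω) ∂μ ≤ ∫⁻ ω, a ω ∂μ ∧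
    extExpectation μ X = ((∫⁻ ω, a ω ∂μ : ℝ≥0∞) : EReal) - ((∫⁻ ω, b ω ∂μ : ℝ≥0∞) : EReal) := by
  have hp : (fun ω => ENNReal.ofReal (X ω)) =ᵐ[μ] fun ω => a ω - b ω := by
    filter_upwards [hX] with ω hω
    rw [hω.2.2, ENNReal.ofReal_sub _ ENNReal.toReal_nonneg, ENNReal.ofReal_toReal hω.1,
      ENNReal.ofReal_toReal hω.2.1]
  have hm : (fun ω => ENNReal.ofReal (-X ω)) =ᵐ[μ] fun ω => b ω - a ω := by
    filter_upwards [hX] with ω hω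
    rw [hω.2.2, neg_sub, ENNReal.ofReal_sub _ ENNReal.toReal_nonneg, ENNReal.ofReal_toReal hω.1,
      ENNReal.ofReal_toReal hω.2.1]
  have hle : ∫⁻ ω, a ω - b ω ∂μ ≤ ∫⁻ ω, a ω ∂μ := lintegral_mono fun ω => tsub_le_self
  have hle' : ∫⁻ ω, b ω - a ω ∂μ ≤ ∫⁻ ω, b ω ∂μ := lintegral_mono fun ω => tsub_le_self
  -- The functions `a` and `b` need not be the positive and negative parts of `X`, since rewards may
  -- cancel along a path. The identity `(a - b) + b = max a b = (b - a) + a` compares them without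
  -- subtracting infinite integrals.
  have hadd : ∫⁻ ω, a ω - b ω ∂μ + ∫⁻ ω, b ω ∂μ = ∫⁻ ω, b ω - a ω ∂μ + ∫⁻ ω, a ω ∂μ := by
    rw [← lintegral_add_right _ hb, ← lintegral_add_right _ ha]
    refine lintegral_congr fun ω => ?_
    rw [tsub_add_eq_max, tsub_add_eq_max, max_comm]
  rw [extExpectation, lintegral_congr_ae hp, lintegral_congr_ae hm]
  refine ⟨hle, ?_⟩
  have hne := ne_top_of_le_ne_top ha' hle
  -- If `∫ b = ⊤`, finiteness of `∫ a` forces `∫ (b - a) = ⊤`, and both differences are `-∞`.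
  by_cases hbt : ∫⁻ ω, b ω ∂μ = ⊤
  · have h1 : ∫⁻ ω, b ω - a ω ∂μ = ⊤ := by
      by_contra hc
      rw [hbt, add_top] at hadd
      exact ENNReal.add_ne_top.2 ⟨hc, ha'⟩ hadd.symm
    rw [h1, hbt]
    simp
  · have hbe := ne_top_of_le_ne_top hbt hle'
    have h2 := congrArg ENNReal.toReal hadd
    rw [ENNReal.toReal_add hne hbt, ENNReal.toReal_add hbe ha'] at h2
    rw [← EReal.coe_ennreal_toReal hne, ← EReal.coe_ennreal_toReal hbt,
      ← EReal.coe_ennreal_toReal hbe, ← EReal.coe_ennreal_toReal ha', ← EReal.coe_sub,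
      ← EReal.coe_sub, EReal.coe_eq_coe_iff]
    linarith

namespace MarketData

variable {K : ℕ} {M : MarketData K}

/-! ### First moments of the wealth -/

variable (M) in
/-- A bound on the rate of growth of the wealth by jumps: `L ∑ⱼ ∫ |z| η(t, e_j, dz)`. -/
noncomputable def jumpMoment (t : ℝ) : ℝ≥0∞ :=
  ENNReal.ofReal M.L * ∑ j, ∫⁻ z, ENNReal.ofReal |z| ∂(M.eta j t)

theorem measurable_jumpMoment : Measurable M.jumpMoment := by
  refine Measurable.const_mul (Finset.measurable_sum _ fun j _ => ?_) _
  have h : Measurable fun z : ℝ => ENNReal.ofReal |z| := (measurable_id.abs).ennreal_ofReal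
  exact h.lintegral_kernel (κ := M.eta j)

/-- By `|z| ≤ 1 + z²`, finiteness of `ς` and square integrability of `G` control the first moments
of the jumps. -/
theorem lintegral_abs_eta_le (j : Fin K) (t : ℝ) :
    ∫⁻ z, ENNReal.ofReal |z| ∂(M.eta j t) ≤
      M.ς univ + ∫⁻ ζ in M.Z, ENNReal.ofReal (M.G t j ζ ^ 2) ∂M.ς := by
  have hm : Measurable (M.G t j) := (M.measurable_G j).comp measurable_prodMk_left
  change ∫⁻ z, ENNReal.ofReal |z|
    ∂((M.ς.restrict (M.Z ∩ {ζ | M.G t j ζ ≠ 0})).map (M.G t j)) ≤ _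
  have habs : Measurable fun z : ℝ => ENNReal.ofReal |z| := (measurable_id.abs).ennreal_ofReal
  rw [lintegral_map habs hm]
  refine (lintegral_mono_set inter_subset_left).trans ?_
  have h1 : ∀ ζ, ENNReal.ofReal |M.G t j ζ| ≤ 1 + ENNReal.ofReal (M.G t j ζ ^ 2) := by
    intro ζ
    rw [← ENNReal.ofReal_one, ← ENNReal.ofReal_add zero_le_one (sq_nonneg _)]
    refine ENNReal.ofReal_le_ofReal ?_
    nlinarith [sq_nonneg (|M.G t j ζ| - 1), sq_abs (M.G t j ζ), abs_nonneg (M.G t j ζ)]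
  refine (lintegral_mono h1).trans ?_
  rw [lintegral_add_left measurable_const, lintegral_const, one_mul]
  exact add_le_add (Measure.restrict_apply_le _ _) le_rfl

theorem Standing.lintegral_jumpMoment_lt (hM : M.Standing) :
    ∫⁻ t in Icc 0 M.T, M.jumpMoment t < ⊤ := by
  have h : Measurable fun z : ℝ => ENNReal.ofReal |z| := (measurable_id.abs).ennreal_ofReal
  simp only [jumpMoment]
  rw [lintegral_const_mul _ (Finset.measurable_sum _ fun j _ => h.lintegral_kernel (κ := M.eta j)),
    lintegral_finsetSum _ fun j _ => h.lintegral_kernel (κ := M.eta j)]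
  refine ENNReal.mul_lt_top ENNReal.ofReal_lt_top (ENNReal.sum_lt_top.2 fun j _ => ?_)
  refine (lintegral_mono fun t => lintegral_abs_eta_le j t).trans_lt ?_
  rw [lintegral_add_left measurable_const]
  refine ENNReal.add_lt_top.2 ⟨?_, hM.G_sq j⟩
  have := M.finite_ς
  simp [ENNReal.mul_lt_top_iff, measure_lt_top]

variable (M) in
/-- The real version of `jumpMoment`, cut off outside the horizon. -/
noncomputable def growth (t : ℝ) : ℝ := (Icc 0 M.T).indicator (fun t => (M.jumpMoment t).toReal) t

theorem growth_nonneg (t : ℝ) : 0 ≤ M.growth t := indicator_nonneg (fun _ _ => ENNReal.toReal_nonneg) _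

theorem Standing.integrable_growth (hM : M.Standing) : Integrable M.growth := by
  have h : IntegrableOn (fun t => (M.jumpMoment t).toReal) (Icc 0 M.T) :=
    integrable_toReal_of_lintegral_ne_top measurable_jumpMoment.aemeasurable
      hM.lintegral_jumpMoment_lt.ne
  exact h.integrable_indicator measurableSet_Icc

/-- Square integrability holds only after integration in time, so the moment may be infinite on a
null set of times. -/
theorem Standing.ae_growth (hM : M.Standing) :
    ∀ᵐ t, t ∈ Icc 0 M.T → M.jumpMoment t = ENNReal.ofReal (M.growth t) := by
  have h := ae_lt_top measurable_jumpMoment hM.lintegral_jumpMoment_lt.ne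
  rw [ae_restrict_iff' measurableSet_Icc] at h
  filter_upwards [h] with t ht htm
  rw [growth, indicator_of_mem htm, ENNReal.ofReal_toReal (ht htm).ne]

variable (M) in
/-- The factor by which the expected wealth can grow from time `t` to the horizon. -/
noncomputable def growthFactor (t : ℝ) : ℝ :=
  Real.exp (M.ρ * (1 + M.L) * (M.T - t) + ∫ r in t..M.T, M.growth r)

theorem Standing.measurable_growthFactor (hM : M.Standing) : Measurable M.growthFactor := by
  have h : Continuous fun t => ∫ r in t..M.T, M.growth r := by
    simp only [fun t => intervalIntegral.integral_symm (f := M.growth) (μ := volume) M.T t]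
    exact (intervalIntegral.continuous_primitive
      (fun a b => hM.integrable_growth.intervalIntegrable) _).neg
  exact (Measurable.add ((measurable_id.const_sub M.T).const_mul _) h.measurable).exp

/-- The expected wealth after a jump, weighted with the jump rate. -/
theorem rate_mul_jumpOp_wealth_le {x : State K} (hx : x ∈ M.stateSpace) {a : ℝ}
    (ha : |a| ≤ M.L) (ψ : ℝ → ℝ) (hψ : ∀ t, 0 ≤ ψ t) :
    ENNReal.ofReal (M.rate x) * M.jumpOp (fun y => ENNReal.ofReal (y.2.1 * ψ y.1)) x a ≤
      ENNReal.ofReal (x.2.1 * ψ x.1) * (ENNReal.ofReal (M.rate x) + M.jumpMoment x.1) := by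
  have hL : 0 ≤ M.L := (abs_nonneg a).trans ha
  have hw : 0 ≤ x.2.1 * ψ x.1 := mul_nonneg hx.2.1.le (hψ _)
  have h : Measurable fun z : ℝ => ENNReal.ofReal |z| := (measurable_id.abs).ennreal_ofReal
  have h1 : ∀ j, ∫⁻ z, ENNReal.ofReal ((M.jumpMap x a z).2.1 * ψ (M.jumpMap x a z).1)
      ∂(M.eta j x.1) ≤ ENNReal.ofReal (x.2.1 * ψ x.1) *
        (M.eta j x.1 univ + ENNReal.ofReal M.L * ∫⁻ z, ENNReal.ofReal |z| ∂(M.eta j x.1)) := by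
    intro j
    have e : ∀ z, ENNReal.ofReal ((M.jumpMap x a z).2.1 * ψ (M.jumpMap x a z).1) ≤
        ENNReal.ofReal (x.2.1 * ψ x.1) * (1 + ENNReal.ofReal M.L * ENNReal.ofReal |z|) := by
      intro z
      rw [← ENNReal.ofReal_one, ← ENNReal.ofReal_mul hL, ← ENNReal.ofReal_add zero_le_one
        (mul_nonneg hL (abs_nonneg z)), ← ENNReal.ofReal_mul hw]
      refine ENNReal.ofReal_le_ofReal ?_
      have h2 : a * z ≤ M.L * |z| := (le_abs_self _).trans (by
        rw [abs_mul]; exact mul_le_mul_of_nonneg_right ha (abs_nonneg z))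
      calc x.2.1 * (1 + a * z) * ψ x.1 = x.2.1 * ψ x.1 * (1 + a * z) := by ring
        _ ≤ x.2.1 * ψ x.1 * (1 + M.L * |z|) := mul_le_mul_of_nonneg_left (by linarith) hw
    refine (lintegral_mono e).trans_eq ?_
    rw [lintegral_const_mul _ ((h.const_mul _).const_add _), lintegral_add_left measurable_const,
      lintegral_const, one_mul, lintegral_const_mul _ h]
  rw [M.rate_mul_jumpOp hx]
  calc _ ≤ ∑ j, ENNReal.ofReal (x.2.2 j) * (ENNReal.ofReal (x.2.1 * ψ x.1) *
        (M.eta j x.1 univ + ENNReal.ofReal M.L * ∫⁻ z, ENNReal.ofReal |z| ∂(M.eta j x.1))) :=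
      Finset.sum_le_sum fun j _ => mul_le_mul' le_rfl (h1 j)
    _ = ENNReal.ofReal (x.2.1 * ψ x.1) * ((∑ j, ENNReal.ofReal (x.2.2 j) * M.eta j x.1 univ) +
        ∑ j, ENNReal.ofReal (x.2.2 j) *
          (ENNReal.ofReal M.L * ∫⁻ z, ENNReal.ofReal |z| ∂(M.eta j x.1))) := by
      rw [← Finset.sum_add_distrib, Finset.mul_sum]
      exact Finset.sum_congr rfl fun j _ => by ring
    _ ≤ _ := by
      rw [M.sum_eta_univ hx, jumpMoment, Finset.mul_sum]
      refine mul_le_mul' le_rfl (add_le_add le_rfl (Finset.sum_le_sum fun j _ => ?_))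
      refine (mul_le_mul' (ENNReal.ofReal_le_one.2 ?_) le_rfl).trans_eq (one_mul _)
      have := Finset.single_le_sum (f := x.2.2) (fun i _ => hx.2.2.1 i) (Finset.mem_univ j)
      exact this.trans_eq hx.2.2.2

/-- The function `w · growthFactor t` is superharmonic for the payoff `w` at the horizon. -/
theorem IsFlowVersion.wealth_superharmonic (hM : M.Standing) {α : State K → ℝ → ℝ}
    (hα : M.IsControl α) {Φ : State K → ℝ → State K} (hΦ : M.IsFlowVersion α Φ) {y : State K}
    (hy : y ∈ M.stateSpace) :
    M.mdmOp (extZero fun y => ENNReal.ofReal (y.2.1 * M.growthFactor y.1)) y (α y) +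
      M.noJump Φ y * ENNReal.ofReal (M.finalWealth Φ y) ≤
      ENNReal.ofReal (y.2.1 * M.growthFactor y.1) := by
  have hτ := sub_nonneg.2 hy.1.2
  have hC : 0 ≤ y.2.1 * M.growthFactor y.1 := mul_nonneg hy.2.1.le (Real.exp_pos _).le
  have hgi : ∀ a b, IntervalIntegrable (fun r => M.growth (y.1 + r)) volume a b := fun a b =>
    (hM.integrable_growth.comp_add_left y.1).intervalIntegrable
  -- A larger hazard rate: the growth of the wealth by jumps is added to the jump rate. All terms
  -- are compared with the waiting-time law of this rate, whose total mass is one.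
  obtain ⟨a, ha⟩ : ∃ a : ℝ → ℝ, a = fun r => M.rate (Φ y r) + M.growth (y.1 + r) := ⟨_, rfl⟩
  have hai : IntervalIntegrable a volume 0 (M.T - y.1) := by
    rw [ha]; exact (hΦ.intervalIntegrable_rate hy).add (hgi _ _)
  have ha0 : ∀ r ∈ Icc 0 (M.T - y.1), 0 ≤ a r := fun r hr => by
    rw [ha]; exact add_nonneg (M.rate_nonneg (hΦ.mem y hy r hr)) (growth_nonneg _)
  -- Along the flow the wealth grows at most by `exp (ρ (1 + L) s)`, which the factor loses by the
  -- passage of time. The factor also loses `exp (∫ growth)`, which is the additional part of `exp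
  -- (-∫ a)`.
  have hwealth : ∀ s ∈ Icc 0 (M.T - y.1), Real.exp (-M.hazard Φ y s) *
      ((Φ y s).2.1 * M.growthFactor (Φ y s).1) ≤
      y.2.1 * M.growthFactor y.1 * Real.exp (-∫ r in 0..s, a r) := by
    intro s hs
    have e1 : ∫ r in 0..s, a r = M.hazard Φ y s + ∫ r in y.1..(y.1 + s), M.growth r := by
      rw [ha, intervalIntegral.integral_add
        ((hΦ.intervalIntegrable_rate hy).mono_set (by
          rw [uIcc_of_le hs.1, uIcc_of_le hτ]; exact Icc_subset_Icc le_rfl hs.2)) (hgi _ _),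
        intervalIntegral.integral_comp_add_left (fun r => M.growth r), add_zero, hazard,
        intervalIntegral.integral_of_le hs.1]
    have e2 : ∫ r in y.1..M.T, M.growth r =
        (∫ r in y.1..(y.1 + s), M.growth r) + ∫ r in (y.1 + s)..M.T, M.growth r :=
      (intervalIntegral.integral_add_adjacent_intervals
        hM.integrable_growth.intervalIntegrable hM.integrable_growth.intervalIntegrable).symm
    have e3 : ∫ r in 0..s, M.ρ * (1 - α y r) ≤ M.ρ * (1 + M.L) * s := by
      have hb := intervalIntegral.norm_integral_le_of_norm_le_const (a := 0) (b := s)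
        (f := fun r => M.ρ * (1 - α y r)) (C := M.ρ * (1 + M.L)) (fun r hr => ?_)
      · rw [sub_zero, abs_of_nonneg hs.1] at hb
        exact (le_abs_self _).trans hb
      · rw [uIoc_of_le hs.1] at hr
        have hαr := hα.mem_Icc y hy r ⟨hr.1.le, by linarith [hr.2, hs.2, hy.1.1]⟩
        have hL := hM.L_pos
        rw [Real.norm_eq_abs, abs_mul, abs_of_pos hM.ρ_pos]
        refine mul_le_mul_of_nonneg_left (abs_le.2 ⟨?_, ?_⟩) hM.ρ_pos.le <;>
          linarith [hαr.1, hαr.2]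
    rw [hΦ.wealth_eq y hy s hs, hΦ.fst_eq y hy s hs, growthFactor, growthFactor, e1, e2]
    rw [show ∀ p q r : ℝ, Real.exp p * (y.2.1 * Real.exp q * Real.exp r) =
      y.2.1 * Real.exp (p + q + r) from fun p q r => by rw [Real.exp_add, Real.exp_add]; ring,
      mul_assoc y.2.1, ← Real.exp_add]
    refine mul_le_mul_of_nonneg_left (Real.exp_le_exp.2 ?_) hy.2.1.le
    linarith
  have hfinal : M.noJump Φ y * ENNReal.ofReal (M.finalWealth Φ y) ≤
      ENNReal.ofReal (y.2.1 * M.growthFactor y.1) *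
        ENNReal.ofReal (Real.exp (-∫ r in 0..(M.T - y.1), a r)) := by
    rw [noJump, ← ENNReal.ofReal_mul (Real.exp_pos _).le, ← ENNReal.ofReal_mul hC]
    refine ENNReal.ofReal_le_ofReal ((le_of_eq ?_).trans (hwealth _ ⟨hτ, le_rfl⟩))
    rw [hΦ.fst_eq y hy _ ⟨hτ, le_rfl⟩, finalWealth, add_sub_cancel, growthFactor, sub_self,
      intervalIntegral.integral_same]
    simp
  have hpre : ∀ᵐ v, v ∈ Ioc 0 (M.T - y.1) →
      M.jumpDens Φ y v * M.jumpOp (fun y => ENNReal.ofReal (y.2.1 * M.growthFactor y.1))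
        (Φ y v) (α y v) ≤
      ENNReal.ofReal (y.2.1 * M.growthFactor y.1) *
        ENNReal.ofReal (a v * Real.exp (-∫ r in 0..v, a r)) := by
    have hg := (quasiMeasurePreserving_add_left volume y.1).ae hM.ae_growth
    filter_upwards [hg] with v hv hvm
    have hv' : v ∈ Icc 0 (M.T - y.1) := ⟨hvm.1.le, hvm.2⟩
    have hyv := hΦ.mem y hy v hv'
    have hrate := M.rate_nonneg hyv
    have hαv := hα.mem_Icc y hy v ⟨hv'.1, by linarith [hv'.2, hy.1.1]⟩
    have hw0 : 0 ≤ (Φ y v).2.1 * M.growthFactor (Φ y v).1 :=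
      mul_nonneg hyv.2.1.le (Real.exp_pos _).le
    have hj := rate_mul_jumpOp_wealth_le hyv (abs_le.2 hαv) M.growthFactor
      fun t => (Real.exp_pos _).le
    have ht := hv ⟨by linarith [hy.1.1, hv'.1], by linarith [hv'.2]⟩
    rw [← hΦ.fst_eq y hy v hv'] at ht
    rw [ht, ← ENNReal.ofReal_add hrate (growth_nonneg _), ← ENNReal.ofReal_mul hw0] at hj
    rw [jumpDens, mul_comm (M.rate _), ENNReal.ofReal_mul (Real.exp_pos _).le, mul_assoc]
    refine (mul_le_mul' le_rfl hj).trans ?_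
    rw [← ENNReal.ofReal_mul (Real.exp_pos _).le, ← ENNReal.ofReal_mul hC]
    refine ENNReal.ofReal_le_ofReal ?_
    have h1 := mul_le_mul_of_nonneg_right (hwealth v hv') (ha0 v hv')
    have h2 : a v = M.rate (Φ y v) + M.growth (Φ y v).1 := by rw [ha, hΦ.fst_eq y hy v hv']
    rw [h2] at h1 ⊢
    linarith
  have hhaz := lintegral_hazard hai ha0 (s := 0) ⟨le_rfl, hτ⟩
  rw [intervalIntegral.integral_same, neg_zero, Real.exp_zero, ENNReal.ofReal_one] at hhaz
  rw [hΦ.mdmOp_eq hy, transOp]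
  simp only [extZero, Sum.elim_inl, Sum.elim_inr, mul_zero, add_zero]
  calc _ ≤ (∫⁻ v in Ioc 0 (M.T - y.1), ENNReal.ofReal (y.2.1 * M.growthFactor y.1) *
          ENNReal.ofReal (a v * Real.exp (-∫ r in 0..v, a r))) +
        ENNReal.ofReal (y.2.1 * M.growthFactor y.1) *
          ENNReal.ofReal (Real.exp (-∫ r in 0..(M.T - y.1), a r)) :=
      add_le_add (lintegral_mono_ae ((ae_restrict_iff' measurableSet_Ioc).2 hpre)) hfinal
    _ = ENNReal.ofReal (y.2.1 * M.growthFactor y.1) := by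
      rw [lintegral_const_mul' _ _ ENNReal.ofReal_ne_top, ← mul_add, hhaz, mul_one]

theorem IsMDMLaw.tsum_wealth_le (hM : M.Standing) {h : Strategy K} (hh : M.Admissible h)
    {x : State K} (hx : x ∈ M.stateSpace) {μ : Measure (PathSpace K)} (hμ : M.IsMDMLaw h x μ)
    {Φ : ℕ → State K → ℝ → State K} (hΦ : ∀ n, M.IsFlowVersion (h n) (Φ n)) :
    ∑' n, ∫⁻ ω, extZero (fun y => M.noJump (Φ n) y *
      ENNReal.ofReal (M.finalWealth (Φ n) y)) (ω n) ∂μ ≤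
      ENNReal.ofReal (x.2.1 * M.growthFactor x.1) :=
  hμ.tsum_lintegral_le hM hh hx (v := fun y => ENNReal.ofReal (y.2.1 * M.growthFactor y.1))
    (measurable_snd.fst.mul (hM.measurable_growthFactor.comp measurable_fst)).ennreal_ofReal
    (fun n => (hΦ n).measurable_noJump.mul (hΦ n).measurable_finalWealth.ennreal_ofReal)
    fun n _ hy => (hΦ n).wealth_superharmonic hM (hh.isControl n) hy

/-! ### Expected utility -/

/-- `U` is arbitrary outside `(0, ∞)`, so only its cut-off is measurable in general; the terminal
wealth is almost surely positive. -/
theorem _root_.IsUtility.measurable_indicator {U : ℝ → ℝ} (hU : IsUtility U) :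
    Measurable ((Ioi 0).indicator U) := by
  have h := hU.contDiffOn.continuousOn
  exact h.measurable_piecewise continuousOn_const measurableSet_Ioi

/-- Concave functions grow at most linearly. -/
theorem _root_.IsUtility.exists_le_affine {U : ℝ → ℝ} (hU : IsUtility U) :
    ∃ A B : ℝ, 0 ≤ A ∧ 0 ≤ B ∧ ∀ w, 0 < w → U w ≤ A + B * w := by
  have hc := hU.strictConcaveOn.concaveOn
  have hmono := hU.strictMonoOn
  have h12 : U 1 < U 2 := hmono (mem_Ioi.2 one_pos) (mem_Ioi.2 two_pos) one_lt_two
  refine ⟨|U 2|, U 2 - U 1, abs_nonneg _, by linarith, fun w hw => ?_⟩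
  have hU2 := le_abs_self (U 2)
  rcases le_or_gt w 2 with h2 | h2
  · have := hmono.monotoneOn (mem_Ioi.2 hw) (mem_Ioi.2 two_pos) h2
    nlinarith
  -- Beyond `2` the slope is at most the slope between `1` and `2`.
  · have := hc.slope_anti_adjacent (mem_Ioi.2 one_pos) (mem_Ioi.2 hw) one_lt_two h2
    rw [div_le_div_iff₀ (by linarith) (by norm_num)] at this
    nlinarith

end MarketData

namespace MarketData

variable {K : ℕ} {M : MarketData K} {U : ℝ → ℝ} {h : Strategy K} {x : State K}
  {μ : Measure (PathSpace K)}

/-- The expected positive part of the utility of the terminal wealth is finite. -/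
theorem IsMDMLaw.tsum_utility_ne_top (hM : M.Standing) (hU : IsUtility U) (hh : M.Admissible h)
    (hx : x ∈ M.stateSpace) (hμ : M.IsMDMLaw h x μ)
    {Φ : ℕ → State K → ℝ → State K} (hΦ : ∀ n, M.IsFlowVersion (h n) (Φ n)) :
    ∑' n, ∫⁻ ω, extZero (fun y => M.noJump (Φ n) y *
      ENNReal.ofReal ((Ioi 0).indicator U (M.finalWealth (Φ n) y))) (ω n) ∂μ ≠ ⊤ := by
  obtain ⟨A, B, hA, hB, hAB⟩ := hU.exists_le_affine
  have hm1 : ∀ n, Measurable fun ω : PathSpace K => extZero (M.noJump (Φ n)) (ω n) :=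
    fun n => measurable_extZero_path (hΦ n).measurable_noJump n
  have hm2 : ∀ n, Measurable fun ω : PathSpace K => extZero (fun y => M.noJump (Φ n) y *
      ENNReal.ofReal (M.finalWealth (Φ n) y)) (ω n) := fun n => measurable_extZero_path
    ((hΦ n).measurable_noJump.mul (hΦ n).measurable_finalWealth.ennreal_ofReal) n
  have hle : ∀ n, ∫⁻ ω, extZero (fun y => M.noJump (Φ n) y *
      ENNReal.ofReal ((Ioi 0).indicator U (M.finalWealth (Φ n) y))) (ω n) ∂μ ≤
      ENNReal.ofReal A * ∫⁻ ω, extZero (M.noJump (Φ n)) (ω n) ∂μ +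
      ENNReal.ofReal B * ∫⁻ ω, extZero (fun y => M.noJump (Φ n) y *
        ENNReal.ofReal (M.finalWealth (Φ n) y)) (ω n) ∂μ := by
    intro n
    rw [← lintegral_const_mul _ (hm1 n), ← lintegral_const_mul _ (hm2 n),
      ← lintegral_add_left ((hm1 n).const_mul _)]
    refine lintegral_mono_ae ?_
    filter_upwards [hμ.ae_mem_chainSpace hM hh hx n] with ω hω
    rcases hy : ω n with y | u
    · rw [hy] at hω
      have hw := (hΦ n).finalWealth_pos (inl_mem_chainSpace.1 hω)
      simp only [extZero, Sum.elim_inl]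
      rw [indicator_of_mem (mem_Ioi.2 hw), mul_comm (ENNReal.ofReal A), mul_left_comm, ← mul_add,
        ← ENNReal.ofReal_mul hB, ← ENNReal.ofReal_add hA (mul_nonneg hB hw.le)]
      exact mul_le_mul' le_rfl (ENNReal.ofReal_le_ofReal (hAB _ hw))
    · exact zero_le
  refine ne_top_of_le_ne_top ?_ (ENNReal.tsum_le_tsum hle)
  rw [ENNReal.tsum_add, ENNReal.tsum_mul_left, ENNReal.tsum_mul_left]
  exact ENNReal.add_ne_top.2
    ⟨ENNReal.mul_ne_top ENNReal.ofReal_ne_top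
      (ne_top_of_le_ne_top ENNReal.one_ne_top (hμ.tsum_noJump_le hM hh hx hΦ)),
    ENNReal.mul_ne_top ENNReal.ofReal_ne_top
      (ne_top_of_le_ne_top ENNReal.ofReal_ne_top (hμ.tsum_wealth_le hM hh hx hΦ))⟩

/-- The utility of the terminal wealth and the total reward have the same expectation. -/
theorem IsMDMLaw.extExpectation_eq (hM : M.Standing) (hU : IsUtility U) (hh : M.Admissible h)
    (hx : x ∈ M.stateSpace) (hμ : M.IsMDMLaw h x μ) :
    ∫⁻ ω, ENNReal.ofReal (U (M.terminalWealth h ω)) ∂μ < ⊤ ∧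
    ∫⁻ ω, ENNReal.ofReal (M.totalReward U h ω) ∂μ < ⊤ ∧
    (extExpectation μ fun ω => U (M.terminalWealth h ω)) =
      extExpectation μ (M.totalReward U h) := by
  choose Φ hΦ using fun n => hM.exists_flowVersion (hh.isControl n)
  obtain ⟨V, hV⟩ : ∃ V : ℝ → ℝ, V = (Ioi 0).indicator U := ⟨_, rfl⟩
  have hVU : ∀ w, 0 < w → V w = U w := fun w hw => by rw [hV, indicator_of_mem (mem_Ioi.2 hw)]
  have hVm : Measurable V := by rw [hV]; exact hU.measurable_indicator
  have hVn : Measurable fun w => -V w := hVm.neg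
  have hlast := hμ.ae_exists_last hM hh hx
  have hW : ∀ᵐ ω ∂μ, V (M.terminalWealth h ω) = U (M.terminalWealth h ω) := by
    filter_upwards [hlast] with ω ⟨n, hω, hω'⟩
    obtain ⟨y, hyS, hy⟩ := hω n le_rfl
    rw [terminalWealth_eq (hΦ n) hω hω' hy, hVU _ ((hΦ n).finalWealth_pos hyS)]
  obtain ⟨r, hr⟩ : ∃ r : (ℝ → ℝ) → ℕ → State K → ℝ≥0∞, r = fun F n y =>
    M.noJump (Φ n) y * ENNReal.ofReal (F (M.finalWealth (Φ n) y)) := ⟨_, rfl⟩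
  have hrm : ∀ F : ℝ → ℝ, Measurable F → ∀ n, Measurable (r F n) := fun F hF n => by
    rw [hr]
    exact (hΦ n).measurable_noJump.mul (hF.comp (hΦ n).measurable_finalWealth).ennreal_ofReal
  have hpath : ∀ F : ℝ → ℝ, Measurable F → ∫⁻ ω, ENNReal.ofReal (F (M.terminalWealth h ω)) ∂μ =
      ∫⁻ ω, ∑' n, extZero (r F n) (ω n) ∂μ := by
    intro F hF
    rw [lintegral_tsum fun n => (measurable_extZero_path (hrm F hF n) n).aemeasurable, hr]
    exact hμ.lintegral_terminalWealth hM hh hx hΦ (f := fun w => ENNReal.ofReal (F w))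
      hF.ennreal_ofReal
  have hfin : ∫⁻ ω, ∑' n, extZero (r V n) (ω n) ∂μ ≠ ⊤ := by
    rw [lintegral_tsum fun n => (measurable_extZero_path (hrm V hVm n) n).aemeasurable, hr, hV]
    exact hμ.tsum_utility_ne_top hM hU hh hx hΦ
  have hsum : ∀ F : ℝ → ℝ, Measurable F →
      Measurable fun ω : PathSpace K => ∑' n, extZero (r F n) (ω n) := fun F hF =>
    Measurable.tsum fun n => measurable_extZero_path (hrm F hF n) n
  -- The total reward is the difference of the discounted sums for `V` and `-V`; their expectations
  -- are those of the positive and negative part of the utility.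
  have hX : ∀ᵐ ω ∂μ, ∑' n, extZero (r V n) (ω n) ≠ ⊤ ∧
      ∑' n, extZero (r (fun w => -V w) n) (ω n) ≠ ⊤ ∧
      M.totalReward U h ω = (∑' n, extZero (r V n) (ω n)).toReal -
        (∑' n, extZero (r (fun w => -V w) n) (ω n)).toReal := by
    filter_upwards [hlast] with ω ⟨n, hω, hω'⟩
    have h1 := totalReward_eq (U := V) hΦ hω hω'
    rw [hr]
    have h2 : M.totalReward U h ω = M.totalReward V h ω := by
      refine tsum_congr fun k => ?_
      rcases le_or_gt k n with hk | hk
      · obtain ⟨y, hyS, hy⟩ := hω k hk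
        rw [hy]
        simp only [Sum.elim_inl, stageReward]
        rw [(hΦ k).finalWealth_eq hyS, hVU _ ((hΦ k).finalWealth_pos hyS)]
      · rw [hω' k hk]
        rfl
    rw [h2]
    exact h1
  have hX' := extExpectation_sub (hsum V hVm) (hsum _ hVn) hfin hX
  have e1 : ∫⁻ ω, ENNReal.ofReal (U (M.terminalWealth h ω)) ∂μ =
      ∫⁻ ω, ∑' n, extZero (r V n) (ω n) ∂μ := by
    rw [← hpath V hVm]
    refine lintegral_congr_ae ?_
    filter_upwards [hW] with ω hω
    rw [hω]
  have e2 : ∫⁻ ω, ENNReal.ofReal (-U (M.terminalWealth h ω)) ∂μ =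
      ∫⁻ ω, ∑' n, extZero (r (fun w => -V w) n) (ω n) ∂μ := by
    rw [← hpath _ hVn]
    refine lintegral_congr_ae ?_
    filter_upwards [hW] with ω hω
    rw [hω]
  refine ⟨by rw [e1]; exact hfin.lt_top, hX'.1.trans_lt hfin.lt_top, ?_⟩
  rw [hX'.2, extExpectation, e1, e2]

/-! ### Equality of the laws, the rewards and the value functions -/

/-- The two predicates coincide, hence so do the measures that `epsilon` selects from them. -/
theorem pdmpLaw_eq_mdmLaw (hM : M.Standing) (hh : M.Admissible h) (hx : x ∈ M.stateSpace) :
    M.pdmpLaw h x = M.mdmLaw h x := by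
  rw [pdmpLaw, mdmLaw]
  congr 1
  funext μ
  exact propext (isPDMPLaw_iff_isMDMLaw hM hh hx)

theorem isMDMLaw_mdmLaw (hM : M.Standing) (hh : M.Admissible h) (hx : x ∈ M.stateSpace) :
    M.IsMDMLaw h x (M.mdmLaw h x) :=
  Classical.epsilon_spec (existsUnique_isMDMLaw hM hh hx).exists

theorem pdmpReward_eq_mdmReward (hM : M.Standing) (hU : IsUtility U) (hh : M.Admissible h)
    (hx : x ∈ M.stateSpace) : M.pdmpReward U h x = M.mdmReward U h x := by
  rw [pdmpReward, mdmReward, pdmpLaw_eq_mdmLaw hM hh hx]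
  exact ((isMDMLaw_mdmLaw hM hh hx).extExpectation_eq hM hU hh hx).2.2

end MarketData

theorem lemma4p2 {K : ℕ} (M : MarketData K) (hM : M.Standing) (U : ℝ → ℝ) (hU : IsUtility U) :
    (∀ h : Strategy K, M.Admissible h → ∀ x ∈ M.stateSpace,
      -- the laws of the PDMP and of the Markov decision model exist and are unique
      (∃! μ, M.IsPDMPLaw h x μ) ∧ (∃! ν, M.IsMDMLaw h x ν) ∧
      -- the two expectations are well defined in `[-∞, ∞)`
      ∫⁻ ω, ENNReal.ofReal (U (M.terminalWealth h ω)) ∂(M.pdmpLaw h x) < ⊤ ∧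
      ∫⁻ ω, ENNReal.ofReal (M.totalReward U h ω) ∂(M.mdmLaw h x) < ⊤ ∧
      (∀ᵐ ω ∂(M.mdmLaw h x), ∃ N, ∀ n ≥ N, ω n = Sum.inr ()) ∧
      M.pdmpReward U h x = M.mdmReward U h x) ∧
    ∀ x ∈ M.stateSpace, M.pdmpValue U x = M.mdmValue U x := by
  refine ⟨fun h hh x hx => ?_, fun x hx => ?_⟩
  · have hμ := MarketData.isMDMLaw_mdmLaw hM hh hx
    have hE := hμ.extExpectation_eq hM hU hh hx
    refine ⟨?_, MarketData.existsUnique_isMDMLaw hM hh hx, ?_, hE.2.1, hμ.ae_absorbed hM hh hx,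
      MarketData.pdmpReward_eq_mdmReward hM hU hh hx⟩
    · simpa only [MarketData.isPDMPLaw_iff_isMDMLaw hM hh hx] using
        MarketData.existsUnique_isMDMLaw hM hh hx
    · rw [MarketData.pdmpLaw_eq_mdmLaw hM hh hx]
      exact hE.1
  · rw [MarketData.pdmpValue, MarketData.mdmValue]
    exact iSup_congr fun h => iSup_congr fun hh => MarketData.pdmpReward_eq_mdmReward hM hU hh hx
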